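/- Let $n\ge 2$, $0\le m\le n$, $\Pi=[0,1]\times[0,\infty)$. Consider the problem, for $u=(u_1,\dots,u_n)$ with values in $\mathbb R^n$, $$\partial_t u_j+a_j(x,t)\,\partial_x u_j+b_j(x,t)\,u_j=0\quad(0<x<1,\ t>0,\ j\le n),$$ $$u(x,0)=\varphi(x)\quad(0\le x\le 1),\qquad u^{out}(t)=h(t,u^{in}(t))\quad(t\ge 0),$$ where $a_j,b_j:\Pi\to\mathbb R$, $h:[0,\infty)\times\mathbb R^n\to\mathbb R^n$, and, for a function $u$ on $\Pi$, $u^{out}=(u_1(0,\cdot),\dots,u_m(0,\cdot),u_{m+1}(1,\cdot),\dots,u_n(1,\cdot))$ and $u^{in}=(u_1(1,\cdot),\dots,u_m(1,\cdot),u_{m+1}(0,\cdot),\dots,u_n(0,\cdot))$; likewise $\varphi^{out},\varphi^{in}\in\mathbb R^n$ for a function $\varphi$ on $[0,1]$. Assume that, for some $\alpha>0$, $a_j\ge\alpha$ on $\Pi$ for $j\le m$ and $a_j\le-\alpha$ on $\Pi$ for $j>m$; that $a_j,b_j,h$ are continuous, $a_j$ is Lipschitz in $t$ uniformly on $[0,1]\times[0,T]$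 for each $T>0$, and $h(t,\cdot)$ is differentiable for each $t$; that $h(t,0)=0$ for all $t\ge0$; and that for each $T>0$ there are $C>0$ and a polynomial $H$ with $H\ge e$ on $[0,\infty)$ such that $\max_{j,k}|\partial_{\xi_k}h_j(t,\xi)|\le C(\log\log H(\|\xi\|))^{1/4}$ for all $0\le t\le T$, $\xi\in\mathbb R^n$, where $\|\xi\|=\max_i|\xi_i|$. **Notation.** $C_h([0,1])^n$ is the set of $\varphi\in C([0,1])^n$ with $\varphi^{out}=h(0,\varphi^{in})$; $C_h^1([0,1])^n=C_h([0,1])^n\cap C^1([0,1])^n$; $C_h(\Pi)^n$ is the set of $u\in C(\Pi)^n$ with $u^{out}(0)=h(0,u^{in}(0))$. For $(x,t)\in\Pi$ let $\omega_j(\cdot,x,t)$ solve $\partial_\xi\omega_j=1/a_j(\xi,\omega_j)$, $\omega_j(x,x,t)=t$ (the $j$-th characteristic through $(x,t)$); let $x_j(x,t)$ be the abscissa of that end point of this characteristic curve in $\Pi$ which has the smaller ordinate, and let $c_j(\xi,x,t)=\exp\int_x^\xi (b_j/a_j)(\eta,\omega_j(\eta,x,t))\,d\eta$. Let $e_j=0$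 for $j\le m$ and $e_j=1$ for $j>m$. For $\varphi:[0,1]\to\mathbb R^n$ define $Q=Q_\varphi$ by, with $x_j=x_j(x,t)$, $$[Qu]_j(x,t)=\begin{cases}c_j(x_j,x,t)\,h_j\bigl(\tau,u^{in}(\tau)\bigr)\big|_{\tau=\omega_j(x_j,x,t)},& x_j=e_j,\\ c_j(x_j,x,t)\,\varphi_j(x_j),&\text{otherwise.}\end{cases}$$ **Solutions.** A *continuous solution* is $u\in C_h(\Pi)^n$ with $u(\cdot,0)=\varphi$ and $u=Q_\varphi u$ on $\Pi$. A *piecewise continuously differentiable solution* is a continuous $u:\Pi\to\mathbb R^n$ that satisfies the initial and boundary conditions and, off at most countably many characteristic curves, is continuously differentiable and satisfies the differential equations. If $a_j,b_j,h_j$ are continuously differentiable in all arguments and $\varphi\in L^2(0,1)^n$, an *$L^2$-generalized solution* is $u\in C([0,\infty),L^2(0,1)^n)$ such that, for every sequence $\varphi^l\in C_h^1([0,1])^n$ converging to $\varphi$ in $L^2(0,1)^n$, the piecewise continuously differentiable solutions $u^l$ with initial functions $\varphi^l$ satisfy $\|u^l(\cdot,t)-u(\cdot,t)\|_{L^2(0,1)^n}\to0$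 uniformly in $t\in[0,T]$, for each $T>0$. **Theorem.** Consider the condition (C) there are $T>0$ and $k\in\mathbb N$ such that $[Q^kw](x,T)=0$ for all $w\in C_h(\Pi)^n$ and all $x\in[0,1]$, where $Q=Q_\varphi$ with $\varphi(x)=w(x,0)$. 1. Suppose that $a_j,b_j,h_j$ are continuously differentiable in all arguments and that an $L^2$-generalized solution exists for every $\varphi\in L^2(0,1)^n$. Then there is $T>0$ such that for every $\varphi\in L^2(0,1)^n$ the $L^2$-generalized solution vanishes for all $t>T$ (the problem is finite time stabilizable) if and only if (C) holds. 2. Suppose that a continuous solution exists for every $\varphi\in C_h([0,1])^n$. Then there is $T>0$ such that for every $\varphi\in C_h([0,1])^n$ the continuous solution vanishes for all $t>T$ (the problem is finite time stabilizable) if and only if (C) holds. -/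

import Mathlib

open Set Filter Topology MeasureTheory

/-- The closed half-strip `Π = {(x, t) : 0 ≤ x ≤ 1, t ≥ 0}`; points are pairs `(x, t)`. -/
def halfStrip : Set (ℝ × ℝ) := Icc (0 : ℝ) 1 ×ˢ Ici (0 : ℝ)

/-- The Hilbert space `L²(0,1)ⁿ` with `‖u‖² = ∫₀¹ ∑ᵢ uᵢ² dx`. -/
abbrev L2Space (n : ℕ) : Type :=
  Lp (EuclideanSpace ℝ (Fin n)) 2 (volume.restrict (Ioo (0 : ℝ) 1))

/-- The `L²(0,1)ⁿ`-distance `‖f - g‖` between a function `f` and an element `g` of `L²(0,1)ⁿ`. -/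
noncomputable def l2Dist {n : ℕ} (f : ℝ → Fin n → ℝ) (g : L2Space n) : ENNReal :=
  eLpNorm (fun x => WithLp.toLp 2 (f x) - g x) 2 (volume.restrict (Ioo (0 : ℝ) 1))

/-- The data of the initial-boundary value problem
`∂ₜ uⱼ + aⱼ(x,t) ∂ₓ uⱼ + bⱼ(x,t) uⱼ = 0`, `u(x,0) = φ(x)`, `u^out(t) = h(t, u^in(t))`.
The first `m` components travel to the right, the others to the left. The values of `a`, `b`
outside the half-strip and of `h` at negative times are irrelevant. -/
structure HyperbolicProblem (n : ℕ) where
  m : ℕ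
  a : Fin n → ℝ × ℝ → ℝ
  b : Fin n → ℝ × ℝ → ℝ
  h : ℝ → (Fin n → ℝ) → Fin n → ℝ

namespace HyperbolicProblem

variable {n : ℕ} (P : HyperbolicProblem n)

/-- `inf aⱼ ≥ α` for the first `m` components and `sup aⱼ ≤ -α` for the others, some `α > 0`. -/
def SpeedBounds : Prop :=
  ∃ α : ℝ, 0 < α ∧ ∀ j : Fin n, ∀ p ∈ halfStrip,
    ((j : ℕ) < P.m → α ≤ P.a j p) ∧ (P.m ≤ (j : ℕ) → P.a j p ≤ -α)

/-- The regularity that is needed for characteristics and for the propagation operator to be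
well defined: continuous data, and `aⱼ` locally Lipschitz in `t`. -/
def BasicRegularity : Prop :=
  (∀ j, ContinuousOn (P.a j) halfStrip) ∧
  (∀ j, ∀ T : ℝ, 0 < T → ∃ L : ℝ, ∀ x ∈ Icc (0 : ℝ) 1, ∀ s ∈ Icc 0 T, ∀ t ∈ Icc 0 T,
    |P.a j (x, s) - P.a j (x, t)| ≤ L * |s - t|) ∧
  (∀ j, ContinuousOn (P.b j) halfStrip) ∧
  ContinuousOn (fun q : ℝ × (Fin n → ℝ) => P.h q.1 q.2) (Ici (0 : ℝ) ×ˢ univ)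

/-- `aⱼ`, `bⱼ`, `hⱼ` are continuously differentiable in all their arguments. -/
def C1Regularity : Prop :=
  (∀ j, ContDiffOn ℝ 1 (P.a j) halfStrip) ∧
  (∀ j, ContDiffOn ℝ 1 (P.b j) halfStrip) ∧
  ContDiffOn ℝ 1 (fun q : ℝ × (Fin n → ℝ) => P.h q.1 q.2) (Ici (0 : ℝ) ×ˢ univ)

/-- `‖∇_ξ h(t,ξ)‖_max ≤ C(T) (log log H(‖ξ‖))^{1/4}` for `0 ≤ t ≤ T`. The lower bound
on the polynomial `H` says that the right-hand side is a real number. -/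
def GrowthCondition : Prop :=
  (∀ t : ℝ, 0 ≤ t → Differentiable ℝ (P.h t)) ∧
  ∀ T : ℝ, 0 < T → ∃ C : ℝ, 0 < C ∧ ∃ H : Polynomial ℝ,
    (∀ s : ℝ, 0 ≤ s → Real.exp 1 ≤ H.eval s) ∧
    ∀ t ∈ Icc 0 T, ∀ ξ : Fin n → ℝ, ∀ j k : Fin n,
      |fderiv ℝ (P.h t) ξ (Pi.single k 1) j| ≤
        C * (Real.log (Real.log (H.eval ‖ξ‖))) ^ (1 / 4 : ℝ)

/-- The abscissa of the boundary on which the `j`-th component enters the strip. -/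
def inAbscissa (j : Fin n) : ℝ := if (j : ℕ) < P.m then 0 else 1

/-- The abscissa of the boundary on which the `j`-th component leaves the strip. -/
def outAbscissa (j : Fin n) : ℝ := if (j : ℕ) < P.m then 1 else 0

/-- `φ^out = (φ₁(0),…,φₘ(0),φₘ₊₁(1),…,φₙ(1))`. -/
def outTrace (f : ℝ → Fin n → ℝ) : Fin n → ℝ := fun j => f (P.inAbscissa j) j

/-- `φ^in = (φ₁(1),…,φₘ(1),φₘ₊₁(0),…,φₙ(0))`. -/
def inTrace (f : ℝ → Fin n → ℝ) : Fin n → ℝ := fun j => f (P.outAbscissa j) j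

/-- The space `C_h([0,1])ⁿ`: continuous functions with `φ^out = h(0, φ^in)`. -/
def Ch : Set (ℝ → Fin n → ℝ) :=
  {φ | ContinuousOn φ (Icc 0 1) ∧ P.outTrace φ = P.h 0 (P.inTrace φ)}

/-- The space `C¹_h([0,1])ⁿ`. -/
def C1h : Set (ℝ → Fin n → ℝ) :=
  {φ | φ ∈ P.Ch ∧ ContDiffOn ℝ 1 φ (Icc 0 1)}

/-- The space `C_h(Π)ⁿ`: continuous functions on `Π` with `u^out(0) = h(0, u^in(0))`. -/
def ChStrip : Set (ℝ × ℝ → Fin n → ℝ) :=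
  {u | ContinuousOn u halfStrip ∧
    P.outTrace (fun x => u (x, 0)) = P.h 0 (P.inTrace (fun x => u (x, 0)))}

/-- `γ` solves `γ'(ξ) = 1 / aⱼ(ξ, γ(ξ))` on `[0,1]`, `γ(x) = t`, with `p = (x, t)`. Below the
line `t = 0`, where `aⱼ` is not given, it is continued by its value at `t = 0`; the part of
`γ` in `Π` does not depend on this. -/
def IsCharacteristic (j : Fin n) (p : ℝ × ℝ) (γ : ℝ → ℝ) : Prop :=
  γ p.1 = p.2 ∧ ∀ ξ ∈ Icc (0 : ℝ) 1,
    HasDerivWithinAt γ (1 / P.a j (ξ, max (γ ξ) 0)) (Icc 0 1) ξ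

/-- The `j`-th characteristic `ξ ↦ ωⱼ(ξ, x, t)` through `p = (x, t)`, for `ξ ∈ [0,1]`. -/
noncomputable def charac (j : Fin n) (p : ℝ × ℝ) : ℝ → ℝ :=
  Classical.epsilon (P.IsCharacteristic j p)

/-- The curve in `Π` that is traced by the `j`-th characteristic through `p`. -/
def characCurve (j : Fin n) (p : ℝ × ℝ) : Set (ℝ × ℝ) :=
  {q ∈ halfStrip | q.2 = P.charac j p q.1}

/-- `xⱼ(x,t)`: the abscissa of the end point with the smaller ordinate of the characteristic
curve through `p = (x, t)` in `Π`. The ordinate increases with the abscissa for the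
first `m` components and decreases for the others. -/
noncomputable def foot (j : Fin n) (p : ℝ × ℝ) : ℝ :=
  if (j : ℕ) < P.m then sInf {ξ ∈ Icc (0 : ℝ) 1 | 0 ≤ P.charac j p ξ}
  else sSup {ξ ∈ Icc (0 : ℝ) 1 | 0 ≤ P.charac j p ξ}

/-- `cⱼ(ξ,x,t) = exp ∫ₓ^ξ (bⱼ/aⱼ)(η, ωⱼ(η,x,t)) dη`. -/
noncomputable def weight (j : Fin n) (ξ : ℝ) (p : ℝ × ℝ) : ℝ :=
  Real.exp (∫ η in p.1..ξ, P.b j (η, P.charac j p η) / P.a j (η, P.charac j p η))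

/-- `[Ru]ⱼ(t) = hⱼ(t, u^in(t))`. -/
def boundaryOp (u : ℝ × ℝ → Fin n → ℝ) (t : ℝ) : Fin n → ℝ :=
  P.h t (P.inTrace (fun x => u (x, t)))

/-- `[Sv]ⱼ(x,t) = cⱼ(xⱼ(x,t),x,t) vⱼ(ωⱼ(xⱼ(x,t),x,t))`. -/
noncomputable def shiftOp (v : ℝ → Fin n → ℝ) (p : ℝ × ℝ) : Fin n → ℝ :=
  fun j => P.weight j (P.foot j p) p * v (P.charac j p (P.foot j p)) j

/-- The propagation operator `Q = Q_φ`: `[Qu]ⱼ = [SRu]ⱼ` where the characteristic starts on the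
lateral boundary, and `[Qu]ⱼ(x,t) = cⱼ(xⱼ,x,t) φⱼ(xⱼ)` where it starts at the initial time.
The `j`-th characteristic of a point with `t > 0` can start only on that lateral side on
which the `j`-th component enters; at the corner from which the component leaves,
`[Qu]ⱼ` is the value of `φⱼ`. -/
noncomputable def Q (φ : ℝ → Fin n → ℝ) (u : ℝ × ℝ → Fin n → ℝ) : ℝ × ℝ → Fin n → ℝ :=
  fun p j =>
    if P.foot j p = P.inAbscissa j then P.shiftOp (P.boundaryOp u) p j
    else P.weight j (P.foot j p) p * φ (P.foot j p) j

/-- Continuous solutions: `u ∈ D(Q_φ)` with `u = Q_φ u` in `Π`. -/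
def IsContinuousSolution (φ : ℝ → Fin n → ℝ) (u : ℝ × ℝ → Fin n → ℝ) : Prop :=
  u ∈ P.ChStrip ∧ (∀ x ∈ Icc (0 : ℝ) 1, u (x, 0) = φ x) ∧ ∀ p ∈ halfStrip, u p = P.Q φ u p

/-- Piecewise continuously differentiable solutions: `u` is continuous on `Π`, is continuously
differentiable off countably many characteristic curves, satisfies the differential
equations off these curves, and satisfies the initial and boundary conditions. -/
def IsPiecewiseC1Solution (φ : ℝ → Fin n → ℝ) (u : ℝ × ℝ → Fin n → ℝ) : Prop :=
  ContinuousOn u halfStrip ∧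
  (∃ E : Set (Fin n × (ℝ × ℝ)), E.Countable ∧ (∀ e ∈ E, e.2 ∈ halfStrip) ∧
    ∀ p ∈ halfStrip, (∀ e ∈ E, p ∉ P.characCurve e.1 e.2) →
      ContDiffWithinAt ℝ 1 u halfStrip p ∧
      (0 < p.1 → p.1 < 1 → 0 < p.2 → ∀ j : Fin n,
        fderiv ℝ u p (0, 1) j + P.a j p * fderiv ℝ u p (1, 0) j + P.b j p * u p j = 0)) ∧
  (∀ x ∈ Icc (0 : ℝ) 1, u (x, 0) = φ x) ∧
  (∀ t : ℝ, 0 ≤ t →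
    P.outTrace (fun x => u (x, t)) = P.h t (P.inTrace (fun x => u (x, t))))

/-- `L²`-generalized solutions `u ∈ C([0,∞), L²(0,1)ⁿ)`: for all `φˡ ∈ C¹_h([0,1])ⁿ` with
`φˡ → φ` in `L²(0,1)ⁿ`, the piecewise continuously differentiable solutions `uˡ` with
initial data `φˡ` converge to `u` in `L²(0,1)ⁿ` uniformly in `t ∈ [0,T]`, for each `T > 0`. -/
def IsL2Solution (φ : L2Space n) (u : ℝ → L2Space n) : Prop :=
  ContinuousOn u (Ici 0) ∧
  ∀ (φl : ℕ → ℝ → Fin n → ℝ) (ul : ℕ → ℝ × ℝ → Fin n → ℝ),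
    (∀ l, φl l ∈ P.C1h) →
    Tendsto (fun l => l2Dist (φl l) φ) atTop (𝓝 0) →
    (∀ l, P.IsPiecewiseC1Solution (φl l) (ul l)) →
    ∀ T : ℝ, 0 < T →
      Tendsto (fun l => ⨆ t ∈ Icc 0 T, l2Dist (fun x => ul l (x, t)) (u t)) atTop (𝓝 0)

/-- Finite time stabilizability in the sense of `L²`-generalized solutions. -/
def IsFTSL2 : Prop :=
  ∃ T : ℝ, 0 < T ∧ ∀ (φ : L2Space n) (u : ℝ → L2Space n), P.IsL2Solution φ u →
    ∀ t : ℝ, T < t → u t = 0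

/-- Finite time stabilizability in the sense of continuous solutions. -/
def IsFTSContinuous : Prop :=
  ∃ T : ℝ, 0 < T ∧ ∀ φ ∈ P.Ch, ∀ u : ℝ × ℝ → Fin n → ℝ, P.IsContinuousSolution φ u →
    ∀ x ∈ Icc (0 : ℝ) 1, ∀ t : ℝ, T < t → u (x, t) = 0

/-- There are `T > 0` and `k` with `[Q^k w](x,T) = 0` for all `w ∈ C_h(Π)ⁿ` and `x ∈ [0,1]`,
where `Q = Q_φ` for `φ(x) = w(x,0)`. -/
def PropagationVanishes : Prop :=
  ∃ T : ℝ, 0 < T ∧ ∃ k : ℕ, ∀ w ∈ P.ChStrip, ∀ x ∈ Icc (0 : ℝ) 1,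
    ((P.Q (fun y => w (y, 0)))^[k] w) (x, T) = 0

end HyperbolicProblem

/-! Information moves along characteristics, and a characteristic that leaves the strip at a time `t
≤ T` has, if continued below `t = 0` where necessary, its entry ordinate at most `t - δ` with some
`δ = δ(T) > 0` (`exists_crossing_time`). A component of `Q_φ u` at a point involves either `φ` at
one foot or the outgoing traces of `u` at one earlier time (`Q_congr`). Hence on `[0, T]` all
sufficiently high iterates of `Q_φ` agree, whatever function they are applied to
(`exists_iterate_Q_stable`), and they equal the solution if there is one. Vanishing of such an
iterate at time `T` is therefore vanishing of the solution at time `T`, and this persists because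
`h(t, 0) = 0` (`eq_zero_of_fixed`). This settles the case of continuous solutions.

For `L²`-generalized solutions, (C) implies stabilizability by density: initial functions that are
smooth and vanish near the end points have classical solutions, these vanish after a common time,
and so do their limits. Conversely, stabilizability says that these classical solutions vanish at
some common time `T`, and one has to reach every `w ∈ C_h(Π)ⁿ`. Only finitely many characteristics
arise when a component at a point is traced back through `K` reflections. Away from countably many
points of the line `t = T`, a component of `Q_φ^K w` thus depends on `φ` at finitely many points of
the open interval only (`exists_finset_iterate_Q_eq`). A smooth function that vanishes near the end
points can take the same values there, so the component equals that of a classical solution, which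
is zero; continuity covers the exceptional points (`propagationVanishes_of_smooth`).

The analytic work is the existence of these classical solutions. Since the iterates become
stationary, it suffices that `Q` preserves `C¹` regularity. By transport, `Qu` is an outgoing trace
evaluated at the exit time, times a weight. Exit time and weight are expressed through integrals
along characteristics, which are differentiated by hand up to the boundary of the closed half-strip
(`hasFDerivWithinAt_charInt`). -/

open Asymptotics

/-! ### A Gronwall inequality -/

/-- A two-sided Gronwall inequality for a homogeneous differential inequality. -/
theorem abs_le_mul_exp_of_abs_deriv_le {a b L x ξ : ℝ} (hL : 0 ≤ L) {y y' : ℝ → ℝ}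
    (hy : ∀ t ∈ Icc a b, HasDerivWithinAt y (y' t) (Icc a b) t)
    (hbound : ∀ t ∈ Icc a b, |y' t| ≤ L * |y t|) (hx : x ∈ Icc a b) (hξ : ξ ∈ Icc a b) :
    |y ξ| ≤ |y x| * Real.exp (L * (b - a)) := by
  have hcont : ContinuousOn y (Icc a b) := fun t ht => (hy t ht).continuousWithinAt
  -- `|y|` need not be differentiable, so the square is used. This bound makes `y² e^{-2Lt}`
  -- decreasing and `y² e^{2Lt}` increasing, which serve for `x ≤ ξ` and `ξ ≤ x` respectively.
  have key : ∀ t ∈ Icc a b, |y t * y' t| ≤ L * (y t) ^ 2 := by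
    intro t ht
    rw [abs_mul]
    nlinarith [hbound t ht, abs_nonneg (y t), sq_abs (y t)]
  have hder : ∀ σ : ℝ, ∀ t ∈ interior (Icc a b),
      HasDerivWithinAt (fun t => (y t) ^ 2 * Real.exp (σ * t))
        ((2 * (y t * y' t) + σ * (y t) ^ 2) * Real.exp (σ * t)) (interior (Icc a b)) t := by
    intro σ t ht
    have h1 := (hy t (interior_subset ht)).mono (interior_subset (s := Icc a b))
    have h2 : HasDerivAt (fun t : ℝ => Real.exp (σ * t)) (Real.exp (σ * t) * (σ * 1)) t :=
      ((hasDerivAt_id t).const_mul σ).exp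
    refine ((h1.pow 2).mul h2.hasDerivWithinAt).congr_deriv ?_
    simp only [Pi.pow_apply]
    push_cast
    ring
  have hc : ∀ σ : ℝ, ContinuousOn (fun t => (y t) ^ 2 * Real.exp (σ * t)) (Icc a b) := fun σ =>
    (hcont.pow 2).mul (by fun_prop)
  have hsq : (y ξ) ^ 2 ≤ (y x) ^ 2 * Real.exp (L * (b - a)) ^ 2 := by
    rw [← Real.exp_nat_mul]
    push_cast
    have cancel : ∀ u : ℝ, Real.exp (-u) * Real.exp u = 1 := fun u => by
      rw [← Real.exp_add]; simp
    rcases le_total x ξ with h | h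
    · have hanti : AntitoneOn (fun t => (y t) ^ 2 * Real.exp (-(2 * L) * t)) (Icc a b) := by
        refine antitoneOn_of_hasDerivWithinAt_nonpos (convex_Icc a b) (hc _) (hder _) ?_
        intro t ht
        refine mul_nonpos_of_nonpos_of_nonneg ?_ (Real.exp_pos _).le
        nlinarith [abs_le.1 (key t (interior_subset ht))]
      have h1 := hanti hx hξ h
      simp only at h1
      have h2 : (y ξ) ^ 2 ≤ (y x) ^ 2 * (Real.exp (-(2 * L) * x) * Real.exp (2 * L * ξ)) := by
        have h3 := cancel (2 * L * ξ)
        rw [← neg_mul] at h3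
        calc (y ξ) ^ 2 = (y ξ) ^ 2 * Real.exp (-(2 * L) * ξ) * Real.exp (2 * L * ξ) := by
              rw [mul_assoc, h3, mul_one]
          _ ≤ (y x) ^ 2 * Real.exp (-(2 * L) * x) * Real.exp (2 * L * ξ) := by gcongr
          _ = _ := by ring
      rw [← Real.exp_add] at h2
      refine h2.trans (mul_le_mul_of_nonneg_left (Real.exp_le_exp.2 ?_) (sq_nonneg _))
      nlinarith [hx.1, hx.2, hξ.1, hξ.2]
    · have hmono : MonotoneOn (fun t => (y t) ^ 2 * Real.exp (2 * L * t)) (Icc a b) := by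
        refine monotoneOn_of_hasDerivWithinAt_nonneg (convex_Icc a b) (hc _) (hder _) ?_
        intro t ht
        refine mul_nonneg ?_ (Real.exp_pos _).le
        nlinarith [abs_le.1 (key t (interior_subset ht))]
      have h1 := hmono hξ hx h
      simp only at h1
      have h2 : (y ξ) ^ 2 ≤ (y x) ^ 2 * (Real.exp (2 * L * x) * Real.exp (-(2 * L) * ξ)) := by
        have h3 := cancel (2 * L * ξ)
        rw [← neg_mul, mul_comm] at h3
        calc (y ξ) ^ 2 = (y ξ) ^ 2 * Real.exp (2 * L * ξ) * Real.exp (-(2 * L) * ξ) := by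
              rw [mul_assoc, h3, mul_one]
          _ ≤ (y x) ^ 2 * Real.exp (2 * L * x) * Real.exp (-(2 * L) * ξ) := by gcongr
          _ = _ := by ring
      rw [← Real.exp_add] at h2
      refine h2.trans (mul_le_mul_of_nonneg_left (Real.exp_le_exp.2 ?_) (sq_nonneg _))
      nlinarith [hx.1, hx.2, hξ.1, hξ.2]
  rw [← mul_pow] at hsq
  have := sq_le_sq.1 hsq
  rwa [abs_mul, abs_of_pos (Real.exp_pos _)] at this

/-! ### Orientation, existence and uniqueness of characteristics -/

namespace HyperbolicProblem

variable {n : ℕ} (P : HyperbolicProblem n)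

/-- The direction of propagation of the `j`-th component. -/
def dir (j : Fin n) : ℝ := if (j : ℕ) < P.m then 1 else -1

/-- The slope `dt/dx = 1 / aⱼ` of the characteristics, frozen below `t = 0`. -/
noncomputable def slope (j : Fin n) (q : ℝ × ℝ) : ℝ := 1 / P.a j (q.1, max q.2 0)

/-- For both families, `dir j * ξ` grows in the direction of propagation. Most later arguments use
only this order and so treat the two families at once. -/
theorem dir_cases (j : Fin n) :
    ((j : ℕ) < P.m ∧ P.dir j = 1 ∧ P.inAbscissa j = 0 ∧ P.outAbscissa j = 1) ∨
      (¬ (j : ℕ) < P.m ∧ P.dir j = -1 ∧ P.inAbscissa j = 1 ∧ P.outAbscissa j = 0) := by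
  unfold dir inAbscissa outAbscissa
  by_cases h : (j : ℕ) < P.m <;> simp [h]

theorem dir_mul_self (j : Fin n) : P.dir j * P.dir j = 1 := by
  rcases P.dir_cases j with ⟨-, h, -, -⟩ | ⟨-, h, -, -⟩ <;> rw [h] <;> norm_num

theorem abs_dir (j : Fin n) : |P.dir j| = 1 := by
  rcases P.dir_cases j with ⟨-, h, -, -⟩ | ⟨-, h, -, -⟩ <;> rw [h] <;> norm_num

theorem inAbscissa_mem (j : Fin n) : P.inAbscissa j ∈ Icc (0 : ℝ) 1 := by
  rcases P.dir_cases j with ⟨-, -, h, -⟩ | ⟨-, -, h, -⟩ <;> rw [h] <;> norm_num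

theorem outAbscissa_mem (j : Fin n) : P.outAbscissa j ∈ Icc (0 : ℝ) 1 := by
  rcases P.dir_cases j with ⟨-, -, -, h⟩ | ⟨-, -, -, h⟩ <;> rw [h] <;> norm_num

theorem dir_mul_inAbscissa_le (j : Fin n) {ξ : ℝ} (hξ : ξ ∈ Icc (0 : ℝ) 1) :
    P.dir j * P.inAbscissa j ≤ P.dir j * ξ := by
  rcases P.dir_cases j with ⟨-, h, h', -⟩ | ⟨-, h, h', -⟩ <;> rw [h, h'] <;>
    linarith [hξ.1, hξ.2]

theorem le_dir_mul_outAbscissa (j : Fin n) {ξ : ℝ} (hξ : ξ ∈ Icc (0 : ℝ) 1) :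
    P.dir j * ξ ≤ P.dir j * P.outAbscissa j := by
  rcases P.dir_cases j with ⟨-, h, -, h'⟩ | ⟨-, h, -, h'⟩ <;> rw [h, h'] <;>
    linarith [hξ.1, hξ.2]

theorem dir_mul_outAbscissa (j : Fin n) :
    P.dir j * P.outAbscissa j = P.dir j * P.inAbscissa j + 1 := by
  rcases P.dir_cases j with ⟨-, h, h', h''⟩ | ⟨-, h, h', h''⟩ <;> rw [h, h', h''] <;> norm_num

theorem mem_Ioo_of_ne (j : Fin n) {ξ : ℝ} (hξ : ξ ∈ Icc (0 : ℝ) 1) (h1 : ξ ≠ P.inAbscissa j)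
    (h2 : ξ ≠ P.outAbscissa j) : ξ ∈ Ioo (0 : ℝ) 1 := by
  rcases P.dir_cases j with ⟨-, -, h', h''⟩ | ⟨-, -, h', h''⟩ <;> rw [h'] at h1 <;>
    rw [h''] at h2
  · exact ⟨lt_of_le_of_ne hξ.1 h1.symm, lt_of_le_of_ne hξ.2 h2⟩
  · exact ⟨lt_of_le_of_ne hξ.1 h2.symm, lt_of_le_of_ne hξ.2 h1⟩

variable {P}

theorem mem_halfStrip {x t : ℝ} (hx : x ∈ Icc (0 : ℝ) 1) (ht : 0 ≤ t) : (x, t) ∈ halfStrip :=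
  ⟨hx, ht⟩

theorem max_mem_halfStrip {x : ℝ} (hx : x ∈ Icc (0 : ℝ) 1) (t : ℝ) :
    (x, max t 0) ∈ halfStrip := ⟨hx, le_max_right t 0⟩

theorem SpeedBounds.dir_mul (hs : P.SpeedBounds) :
    ∃ α : ℝ, 0 < α ∧ ∀ j, ∀ p ∈ halfStrip, α ≤ P.dir j * P.a j p := by
  obtain ⟨α, hα, h⟩ := hs
  refine ⟨α, hα, fun j p hp => ?_⟩
  rcases P.dir_cases j with ⟨h0, h', -, -⟩ | ⟨h0, h', -, -⟩ <;> rw [h']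
  · linarith [(h j p hp).1 h0]
  · linarith [(h j p hp).2 (not_lt.1 h0)]

theorem SpeedBounds.a_ne_zero (hs : P.SpeedBounds) (j : Fin n) {p : ℝ × ℝ}
    (hp : p ∈ halfStrip) : P.a j p ≠ 0 := by
  obtain ⟨α, hα, h⟩ := hs.dir_mul
  intro h0
  have := h j p hp
  rw [h0] at this
  linarith

theorem dir_mul_slope (j : Fin n) (q : ℝ × ℝ) :
    P.dir j * P.slope j q = 1 / (P.dir j * P.a j (q.1, max q.2 0)) := by
  unfold slope
  rcases P.dir_cases j with ⟨-, h', -, -⟩ | ⟨-, h', -, -⟩ <;> rw [h']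
  · simp
  · simp [div_neg]

theorem SpeedBounds.slope_pos (hs : P.SpeedBounds) (j : Fin n) {q : ℝ × ℝ}
    (hq : q.1 ∈ Icc (0 : ℝ) 1) : 0 < P.dir j * P.slope j q := by
  obtain ⟨α, hα, h⟩ := hs.dir_mul
  rw [dir_mul_slope]
  have := h j _ (max_mem_halfStrip hq q.2)
  exact one_div_pos.2 (hα.trans_le this)

theorem SpeedBounds.exists_abs_slope_le (hs : P.SpeedBounds) :
    ∃ C : ℝ, 0 < C ∧ ∀ j, ∀ q : ℝ × ℝ, q.1 ∈ Icc (0 : ℝ) 1 → |P.slope j q| ≤ C := by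
  obtain ⟨α, hα, h⟩ := hs.dir_mul
  refine ⟨1 / α, by positivity, fun j q hq => ?_⟩
  have h1 := hs.slope_pos j hq
  have h2 : |P.slope j q| = P.dir j * P.slope j q := by
    rw [← abs_of_pos h1, abs_mul, abs_dir, one_mul]
  rw [h2, dir_mul_slope]
  exact one_div_le_one_div_of_le hα (h j _ (max_mem_halfStrip hq q.2))

/-- `aⱼ` is bounded on the compact set `[0,1] × [0, max T 0]`, and freezing reduces negative times
to `t = 0`. The bound depends on `T` because the speeds may grow with time. -/
theorem exists_le_slope (hs : P.SpeedBounds) (hr : P.BasicRegularity) (T : ℝ) :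
    ∃ c : ℝ, 0 < c ∧ ∀ j, ∀ q : ℝ × ℝ, q.1 ∈ Icc (0 : ℝ) 1 → q.2 ≤ T →
      c ≤ P.dir j * P.slope j q := by
  obtain ⟨α, hα, h⟩ := hs.dir_mul
  have hK : IsCompact (Icc (0 : ℝ) 1 ×ˢ Icc (0 : ℝ) (max T 0)) := isCompact_Icc.prod isCompact_Icc
  have hsub : Icc (0 : ℝ) 1 ×ˢ Icc (0 : ℝ) (max T 0) ⊆ halfStrip := fun p hp => ⟨hp.1, hp.2.1⟩
  have hb : ∀ j, ∃ A : ℝ, ∀ p ∈ Icc (0 : ℝ) 1 ×ˢ Icc (0 : ℝ) (max T 0), ‖P.a j p‖ ≤ A :=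
    fun j => hK.exists_bound_of_continuousOn ((hr.1 j).mono hsub)
  choose A hA using hb
  have hS : ∀ j, A j ≤ ∑ i, |A i| := fun j =>
    (le_abs_self _).trans (Finset.single_le_sum (f := fun i => |A i|)
      (fun i _ => abs_nonneg _) (Finset.mem_univ j))
  have hS0 : 0 ≤ ∑ i, |A i| := Finset.sum_nonneg fun i _ => abs_nonneg _
  refine ⟨1 / (∑ i, |A i| + 1), by positivity, fun j q hq hqT => ?_⟩
  have hmem : (q.1, max q.2 0) ∈ Icc (0 : ℝ) 1 ×ˢ Icc (0 : ℝ) (max T 0) :=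
    ⟨hq, le_max_right _ _, max_le_max hqT le_rfl⟩
  rw [dir_mul_slope]
  refine one_div_le_one_div_of_le (hα.trans_le (h j _ (hsub hmem))) ?_
  have h1 : P.dir j * P.a j (q.1, max q.2 0) ≤ |P.a j (q.1, max q.2 0)| := by
    refine (le_abs_self _).trans ?_
    rw [abs_mul, abs_dir, one_mul]
  have h2 := hA j _ hmem
  rw [Real.norm_eq_abs] at h2
  linarith [hS j]

theorem continuousOn_slope (hs : P.SpeedBounds) (hr : P.BasicRegularity) (j : Fin n) :
    ContinuousOn (P.slope j) (Icc (0 : ℝ) 1 ×ˢ univ) := by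
  have h1 : MapsTo (fun q : ℝ × ℝ => (q.1, max q.2 0)) (Icc (0 : ℝ) 1 ×ˢ univ) halfStrip :=
    fun q hq => max_mem_halfStrip hq.1 _
  refine ContinuousOn.div continuousOn_const
    ((hr.1 j).comp (by fun_prop) h1) (fun q hq => hs.a_ne_zero j (h1 hq))

/-- The reciprocal of a Lipschitz function bounded away from zero is Lipschitz, and freezing does
not increase distances. Only an upper bound on the times is needed, so curves may run below `t = 0`.
-/
theorem exists_slope_lipschitz (hs : P.SpeedBounds) (hr : P.BasicRegularity) (j : Fin n) (R : ℝ) :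
    ∃ L : ℝ, 0 ≤ L ∧ ∀ ξ ∈ Icc (0 : ℝ) 1, ∀ s t : ℝ, s ≤ R → t ≤ R →
      |P.slope j (ξ, s) - P.slope j (ξ, t)| ≤ L * |s - t| := by
  obtain ⟨C, hC, hCb⟩ := hs.exists_abs_slope_le
  obtain ⟨L, hL⟩ := hr.2.1 j (max R 1) (by positivity)
  refine ⟨C * C * |L|, by positivity, fun ξ hξ s t hsR htR => ?_⟩
  have e : P.slope j (ξ, s) - P.slope j (ξ, t) =
      P.slope j (ξ, s) * P.slope j (ξ, t) * (P.a j (ξ, max t 0) - P.a j (ξ, max s 0)) := by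
    have h1 := hs.a_ne_zero j (max_mem_halfStrip hξ s)
    have h2 := hs.a_ne_zero j (max_mem_halfStrip hξ t)
    unfold slope
    field_simp
  have h3 := hL ξ hξ (max t 0) ⟨le_max_right _ _, max_le (htR.trans (le_max_left _ _)) (by positivity)⟩
    (max s 0) ⟨le_max_right _ _, max_le (hsR.trans (le_max_left _ _)) (by positivity)⟩
  have h4 : |max t 0 - max s 0| ≤ |s - t| := by
    rw [abs_sub_comm s t]; exact abs_max_sub_max_le_abs t s 0
  rw [e, abs_mul, abs_mul]
  have h5 : |P.a j (ξ, max t 0) - P.a j (ξ, max s 0)| ≤ |L| * |s - t| :=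
    h3.trans (mul_le_mul (le_abs_self L) h4 (abs_nonneg _) (abs_nonneg _))
  calc _ ≤ C * C * (|L| * |s - t|) := by
        gcongr
        · exact hCb j (ξ, s) hξ
        · exact hCb j (ξ, t) hξ
    _ = _ := by ring

/-- The slope is bounded by a global `C`, so over the unit interval a curve moves by at most `C`.
The Picard–Lindelöf theorem on a ball of radius `C` thus yields the whole curve in one step, and
local Lipschitz continuity suffices. -/
theorem exists_isCharacteristic (hs : P.SpeedBounds) (hr : P.BasicRegularity) (j : Fin n)
    {p : ℝ × ℝ} (hp : p.1 ∈ Icc (0 : ℝ) 1) : ∃ γ, P.IsCharacteristic j p γ := by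
  obtain ⟨C, hC, hCb⟩ := hs.exists_abs_slope_le
  obtain ⟨L, hL0, hL⟩ := exists_slope_lipschitz hs hr j (p.2 + C)
  have hball : ∀ s ∈ Metric.closedBall p.2 ((⟨C, hC.le⟩ : NNReal) : ℝ), s ≤ p.2 + C := by
    intro s hsm
    have := (abs_le.1 (Real.dist_eq s p.2 ▸ Metric.mem_closedBall.1 hsm)).2
    change s - p.2 ≤ C at this
    linarith
  have hPL : IsPicardLindelof (fun ξ s => P.slope j (ξ, s)) (⟨p.1, hp⟩ : Icc (0 : ℝ) 1) p.2
      ⟨C, hC.le⟩ 0 ⟨C, hC.le⟩ ⟨L, hL0⟩ := by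
    refine ⟨fun ξ hξ => ?_, fun s _ => ?_, fun ξ hξ s _ => ?_, ?_⟩
    · refine LipschitzOnWith.of_dist_le_mul fun s hsm t htm => ?_
      rw [Real.dist_eq, Real.dist_eq]
      exact hL ξ hξ s t (hball s hsm) (hball t htm)
    · exact (continuousOn_slope hs hr j).comp (by fun_prop) (fun ξ hξ => ⟨hξ, mem_univ _⟩)
    · exact hCb j (ξ, s) hξ
    · have : max (1 - p.1) (p.1 - 0) ≤ 1 := max_le (by linarith [hp.1]) (by linarith [hp.2])
      change C * max (1 - p.1) (p.1 - 0) ≤ C - 0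
      nlinarith
  obtain ⟨γ, h1, h2⟩ := hPL.exists_eq_forall_mem_Icc_hasDerivWithinAt₀
  exact ⟨γ, h1, h2⟩

theorem isCharacteristic_charac (hs : P.SpeedBounds) (hr : P.BasicRegularity) (j : Fin n)
    {p : ℝ × ℝ} (hp : p.1 ∈ Icc (0 : ℝ) 1) : P.IsCharacteristic j p (P.charac j p) :=
  Classical.epsilon_spec (exists_isCharacteristic hs hr j hp)

theorem charac_self (hs : P.SpeedBounds) (hr : P.BasicRegularity) (j : Fin n)
    {p : ℝ × ℝ} (hp : p.1 ∈ Icc (0 : ℝ) 1) : P.charac j p p.1 = p.2 :=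
  (isCharacteristic_charac hs hr j hp).1

theorem hasDerivWithinAt_charac (hs : P.SpeedBounds) (hr : P.BasicRegularity) (j : Fin n)
    {p : ℝ × ℝ} (hp : p.1 ∈ Icc (0 : ℝ) 1) {ξ : ℝ} (hξ : ξ ∈ Icc (0 : ℝ) 1) :
    HasDerivWithinAt (P.charac j p) (P.slope j (ξ, P.charac j p ξ)) (Icc 0 1) ξ :=
  (isCharacteristic_charac hs hr j hp).2 ξ hξ

theorem continuousOn_charac (hs : P.SpeedBounds) (hr : P.BasicRegularity) (j : Fin n)
    {p : ℝ × ℝ} (hp : p.1 ∈ Icc (0 : ℝ) 1) : ContinuousOn (P.charac j p) (Icc 0 1) :=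
  fun _ hξ => (hasDerivWithinAt_charac hs hr j hp hξ).continuousWithinAt

theorem exists_charac_sub_eq (hs : P.SpeedBounds) (hr : P.BasicRegularity) (j : Fin n)
    {p : ℝ × ℝ} (hp : p.1 ∈ Icc (0 : ℝ) 1) {ξ ξ' : ℝ} (hξ : ξ ∈ Icc (0 : ℝ) 1)
    (hξ' : ξ' ∈ Icc (0 : ℝ) 1) :
    ∃ ζ ∈ Icc (0 : ℝ) 1,
      P.charac j p ξ' - P.charac j p ξ = P.slope j (ζ, P.charac j p ζ) * (ξ' - ξ) := by
  have aux : ∀ {ξ ξ' : ℝ}, ξ ∈ Icc (0 : ℝ) 1 → ξ' ∈ Icc (0 : ℝ) 1 → ξ < ξ' →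
      ∃ ζ ∈ Icc (0 : ℝ) 1,
      P.charac j p ξ' - P.charac j p ξ = P.slope j (ζ, P.charac j p ζ) * (ξ' - ξ) := by
    intro ξ ξ' hξ hξ' hlt
    have hsub : Icc ξ ξ' ⊆ Icc (0 : ℝ) 1 := Icc_subset_Icc hξ.1 hξ'.2
    obtain ⟨ζ, hζ, h⟩ := exists_hasDerivAt_eq_slope (P.charac j p)
      (fun ζ => P.slope j (ζ, P.charac j p ζ)) hlt
      ((continuousOn_charac hs hr j hp).mono hsub) (fun ζ hζ =>
        (hasDerivWithinAt_charac hs hr j hp (hsub (Ioo_subset_Icc_self hζ))).hasDerivAt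
          (Icc_mem_nhds (hξ.1.trans_lt hζ.1) (hζ.2.trans_le hξ'.2)))
    refine ⟨ζ, hsub (Ioo_subset_Icc_self hζ), ?_⟩
    rw [h, div_mul_cancel₀ _ (sub_ne_zero.2 hlt.ne')]
  rcases lt_trichotomy ξ ξ' with h | h | h
  · exact aux hξ hξ' h
  · subst h
    exact ⟨ξ, hξ, by simp⟩
  · obtain ⟨ζ, h1, h3⟩ := aux hξ' hξ h
    exact ⟨ζ, h1, by linarith⟩

theorem charac_strictMono (hs : P.SpeedBounds) (hr : P.BasicRegularity) (j : Fin n)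
    {p : ℝ × ℝ} (hp : p.1 ∈ Icc (0 : ℝ) 1) {ξ ξ' : ℝ} (hξ : ξ ∈ Icc (0 : ℝ) 1)
    (hξ' : ξ' ∈ Icc (0 : ℝ) 1) (h : P.dir j * ξ < P.dir j * ξ') :
    P.charac j p ξ < P.charac j p ξ' := by
  obtain ⟨ζ, h1, h3⟩ := exists_charac_sub_eq hs hr j hp hξ hξ'
  have h4 := hs.slope_pos j (q := (ζ, P.charac j p ζ)) h1
  have h5 := P.dir_mul_self j
  have h6 : P.charac j p ξ' - P.charac j p ξ =
      (P.dir j * P.slope j (ζ, P.charac j p ζ)) * (P.dir j * ξ' - P.dir j * ξ) := by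
    rw [h3]; linear_combination (-(P.slope j (ζ, P.charac j p ζ)) * (ξ' - ξ)) * h5
  have := mul_pos h4 (sub_pos.2 h)
  linarith

theorem dir_mul_injective (j : Fin n) {ξ ξ' : ℝ} (h : P.dir j * ξ = P.dir j * ξ') : ξ = ξ' := by
  have h5 := P.dir_mul_self j
  linear_combination P.dir j * h + (ξ' - ξ) * h5

theorem charac_mono (hs : P.SpeedBounds) (hr : P.BasicRegularity) (j : Fin n)
    {p : ℝ × ℝ} (hp : p.1 ∈ Icc (0 : ℝ) 1) {ξ ξ' : ℝ} (hξ : ξ ∈ Icc (0 : ℝ) 1)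
    (hξ' : ξ' ∈ Icc (0 : ℝ) 1) (h : P.dir j * ξ ≤ P.dir j * ξ') :
    P.charac j p ξ ≤ P.charac j p ξ' := by
  rcases h.lt_or_eq with h | h
  · exact (charac_strictMono hs hr j hp hξ hξ' h).le
  · rw [dir_mul_injective j h]

theorem charac_le_iff (hs : P.SpeedBounds) (hr : P.BasicRegularity) (j : Fin n)
    {p : ℝ × ℝ} (hp : p.1 ∈ Icc (0 : ℝ) 1) {ξ ξ' : ℝ} (hξ : ξ ∈ Icc (0 : ℝ) 1)
    (hξ' : ξ' ∈ Icc (0 : ℝ) 1) :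
    P.charac j p ξ ≤ P.charac j p ξ' ↔ P.dir j * ξ ≤ P.dir j * ξ' :=
  ⟨fun h => not_lt.1 fun h' => (charac_strictMono hs hr j hp hξ' hξ h').not_ge h,
    charac_mono hs hr j hp hξ hξ'⟩

/-- Crossing the strip takes a time that is bounded from below on bounded time intervals. -/
theorem exists_crossing_time (hs : P.SpeedBounds) (hr : P.BasicRegularity) (T : ℝ) :
    ∃ δ : ℝ, 0 < δ ∧ ∀ j, ∀ t ≤ T,
      P.charac j (P.outAbscissa j, t) (P.inAbscissa j) ≤ t - δ := by
  obtain ⟨c, hc, h⟩ := exists_le_slope hs hr T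
  refine ⟨c, hc, fun j t ht => ?_⟩
  have hp : ((P.outAbscissa j, t) : ℝ × ℝ).1 ∈ Icc (0 : ℝ) 1 := P.outAbscissa_mem j
  obtain ⟨ζ, h1, h3⟩ := exists_charac_sub_eq hs hr j hp (P.inAbscissa_mem j)
    (P.outAbscissa_mem j)
  have h0 : P.charac j (P.outAbscissa j, t) (P.outAbscissa j) = t := charac_self hs hr j hp
  -- The ordinate is largest at the exit, so the whole curve lies below `T`, where the slope bound
  -- holds.
  have h4 : P.charac j (P.outAbscissa j, t) ζ ≤ t := by
    conv_rhs => rw [← h0]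
    exact charac_mono hs hr j hp h1 (P.outAbscissa_mem j) (P.le_dir_mul_outAbscissa j h1)
  have h5 := h j (ζ, P.charac j (P.outAbscissa j, t) ζ) h1 (h4.trans ht)
  have h6 := P.dir_mul_self j
  have h7 := P.dir_mul_outAbscissa j
  have h8 : P.slope j (ζ, P.charac j (P.outAbscissa j, t) ζ) * (P.outAbscissa j - P.inAbscissa j)
      = P.dir j * P.slope j (ζ, P.charac j (P.outAbscissa j, t) ζ) := by
    linear_combination P.dir j * P.slope j (ζ, P.charac j (P.outAbscissa j, t) ζ) * h7 -
      P.slope j (ζ, P.charac j (P.outAbscissa j, t) ζ) *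
        (P.outAbscissa j - P.inAbscissa j) * h6
  rw [h0, h8] at h3
  linarith

theorem IsCharacteristic.exists_bound {j : Fin n} {p : ℝ × ℝ} {γ : ℝ → ℝ}
    (h : P.IsCharacteristic j p γ) : ∃ R, ∀ ξ ∈ Icc (0 : ℝ) 1, γ ξ ≤ R := by
  obtain ⟨R, hR⟩ := isCompact_Icc.exists_bound_of_continuousOn
    (f := γ) (s := Icc (0 : ℝ) 1) (fun ξ hξ => (h.2 ξ hξ).continuousWithinAt)
  exact ⟨R, fun ξ hξ => (le_abs_self _).trans (hR ξ hξ)⟩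

/-- Gronwall applied to the difference of the curves. The constant depends only on a common upper
bound `R`, and this uniformity yields continuity in the base point as well as uniqueness. -/
theorem exists_abs_sub_le_of_isCharacteristic (hs : P.SpeedBounds) (hr : P.BasicRegularity)
    (j : Fin n) (R : ℝ) : ∃ M : ℝ, 0 < M ∧ ∀ (p p' : ℝ × ℝ) (γ γ' : ℝ → ℝ),
      P.IsCharacteristic j p γ → P.IsCharacteristic j p' γ' →
      (∀ ξ ∈ Icc (0 : ℝ) 1, γ ξ ≤ R) → (∀ ξ ∈ Icc (0 : ℝ) 1, γ' ξ ≤ R) →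
      ∀ ξ ∈ Icc (0 : ℝ) 1, ∀ x ∈ Icc (0 : ℝ) 1, |γ ξ - γ' ξ| ≤ |γ x - γ' x| * M := by
  obtain ⟨L, hL0, hL⟩ := exists_slope_lipschitz hs hr j R
  refine ⟨Real.exp (L * (1 - 0)), Real.exp_pos _, fun p p' γ γ' h h' hR hR' ξ hξ x hx => ?_⟩
  exact abs_le_mul_exp_of_abs_deriv_le hL0 (y := fun ξ => γ ξ - γ' ξ)
    (y' := fun ξ => P.slope j (ξ, γ ξ) - P.slope j (ξ, γ' ξ))
    (fun ξ hξ => (h.2 ξ hξ).sub (h'.2 ξ hξ))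
    (fun ξ hξ => hL ξ hξ _ _ (hR ξ hξ) (hR' ξ hξ)) hx hξ

theorem IsCharacteristic.eqOn (hs : P.SpeedBounds) (hr : P.BasicRegularity) {j : Fin n}
    {p p' : ℝ × ℝ} {γ γ' : ℝ → ℝ} (h : P.IsCharacteristic j p γ)
    (h' : P.IsCharacteristic j p' γ') {x : ℝ} (hx : x ∈ Icc (0 : ℝ) 1) (hxx : γ x = γ' x) :
    EqOn γ γ' (Icc 0 1) := by
  obtain ⟨R, hR⟩ := h.exists_bound
  obtain ⟨R', hR'⟩ := h'.exists_bound
  obtain ⟨M, -, hM⟩ := exists_abs_sub_le_of_isCharacteristic hs hr j (max R R')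
  intro ξ hξ
  have := hM p p' γ γ' h h' (fun ξ hξ => (hR ξ hξ).trans (le_max_left _ _))
    (fun ξ hξ => (hR' ξ hξ).trans (le_max_right _ _)) ξ hξ x hx
  rw [hxx, sub_self, abs_zero, zero_mul] at this
  exact sub_eq_zero.1 (abs_nonpos_iff.1 this)

theorem charac_eqOn (hs : P.SpeedBounds) (hr : P.BasicRegularity) {j : Fin n}
    {p p' : ℝ × ℝ} (hp : p.1 ∈ Icc (0 : ℝ) 1) (hp' : p'.1 ∈ Icc (0 : ℝ) 1) {x : ℝ}
    (hx : x ∈ Icc (0 : ℝ) 1) (h : P.charac j p x = P.charac j p' x) :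
    EqOn (P.charac j p) (P.charac j p') (Icc 0 1) :=
  (isCharacteristic_charac hs hr j hp).eqOn hs hr (isCharacteristic_charac hs hr j hp') hx h

/-! ### Feet, weights and values of the propagation operator -/

/-- The set of abscissas that defines `foot`. -/
def activeSet (P : HyperbolicProblem n) (j : Fin n) (p : ℝ × ℝ) : Set ℝ :=
  {ξ ∈ Icc (0 : ℝ) 1 | 0 ≤ P.charac j p ξ}

/-- The infimum and the supremum in `foot` become one minimality condition with respect to `dir j *
ξ`. -/
theorem foot_eq_of_least (j : Fin n) {p : ℝ × ℝ} {ξ₀ : ℝ} (h : ξ₀ ∈ P.activeSet j p)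
    (hle : ∀ ξ ∈ P.activeSet j p, P.dir j * ξ₀ ≤ P.dir j * ξ) : P.foot j p = ξ₀ := by
  unfold foot
  rcases P.dir_cases j with ⟨h0, h', -, -⟩ | ⟨h0, h', -, -⟩
  · rw [if_pos h0]
    refine IsLeast.csInf_eq ⟨h, fun ξ hξ => ?_⟩
    have := hle ξ hξ
    rw [h'] at this
    linarith
  · rw [if_neg h0]
    refine IsGreatest.csSup_eq ⟨h, fun ξ hξ => ?_⟩
    have := hle ξ hξ
    rw [h'] at this
    linarith

theorem foot_eq_inAbscissa (j : Fin n) {p : ℝ × ℝ}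
    (h : 0 ≤ P.charac j p (P.inAbscissa j)) : P.foot j p = P.inAbscissa j :=
  foot_eq_of_least j ⟨P.inAbscissa_mem j, h⟩ fun _ hξ => P.dir_mul_inAbscissa_le j hξ.1

theorem foot_eq_of_charac_eq_zero (hs : P.SpeedBounds) (hr : P.BasicRegularity) (j : Fin n)
    {p : ℝ × ℝ} (hp : p.1 ∈ Icc (0 : ℝ) 1) {ξ : ℝ} (hξ : ξ ∈ Icc (0 : ℝ) 1)
    (h : P.charac j p ξ = 0) : P.foot j p = ξ :=
  foot_eq_of_least j ⟨hξ, h.ge⟩ fun _ hζ =>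
    (charac_le_iff hs hr j hp hξ hζ.1).1 (h.trans_le hζ.2)

theorem exists_charac_eq_zero (hs : P.SpeedBounds) (hr : P.BasicRegularity) (j : Fin n)
    {p : ℝ × ℝ} (hp : p ∈ halfStrip) (h : P.charac j p (P.inAbscissa j) < 0) :
    ∃ ξ ∈ Icc (0 : ℝ) 1, P.charac j p ξ = 0 := by
  have h1 := isPreconnected_Icc.intermediate_value (P.inAbscissa_mem j) hp.1
    (continuousOn_charac hs hr j hp.1)
  rw [charac_self hs hr j hp.1] at h1
  obtain ⟨ξ, hξ, h2⟩ := h1 ⟨h.le, hp.2⟩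
  exact ⟨ξ, hξ, h2⟩

theorem charac_foot_eq_zero (hs : P.SpeedBounds) (hr : P.BasicRegularity) (j : Fin n)
    {p : ℝ × ℝ} (hp : p ∈ halfStrip) (h : P.charac j p (P.inAbscissa j) < 0) :
    P.charac j p (P.foot j p) = 0 := by
  obtain ⟨ξ, hξ, h2⟩ := exists_charac_eq_zero hs hr j hp h
  rw [foot_eq_of_charac_eq_zero hs hr j hp.1 hξ h2, h2]

theorem foot_mem (hs : P.SpeedBounds) (hr : P.BasicRegularity) (j : Fin n)
    {p : ℝ × ℝ} (hp : p ∈ halfStrip) : P.foot j p ∈ Icc (0 : ℝ) 1 := by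
  rcases le_or_gt 0 (P.charac j p (P.inAbscissa j)) with h | h
  · rw [foot_eq_inAbscissa j h]; exact P.inAbscissa_mem j
  · obtain ⟨ξ, hξ, h2⟩ := exists_charac_eq_zero hs hr j hp h
    rwa [foot_eq_of_charac_eq_zero hs hr j hp.1 hξ h2]

theorem foot_ne_inAbscissa (hs : P.SpeedBounds) (hr : P.BasicRegularity) (j : Fin n)
    {p : ℝ × ℝ} (hp : p ∈ halfStrip) (h : P.charac j p (P.inAbscissa j) < 0) :
    P.foot j p ≠ P.inAbscissa j := by
  intro h1
  have := charac_foot_eq_zero hs hr j hp h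
  rw [h1] at this
  exact h.ne this

theorem charac_in_le (hs : P.SpeedBounds) (hr : P.BasicRegularity) (j : Fin n)
    {p : ℝ × ℝ} (hp : p.1 ∈ Icc (0 : ℝ) 1) : P.charac j p (P.inAbscissa j) ≤ p.2 := by
  conv_rhs => rw [← charac_self hs hr j hp]
  exact charac_mono hs hr j hp (P.inAbscissa_mem j) hp (P.dir_mul_inAbscissa_le j hp)

theorem le_charac_out (hs : P.SpeedBounds) (hr : P.BasicRegularity) (j : Fin n)
    {p : ℝ × ℝ} (hp : p.1 ∈ Icc (0 : ℝ) 1) : p.2 ≤ P.charac j p (P.outAbscissa j) := by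
  conv_lhs => rw [← charac_self hs hr j hp]
  exact charac_mono hs hr j hp hp (P.outAbscissa_mem j) (P.le_dir_mul_outAbscissa j hp)

/-- Points on the same characteristic have the same foot. -/
theorem foot_congr (j : Fin n) {p p' : ℝ × ℝ}
    (h : EqOn (P.charac j p) (P.charac j p') (Icc 0 1)) : P.foot j p = P.foot j p' := by
  have : P.activeSet j p = P.activeSet j p' := by
    ext ξ
    constructor
    · rintro ⟨h1, h2⟩; exact ⟨h1, by rwa [← h h1]⟩
    · rintro ⟨h1, h2⟩; exact ⟨h1, by rwa [h h1]⟩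
  unfold foot
  change (if _ then sInf (P.activeSet j p) else sSup (P.activeSet j p)) =
    (if _ then sInf (P.activeSet j p') else sSup (P.activeSet j p'))
  rw [this]

/-- The value of `[Qu]ⱼ` where the characteristic starts on the lateral boundary. -/
theorem Q_of_nonneg (j : Fin n) {p : ℝ × ℝ} (φ : ℝ → Fin n → ℝ) (u : ℝ × ℝ → Fin n → ℝ)
    (h : 0 ≤ P.charac j p (P.inAbscissa j)) :
    P.Q φ u p j = P.weight j (P.inAbscissa j) p *
      P.boundaryOp u (P.charac j p (P.inAbscissa j)) j := by
  unfold Q shiftOp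
  rw [if_pos (foot_eq_inAbscissa j h), foot_eq_inAbscissa j h]

/-- The value of `[Qu]ⱼ` where the characteristic starts at the initial time. -/
theorem Q_of_neg (hs : P.SpeedBounds) (hr : P.BasicRegularity) (j : Fin n) {p : ℝ × ℝ}
    (hp : p ∈ halfStrip) (φ : ℝ → Fin n → ℝ) (u : ℝ × ℝ → Fin n → ℝ)
    (h : P.charac j p (P.inAbscissa j) < 0) :
    P.Q φ u p j = P.weight j (P.foot j p) p * φ (P.foot j p) j := by
  unfold Q
  rw [if_neg (foot_ne_inAbscissa hs hr j hp h)]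

/-- The integrand `bⱼ / aⱼ` of the weight along the `j`-th characteristic through `p`. -/
noncomputable def damping (P : HyperbolicProblem n) (j : Fin n) (p : ℝ × ℝ) (η : ℝ) : ℝ :=
  P.b j (η, P.charac j p η) / P.a j (η, P.charac j p η)

theorem weight_eq (j : Fin n) (ξ : ℝ) (p : ℝ × ℝ) :
    P.weight j ξ p = Real.exp (∫ η in p.1..ξ, P.damping j p η) := rfl

theorem weight_self (j : Fin n) (p : ℝ × ℝ) : P.weight j p.1 p = 1 := by
  simp [weight_eq]

/-- The ordinate is monotone along a characteristic, so the part in `Π` lies over an interval. This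
makes the damping integrable between any two of its abscissas. -/
theorem uIcc_subset_activeSet (hs : P.SpeedBounds) (hr : P.BasicRegularity) (j : Fin n)
    {p : ℝ × ℝ} (hp : p.1 ∈ Icc (0 : ℝ) 1) {ξ ξ' : ℝ} (hξ : ξ ∈ P.activeSet j p)
    (hξ' : ξ' ∈ P.activeSet j p) : uIcc ξ ξ' ⊆ P.activeSet j p := by
  intro ζ hζ
  have hζ' : ζ ∈ Icc (0 : ℝ) 1 := ordConnected_Icc.uIcc_subset hξ.1 hξ'.1 hζ
  refine ⟨hζ', ?_⟩
  have h : P.dir j * ξ ≤ P.dir j * ζ ∨ P.dir j * ξ' ≤ P.dir j * ζ := by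
    rcases mem_uIcc.1 hζ with h | h <;> rcases P.dir_cases j with ⟨-, h', -, -⟩ | ⟨-, h', -, -⟩ <;>
      rw [h']
    · left; linarith [h.1]
    · right; linarith [h.2]
    · right; linarith [h.1]
    · left; linarith [h.2]
  rcases h with h | h
  · exact hξ.2.trans (charac_mono hs hr j hp hξ.1 hζ' h)
  · exact hξ'.2.trans (charac_mono hs hr j hp hξ'.1 hζ' h)

theorem continuousOn_damping (hs : P.SpeedBounds) (hr : P.BasicRegularity) (j : Fin n)
    {p : ℝ × ℝ} (hp : p.1 ∈ Icc (0 : ℝ) 1) :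
    ContinuousOn (P.damping j p) (P.activeSet j p) := by
  have h1 : ContinuousOn (fun η => (η, P.charac j p η)) (P.activeSet j p) :=
    continuousOn_id.prodMk ((continuousOn_charac hs hr j hp).mono fun _ h => h.1)
  have h2 : MapsTo (fun η => (η, P.charac j p η)) (P.activeSet j p) halfStrip :=
    fun η hη => mem_halfStrip hη.1 hη.2
  exact ((hr.2.2.1 j).comp h1 h2).div ((hr.1 j).comp h1 h2) fun η hη => hs.a_ne_zero j (h2 hη)

theorem intervalIntegrable_damping (hs : P.SpeedBounds) (hr : P.BasicRegularity) (j : Fin n)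
    {p : ℝ × ℝ} (hp : p.1 ∈ Icc (0 : ℝ) 1) {ξ ξ' : ℝ} (hξ : ξ ∈ P.activeSet j p)
    (hξ' : ξ' ∈ P.activeSet j p) : IntervalIntegrable (P.damping j p) volume ξ ξ' :=
  ((continuousOn_damping hs hr j hp).mono
    (uIcc_subset_activeSet hs hr j hp hξ hξ')).intervalIntegrable

theorem mem_activeSet_self (hs : P.SpeedBounds) (hr : P.BasicRegularity) (j : Fin n)
    {p : ℝ × ℝ} (hp : p ∈ halfStrip) : p.1 ∈ P.activeSet j p :=
  ⟨hp.1, by rw [charac_self hs hr j hp.1]; exact hp.2⟩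

/-- The weights form a cocycle along a characteristic. -/
theorem weight_mul_weight (hs : P.SpeedBounds) (hr : P.BasicRegularity) (j : Fin n)
    {p q : ℝ × ℝ} (hp : p ∈ halfStrip) (hq : q ∈ halfStrip) (hpq : q.2 = P.charac j p q.1)
    {ξ : ℝ} (hξ : ξ ∈ P.activeSet j p) :
    P.weight j q.1 p * P.weight j ξ q = P.weight j ξ p := by
  have hE : EqOn (P.charac j q) (P.charac j p) (Icc 0 1) :=
    charac_eqOn hs hr hq.1 hp.1 hq.1 (by rw [charac_self hs hr j hq.1, hpq])
  have hqa : q.1 ∈ P.activeSet j p := ⟨hq.1, by rw [← hpq]; exact hq.2⟩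
  rw [weight_eq, weight_eq, weight_eq, ← Real.exp_add]
  congr 1
  have : ∫ η in q.1..ξ, P.damping j q η = ∫ η in q.1..ξ, P.damping j p η := by
    refine intervalIntegral.integral_congr fun η hη => ?_
    have hη' : η ∈ Icc (0 : ℝ) 1 := ordConnected_Icc.uIcc_subset hq.1 hξ.1 hη
    simp only [damping, hE hη']
  rw [this]
  exact intervalIntegral.integral_add_adjacent_intervals
    (intervalIntegrable_damping hs hr j hp.1 (mem_activeSet_self hs hr j hp) hqa)
    (intervalIntegrable_damping hs hr j hp.1 hqa hξ)

theorem foot_mem_activeSet (hs : P.SpeedBounds) (hr : P.BasicRegularity) (j : Fin n)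
    {p : ℝ × ℝ} (hp : p ∈ halfStrip) : P.foot j p ∈ P.activeSet j p := by
  rcases le_or_gt 0 (P.charac j p (P.inAbscissa j)) with h | h
  · rw [foot_eq_inAbscissa j h]; exact ⟨P.inAbscissa_mem j, h⟩
  · exact ⟨foot_mem hs hr j hp, (charac_foot_eq_zero hs hr j hp h).ge⟩

/-- `Qu` is transported along characteristics. -/
theorem Q_transport (hs : P.SpeedBounds) (hr : P.BasicRegularity) (j : Fin n)
    {p q : ℝ × ℝ} (hp : p ∈ halfStrip) (hq : q ∈ halfStrip) (hpq : q.2 = P.charac j p q.1)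
    (φ : ℝ → Fin n → ℝ) (u : ℝ × ℝ → Fin n → ℝ) :
    P.Q φ u p j = P.weight j q.1 p * P.Q φ u q j := by
  have hE : EqOn (P.charac j q) (P.charac j p) (Icc 0 1) :=
    charac_eqOn hs hr hq.1 hp.1 hq.1 (by rw [charac_self hs hr j hq.1, hpq])
  have hf : P.foot j q = P.foot j p := foot_congr j hE
  have hw := weight_mul_weight hs hr j hp hq hpq (foot_mem_activeSet hs hr j hp)
  unfold Q shiftOp
  rw [hf, hE (foot_mem hs hr j hp), ← hw]
  split_ifs <;> ring

theorem boundaryOp_congr {u u' : ℝ × ℝ → Fin n → ℝ} {t : ℝ}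
    (h : ∀ i, u (P.outAbscissa i, t) i = u' (P.outAbscissa i, t) i) :
    P.boundaryOp u t = P.boundaryOp u' t := by
  unfold boundaryOp
  congr 1
  exact funext h

/-- The domain of dependence of one application of `Q`. It drives the stability, fixed-point and
finite-dependence arguments for the iterates. -/
theorem Q_congr (hs : P.SpeedBounds) (hr : P.BasicRegularity) (j : Fin n) {p : ℝ × ℝ}
    (hp : p ∈ halfStrip) {φ φ' : ℝ → Fin n → ℝ} {u u' : ℝ × ℝ → Fin n → ℝ}
    (h1 : P.charac j p (P.inAbscissa j) < 0 → φ (P.foot j p) j = φ' (P.foot j p) j)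
    (h2 : 0 ≤ P.charac j p (P.inAbscissa j) → ∀ i,
      u (P.outAbscissa i, P.charac j p (P.inAbscissa j)) i =
        u' (P.outAbscissa i, P.charac j p (P.inAbscissa j)) i) :
    P.Q φ u p j = P.Q φ' u' p j := by
  rcases le_or_gt 0 (P.charac j p (P.inAbscissa j)) with h | h
  · rw [Q_of_nonneg j φ u h, Q_of_nonneg j φ' u' h, boundaryOp_congr (h2 h)]
  · rw [Q_of_neg hs hr j hp φ u h, Q_of_neg hs hr j hp φ' u' h, h1 h]

/-! ### Stationary iterates and continuous solutions -/

/-- On a bounded time interval, sufficiently high iterates of `Q_φ` do not depend on the function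
to which they are applied. -/
theorem exists_iterate_Q_stable (hs : P.SpeedBounds) (hr : P.BasicRegularity) (T : ℝ) :
    ∃ K : ℕ, ∀ (φ : ℝ → Fin n → ℝ) (w w' : ℝ × ℝ → Fin n → ℝ), ∀ k ≥ K, ∀ k' ≥ K,
      ∀ p ∈ halfStrip, p.2 ≤ T → (P.Q φ)^[k] w p = (P.Q φ)^[k'] w' p := by
  obtain ⟨δ, hδ, hδT⟩ := exists_crossing_time hs hr T
  -- On the outgoing boundaries every application of `Q` reads traces that are at least `δ` older,
  -- so the range of agreement grows by `δ`.
  have claim : ∀ (φ : ℝ → Fin n → ℝ) (w w' : ℝ × ℝ → Fin n → ℝ) (k : ℕ), ∀ i : Fin n,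
      ∀ t, 0 ≤ t → t ≤ T → t < k * δ →
      (P.Q φ)^[k] w (P.outAbscissa i, t) i = (P.Q φ)^[k] w' (P.outAbscissa i, t) i := by
    intro φ w w' k
    induction k with
    | zero => intro i t h0 _ h; simp at h; linarith
    | succ k ih =>
      intro i t h0 hT hk
      rw [Function.iterate_succ_apply', Function.iterate_succ_apply']
      refine Q_congr hs hr i (mem_halfStrip (P.outAbscissa_mem i) h0) (fun _ => rfl) ?_
      intro h i'
      have h3 := hδT i t hT
      push_cast at hk
      exact ih i' _ h (by linarith) (by linarith)
  obtain ⟨k, hk⟩ := exists_nat_gt (T / δ)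
  rw [div_lt_iff₀ hδ] at hk
  -- At interior points the time read may be arbitrarily close to `p.2`, so nothing is gained; one
  -- further application only spreads the agreement from the boundary to the strip.
  have main : ∀ (φ : ℝ → Fin n → ℝ) (w w' : ℝ × ℝ → Fin n → ℝ), ∀ p ∈ halfStrip, p.2 ≤ T →
      (P.Q φ)^[k + 1] w p = (P.Q φ)^[k + 1] w' p := by
    intro φ w w' p hp hT
    funext j
    rw [Function.iterate_succ_apply', Function.iterate_succ_apply']
    refine Q_congr hs hr j hp (fun _ => rfl) fun h i => ?_
    have h3 := charac_in_le hs hr j hp.1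
    exact claim φ w w' k i _ h (by linarith) (by linarith)
  -- Different exponents are no obstacle: the surplus inner applications are absorbed into the
  -- functions `w` and `w'`.
  refine ⟨k + 1, fun φ w w' l hl l' hl' p hp hT => ?_⟩
  obtain ⟨d, rfl⟩ := Nat.exists_eq_add_of_le hl
  obtain ⟨d', rfl⟩ := Nat.exists_eq_add_of_le hl'
  rw [Function.iterate_add_apply _ (k + 1) d, Function.iterate_add_apply _ (k + 1) d']
  exact main φ _ _ p hp hT

theorem iterate_Q_eq_of_fixed (hs : P.SpeedBounds) (hr : P.BasicRegularity)
    {φ : ℝ → Fin n → ℝ} {u : ℝ × ℝ → Fin n → ℝ} (hu : ∀ p ∈ halfStrip, u p = P.Q φ u p) (k : ℕ) :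
    ∀ p ∈ halfStrip, (P.Q φ)^[k] u p = u p := by
  induction k with
  | zero => intro p _; rfl
  | succ k ih =>
    intro p hp
    rw [Function.iterate_succ_apply', hu p hp]
    funext j
    exact Q_congr hs hr j hp (fun _ => rfl) fun h i =>
      congrFun (ih _ (mem_halfStrip (P.outAbscissa_mem i) h)) i

/-- A fixed point of `Q_φ` that vanishes at some time vanishes from then on. -/
theorem eq_zero_of_fixed (hs : P.SpeedBounds) (hr : P.BasicRegularity)
    (hzero : ∀ t : ℝ, 0 ≤ t → P.h t 0 = 0)
    {φ : ℝ → Fin n → ℝ} {u : ℝ × ℝ → Fin n → ℝ} (hu : ∀ p ∈ halfStrip, u p = P.Q φ u p)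
    {T : ℝ} (hT : 0 ≤ T) (huT : ∀ x ∈ Icc (0 : ℝ) 1, u (x, T) = 0) :
    ∀ p ∈ halfStrip, T ≤ p.2 → u p = 0 := by
  -- The characteristic through `p` either enters at a time `≥ T`, where `h` maps the zero trace to
  -- zero, or crosses the line `t = T` inside the strip, from which the value zero is transported.
  have step : ∀ j, ∀ p ∈ halfStrip, T ≤ p.2 → (T ≤ P.charac j p (P.inAbscissa j) →
      ∀ i, u (P.outAbscissa i, P.charac j p (P.inAbscissa j)) i = 0) → u p j = 0 := by
    intro j p hp hpT h
    rw [hu p hp]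
    rcases le_or_gt T (P.charac j p (P.inAbscissa j)) with h' | h'
    · rw [Q_of_nonneg j φ u (hT.trans h')]
      have : P.inTrace (fun x => u (x, P.charac j p (P.inAbscissa j))) = 0 := funext (h h')
      simp [boundaryOp, this, hzero _ (hT.trans h')]
    · have h1 := isPreconnected_Icc.intermediate_value (P.inAbscissa_mem j) hp.1
        (continuousOn_charac hs hr j hp.1)
      rw [charac_self hs hr j hp.1] at h1
      obtain ⟨ξ, hξ, h2⟩ := h1 ⟨h'.le, hpT⟩
      have hq : (ξ, T) ∈ halfStrip := mem_halfStrip hξ hT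
      rw [Q_transport hs hr j hp hq h2.symm, ← hu _ hq, huT ξ hξ]
      simp
  intro p hp hpT
  obtain ⟨δ, hδ, hδT⟩ := exists_crossing_time hs hr p.2
  have claim : ∀ k : ℕ, ∀ i t, T ≤ t → t ≤ p.2 → t < T + k * δ →
      u (P.outAbscissa i, t) i = 0 := by
    intro k
    induction k with
    | zero => intro i t h0 _ h; simp at h; linarith
    | succ k ih =>
      intro i t h0 hT' hk
      refine step i _ (mem_halfStrip (P.outAbscissa_mem i) (hT.trans h0)) h0 fun h i' => ?_
      have h3 := hδT i t hT'
      push_cast at hk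
      exact ih i' _ h (by linarith) (by linarith)
  obtain ⟨k, hk⟩ := exists_nat_gt ((p.2 - T) / δ)
  rw [div_lt_iff₀ hδ] at hk
  funext j
  refine step j p hp hpT fun h i => ?_
  have h3 := charac_in_le hs hr j hp.1
  exact claim k i _ h h3 (by linarith)

/-- A solution is fixed by the iterates of `Q`, so the condition with `w = u` forces it to vanish at
time `T`, hence from then on. -/
theorem eq_zero_of_propagationVanishes (hs : P.SpeedBounds) (hr : P.BasicRegularity)
    (hzero : ∀ t : ℝ, 0 ≤ t → P.h t 0 = 0) (h : P.PropagationVanishes) :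
    ∃ T : ℝ, 0 < T ∧ ∀ (φ : ℝ → Fin n → ℝ) (u : ℝ × ℝ → Fin n → ℝ),
      P.IsContinuousSolution φ u → ∀ x ∈ Icc (0 : ℝ) 1, ∀ t : ℝ, T ≤ t → u (x, t) = 0 := by
  obtain ⟨T, hT, k, hk⟩ := h
  refine ⟨T, hT, fun φ u hu x hx t ht => ?_⟩
  -- The condition uses the trace `u(·, 0)` as initial function. It agrees with `φ` only on `[0,1]`,
  -- but all feet lie there.
  have hfix : ∀ p ∈ halfStrip, u p = P.Q (fun y => u (y, 0)) u p := by
    intro p hp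
    rw [hu.2.2 p hp]
    funext j
    refine Q_congr hs hr j hp (fun _ => ?_) fun _ _ => rfl
    rw [hu.2.1 _ (foot_mem hs hr j hp)]
  refine eq_zero_of_fixed hs hr hzero hfix hT.le (fun y hy => ?_) _
    (mem_halfStrip hx (hT.le.trans ht)) ht
  rw [← iterate_Q_eq_of_fixed hs hr hfix k _ (mem_halfStrip hy hT.le)]
  exact hk u hu.1 y hy

theorem isFTSContinuous_iff (hs : P.SpeedBounds) (hr : P.BasicRegularity)
    (hzero : ∀ t : ℝ, 0 ≤ t → P.h t 0 = 0)
    (hex : ∀ φ ∈ P.Ch, ∃ u : ℝ × ℝ → Fin n → ℝ, P.IsContinuousSolution φ u) :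
    P.IsFTSContinuous ↔ P.PropagationVanishes := by
  constructor
  · rintro ⟨T, hT, h⟩
    obtain ⟨K, hK⟩ := exists_iterate_Q_stable hs hr (T + 1)
    -- Solutions are known to vanish only strictly after `T`. At time `T + 1` the iterate applied to
    -- `w` equals the iterate applied to the solution with initial function `w(·, 0)`.
    refine ⟨T + 1, by linarith, K, fun w hw x hx => ?_⟩
    have hφ : (fun y => w (y, 0)) ∈ P.Ch :=
      ⟨hw.1.comp (by fun_prop) fun y hy => mem_halfStrip hy le_rfl, hw.2⟩
    obtain ⟨u, hu⟩ := hex _ hφ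
    have hp : (x, T + 1) ∈ halfStrip := mem_halfStrip hx (by linarith)
    rw [hK _ w u K le_rfl K le_rfl _ hp le_rfl, iterate_Q_eq_of_fixed hs hr hu.2.2 K _ hp]
    exact h _ hφ u hu x hx _ (by linarith)
  · intro h
    obtain ⟨T, hT, h⟩ := eq_zero_of_propagationVanishes hs hr hzero h
    exact ⟨T, hT, fun φ _ u hu x hx t ht => h φ u hu x hx t ht.le⟩

end HyperbolicProblem

/-! ### Divided differences in time on the half-strip -/

/-- The nearest point of the half-strip. -/
def clampStrip (q : ℝ × ℝ) : ℝ × ℝ := (max 0 (min 1 q.1), max q.2 0)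

theorem continuous_clampStrip : Continuous clampStrip := by
  unfold clampStrip; fun_prop

theorem clampStrip_mem (q : ℝ × ℝ) : clampStrip q ∈ halfStrip :=
  ⟨⟨le_max_left _ _, max_le zero_le_one (min_le_left _ _)⟩, le_max_right q.2 0⟩

theorem clampStrip_of_mem {q : ℝ × ℝ} (hq : q ∈ halfStrip) : clampStrip q = q := by
  unfold clampStrip
  rw [min_eq_right hq.1.2, max_eq_right hq.1.1, max_eq_left (show (0 : ℝ) ≤ q.2 from hq.2)]

theorem clampStrip_fst {ξ : ℝ} (hξ : ξ ∈ Icc (0 : ℝ) 1) (s : ℝ) :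
    clampStrip (ξ, s) = (ξ, max s 0) := by
  unfold clampStrip
  rw [min_eq_right hξ.2, max_eq_right hξ.1]

theorem uniqueDiffOn_halfStrip : UniqueDiffOn ℝ halfStrip :=
  (uniqueDiffOn_Icc zero_lt_one).prod (uniqueDiffOn_Ici 0)

/-- The time derivative of a function on the half-strip, extended to the plane. -/
noncomputable def timeDeriv (K : ℝ × ℝ → ℝ) (q : ℝ × ℝ) : ℝ :=
  fderivWithin ℝ K halfStrip (clampStrip q) (0, 1)

/-- Projection onto `Π` gives functions continuous on the whole plane, so the continuity of
parametric integrals can be used without domain restrictions. -/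
theorem continuous_comp_clampStrip {K : ℝ × ℝ → ℝ} (hK : ContinuousOn K halfStrip) :
    Continuous fun q => K (clampStrip q) :=
  hK.comp_continuous continuous_clampStrip clampStrip_mem

theorem continuous_timeDeriv {K : ℝ × ℝ → ℝ} (hK : ContDiffOn ℝ 1 K halfStrip) :
    Continuous (timeDeriv K) := by
  have h := (hK.continuousOn_fderivWithin uniqueDiffOn_halfStrip le_rfl).comp_continuous
    continuous_clampStrip clampStrip_mem
  exact h.clm_apply continuous_const

/-- The divided difference of `K` in time. -/
noncomputable def timeSlope (K : ℝ × ℝ → ℝ) (z : ℝ × ℝ × ℝ) : ℝ :=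
  ∫ θ in (0 : ℝ)..1, timeDeriv K (z.1, z.2.1 + θ * (z.2.2 - z.2.1))

/-- The integral form makes the divided difference continuous also on the diagonal, where it becomes
the time derivative. -/
theorem continuous_timeSlope {K : ℝ × ℝ → ℝ} (hK : ContDiffOn ℝ 1 K halfStrip) :
    Continuous (timeSlope K) := by
  have h := continuous_timeDeriv hK
  refine intervalIntegral.continuous_parametric_intervalIntegral_of_continuous'
    (f := fun (z : ℝ × ℝ × ℝ) θ => timeDeriv K (z.1, z.2.1 + θ * (z.2.2 - z.2.1))) ?_ 0 1
  simp only [Function.uncurry_def]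
  fun_prop

theorem timeSlope_mul {K : ℝ × ℝ → ℝ} (hK : ContDiffOn ℝ 1 K halfStrip) {η s s' : ℝ}
    (hη : η ∈ Icc (0 : ℝ) 1) (hs : 0 ≤ s) (hs' : 0 ≤ s') :
    K (η, s') - K (η, s) = timeSlope K (η, s, s') * (s' - s) := by
  have hmem : ∀ θ ∈ Icc (0 : ℝ) 1, (η, s + θ * (s' - s)) ∈ halfStrip := by
    intro θ hθ
    refine mem_prod.2 ⟨hη, ?_⟩
    change 0 ≤ s + θ * (s' - s)
    nlinarith [mul_nonneg hθ.1 hs', mul_nonneg (sub_nonneg.2 hθ.2) hs]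
  have hderiv : ∀ θ ∈ Icc (0 : ℝ) 1, HasDerivWithinAt (fun θ : ℝ => K (η, s + θ * (s' - s)))
      (timeDeriv K (η, s + θ * (s' - s)) * (s' - s)) (Icc 0 1) θ := by
    intro θ hθ
    have h1 : HasFDerivWithinAt K (fderivWithin ℝ K halfStrip (η, s + θ * (s' - s))) halfStrip
        (η, s + θ * (s' - s)) :=
      (hK.differentiableOn one_ne_zero _ (hmem θ hθ)).hasFDerivWithinAt
    have h2 : HasDerivWithinAt (fun θ : ℝ => (η, s + θ * (s' - s))) (0, s' - s) (Icc 0 1) θ := by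
      refine (hasDerivWithinAt_const _ _ _).prodMk ?_
      simpa using ((hasDerivWithinAt_id θ (Icc (0 : ℝ) 1)).mul_const (s' - s)).const_add s
    refine (h1.comp_hasDerivWithinAt θ h2 hmem).congr_deriv ?_
    unfold timeDeriv
    rw [clampStrip_of_mem (hmem θ hθ)]
    have : ((0 : ℝ), s' - s) = (s' - s) • ((0 : ℝ), (1 : ℝ)) := by simp
    rw [this, map_smul, smul_eq_mul, mul_comm]
  have hc : Continuous fun θ : ℝ => timeDeriv K (η, s + θ * (s' - s)) * (s' - s) := by
    have := continuous_timeDeriv hK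
    fun_prop
  have := intervalIntegral.integral_eq_sub_of_hasDerivAt_of_le zero_le_one
    (fun θ hθ => (hderiv θ hθ).continuousWithinAt)
    (fun θ hθ => (hderiv θ (Ioo_subset_Icc_self hθ)).hasDerivAt (Icc_mem_nhds hθ.1 hθ.2))
    (hc.intervalIntegrable 0 1)
  rw [intervalIntegral.integral_mul_const] at this
  unfold timeSlope
  simp only [this]
  congr 2
  · simp
  · simp

/-- Solutions of a linear homogeneous scalar equation. -/
theorem eq_mul_exp_integral {a b : ℝ} {y D : ℝ → ℝ} (hD : Continuous D)
    (hy : ∀ t ∈ uIcc a b, HasDerivWithinAt y (D t * y t) (uIcc a b) t) :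
    ∀ t ∈ uIcc a b, y t = y a * Real.exp (∫ s in a..t, D s) := by
  obtain ⟨L, hL⟩ := (isCompact_uIcc (a := a) (b := b)).exists_bound_of_continuousOn hD.continuousOn
  -- The error solves the same linear equation and vanishes at `a`, so Gronwall makes it zero.
  set z : ℝ → ℝ := fun t => y t - y a * Real.exp (∫ s in a..t, D s) with hz
  have hz' : ∀ t ∈ uIcc a b, HasDerivWithinAt z (D t * z t) (uIcc a b) t := by
    intro t ht
    have h1 := ((hD.integral_hasStrictDerivAt a t).hasDerivAt.exp.const_mul (y a)).hasDerivWithinAt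
      (s := uIcc a b)
    refine ((hy t ht).sub h1).congr_deriv ?_
    simp only [hz]
    ring
  intro t ht
  have := abs_le_mul_exp_of_abs_deriv_le (abs_nonneg L) hz' (fun t ht => by
    rw [abs_mul]
    exact mul_le_mul_of_nonneg_right ((hL t ht).trans (le_abs_self L)) (abs_nonneg _))
    (left_mem_uIcc (a := a) (b := b)) ht
  have h0 : z a = 0 := by simp [hz]
  rw [h0, abs_zero, zero_mul] at this
  have := abs_nonpos_iff.1 this
  simp only [hz] at this
  linarith

/-! ### Joint continuity of the flow -/

namespace HyperbolicProblem

variable {n : ℕ} {P : HyperbolicProblem n}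

theorem charac_le_add (hs : P.SpeedBounds) (hr : P.BasicRegularity) (j : Fin n) :
    ∃ C : ℝ, 0 < C ∧ ∀ p : ℝ × ℝ, p.1 ∈ Icc (0 : ℝ) 1 → ∀ ξ ∈ Icc (0 : ℝ) 1,
      |P.charac j p ξ - p.2| ≤ C * |ξ - p.1| := by
  obtain ⟨C, hC, h⟩ := hs.exists_abs_slope_le
  refine ⟨C, hC, fun p hp ξ hξ => ?_⟩
  obtain ⟨ζ, h1, h2⟩ := exists_charac_sub_eq hs hr j hp hp hξ
  rw [charac_self hs hr j hp] at h2
  rw [h2, abs_mul]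
  exact mul_le_mul_of_nonneg_right (h j (ζ, _) h1) (abs_nonneg _)

/-- The curves through `p` and `p₀` are compared at the abscissa of `p₀`, where they differ little
because the slopes are bounded; Gronwall spreads this to all abscissas. The remaining change in `ξ`
is made along the fixed curve through `p₀`. -/
theorem continuousOn_charac_uncurry (hs : P.SpeedBounds) (hr : P.BasicRegularity) (j : Fin n) :
    ContinuousOn (fun z : ℝ × (ℝ × ℝ) => P.charac j z.2 z.1) (Icc (0 : ℝ) 1 ×ˢ halfStrip) := by
  obtain ⟨C, hC, hCb⟩ := charac_le_add hs hr j
  have hub : ∀ p : ℝ × ℝ, p.1 ∈ Icc (0 : ℝ) 1 → ∀ ξ ∈ Icc (0 : ℝ) 1,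
      P.charac j p ξ ≤ p.2 + C := by
    intro p hp ξ hξ
    have h1 := (abs_le.1 (hCb p hp ξ hξ)).2
    have h2 : |ξ - p.1| ≤ 1 := abs_le.2 ⟨by linarith [hξ.1, hp.2], by linarith [hξ.2, hp.1]⟩
    nlinarith
  rintro ⟨ξ₀, p₀⟩ ⟨hξ₀, hp₀⟩
  obtain ⟨M, hM, hMb⟩ := exists_abs_sub_le_of_isCharacteristic hs hr j (p₀.2 + 1 + C)
  have hlim : Tendsto (fun z : ℝ × (ℝ × ℝ) =>
      (C * |p₀.1 - z.2.1| + |z.2.2 - p₀.2|) * M + |P.charac j p₀ z.1 - P.charac j p₀ ξ₀|)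
      (𝓝[Icc (0 : ℝ) 1 ×ˢ halfStrip] (ξ₀, p₀)) (𝓝 0) := by
    have h1 : ContinuousWithinAt (fun z : ℝ × (ℝ × ℝ) => P.charac j p₀ z.1)
        (Icc (0 : ℝ) 1 ×ˢ halfStrip) (ξ₀, p₀) :=
      ContinuousWithinAt.comp (t := Icc (0 : ℝ) 1) (g := P.charac j p₀) (f := Prod.fst)
        (continuousOn_charac hs hr j hp₀.1 ξ₀ hξ₀) continuous_fst.continuousWithinAt
        (fun z hz => hz.1)
    have h2 : ContinuousWithinAt (fun z : ℝ × (ℝ × ℝ) =>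
        (C * |p₀.1 - z.2.1| + |z.2.2 - p₀.2|) * M + |P.charac j p₀ z.1 - P.charac j p₀ ξ₀|)
        (Icc (0 : ℝ) 1 ×ˢ halfStrip) (ξ₀, p₀) := by
      refine ContinuousWithinAt.add ?_ (h1.sub continuousWithinAt_const).abs
      exact Continuous.continuousWithinAt (by fun_prop)
    have h3 := h2.tendsto
    simpa using h3
  refine tendsto_iff_dist_tendsto_zero.2 (squeeze_zero' (Eventually.of_forall fun _ => dist_nonneg)
    ?_ hlim)
  have hnear : ∀ᶠ z : ℝ × (ℝ × ℝ) in 𝓝[Icc (0 : ℝ) 1 ×ˢ halfStrip] (ξ₀, p₀), z.2.2 < p₀.2 + 1 :=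
    nhdsWithin_le_nhds ((continuous_snd.comp continuous_snd).continuousAt.eventually_lt
      continuousAt_const (by simp))
  filter_upwards [hnear, self_mem_nhdsWithin] with z hz hmem
  obtain ⟨hξ, hp⟩ := hmem
  rw [Real.dist_eq]
  have h1 := hMb z.2 p₀ _ _ (isCharacteristic_charac hs hr j hp.1)
    (isCharacteristic_charac hs hr j hp₀.1) (fun ξ hξ => (hub _ hp.1 ξ hξ).trans (by linarith))
    (fun ξ hξ => (hub _ hp₀.1 ξ hξ).trans (by linarith)) z.1 hξ p₀.1 hp₀.1
  rw [charac_self hs hr j hp₀.1] at h1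
  have h2 := hCb z.2 hp.1 p₀.1 hp₀.1
  have h3 : |P.charac j z.2 p₀.1 - p₀.2| ≤ C * |p₀.1 - z.2.1| + |z.2.2 - p₀.2| :=
    (abs_sub_le _ z.2.2 _).trans (by linarith)
  calc |P.charac j z.2 z.1 - P.charac j p₀ ξ₀|
      ≤ |P.charac j z.2 z.1 - P.charac j p₀ z.1| + |P.charac j p₀ z.1 - P.charac j p₀ ξ₀| :=
        abs_sub_le _ _ _
    _ ≤ _ := by
        gcongr
        exact h1.trans (mul_le_mul_of_nonneg_right h3 hM.le)

/-- The characteristics, extended continuously to all arguments. -/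
noncomputable def flow (P : HyperbolicProblem n) (j : Fin n) (ξ : ℝ) (q : ℝ × ℝ) : ℝ :=
  P.charac j (clampStrip q) (max 0 (min 1 ξ))

theorem flow_of_mem (j : Fin n) {ξ : ℝ} {q : ℝ × ℝ} (hξ : ξ ∈ Icc (0 : ℝ) 1)
    (hq : q ∈ halfStrip) : P.flow j ξ q = P.charac j q ξ := by
  unfold flow
  rw [clampStrip_of_mem hq, min_eq_right hξ.2, max_eq_right hξ.1]

theorem continuous_flow (hs : P.SpeedBounds) (hr : P.BasicRegularity) (j : Fin n) :
    Continuous fun z : ℝ × (ℝ × ℝ) => P.flow j z.1 z.2 := by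
  have h := (continuousOn_charac_uncurry hs hr j).comp_continuous
    (f := fun z : ℝ × (ℝ × ℝ) => (max 0 (min 1 z.1), clampStrip z.2))
    (by have := continuous_clampStrip; fun_prop)
    (fun z => ⟨⟨le_max_left _ _, max_le zero_le_one (min_le_left _ _)⟩, clampStrip_mem _⟩)
  exact h

/-- Downstream of its base point a characteristic stays in `Π`. For this reason the differentiated
integrals run to the exit: the slope frozen below `t = 0` is Lipschitz, but need not be `C¹`. -/
theorem flow_nonneg (hs : P.SpeedBounds) (hr : P.BasicRegularity) (j : Fin n) {q : ℝ × ℝ}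
    (hq : q ∈ halfStrip) {ξ : ℝ} (hξ : ξ ∈ Icc (0 : ℝ) 1) (h : P.dir j * q.1 ≤ P.dir j * ξ) :
    0 ≤ P.flow j ξ q := by
  rw [flow_of_mem j hξ hq]
  refine le_trans ?_ (charac_mono hs hr j hq.1 hq.1 hξ h)
  rw [charac_self hs hr j hq.1]
  exact hq.2

theorem contDiffOn_one_div_a (hs : P.SpeedBounds) (hC : P.C1Regularity) (j : Fin n) :
    ContDiffOn ℝ 1 (fun q => 1 / P.a j q) halfStrip :=
  contDiffOn_const.div (hC.1 j) fun _ hq => hs.a_ne_zero j hq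

theorem contDiffOn_b_div_a (hs : P.SpeedBounds) (hC : P.C1Regularity) (j : Fin n) :
    ContDiffOn ℝ 1 (fun q => P.b j q / P.a j q) halfStrip :=
  (hC.2.1 j).div (hC.1 j) fun _ hq => hs.a_ne_zero j hq

theorem mem_uIcc_out (j : Fin n) {ξ η : ℝ} (hξ : ξ ∈ Icc (0 : ℝ) 1)
    (hη : η ∈ uIcc ξ (P.outAbscissa j)) :
    η ∈ Icc (0 : ℝ) 1 ∧ P.dir j * ξ ≤ P.dir j * η := by
  refine ⟨ordConnected_Icc.uIcc_subset hξ (P.outAbscissa_mem j) hη, ?_⟩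
  rcases P.dir_cases j with ⟨-, h', -, h''⟩ | ⟨-, h', -, h''⟩ <;> rw [h''] at hη <;> rw [h'] <;>
    rcases mem_uIcc.1 hη with h | h <;> linarith [h.1, h.2, hξ.1, hξ.2]

/-- Two characteristics differ by an exponential factor. -/
theorem flow_sub_flow (hs : P.SpeedBounds) (hr : P.BasicRegularity) (hC : P.C1Regularity)
    (j : Fin n) {p p' : ℝ × ℝ} (hp : p ∈ halfStrip) (hp' : p' ∈ halfStrip) {ξ : ℝ}
    (hξ : ξ ∈ Icc (0 : ℝ) 1) (h : P.dir j * p.1 ≤ P.dir j * ξ)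
    (h' : P.dir j * p'.1 ≤ P.dir j * ξ) :
    ∀ η ∈ uIcc ξ (P.outAbscissa j), P.flow j η p' - P.flow j η p =
      (P.flow j ξ p' - P.flow j ξ p) * Real.exp (∫ ζ in ξ..η,
        timeSlope (fun q => 1 / P.a j q) (ζ, P.flow j ζ p, P.flow j ζ p')) := by
  have hF := contDiffOn_one_div_a hs hC j
  have hcf := continuous_flow hs hr j
  refine eq_mul_exp_integral (y := fun η => P.flow j η p' - P.flow j η p)
    (D := fun ζ => timeSlope (fun q => 1 / P.a j q) (ζ, P.flow j ζ p, P.flow j ζ p')) ?_ ?_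
  · have hts := continuous_timeSlope hF
    have h1 : Continuous fun ζ => P.flow j ζ p := hcf.comp (by fun_prop : Continuous fun ζ => (ζ, p))
    have h2 : Continuous fun ζ => P.flow j ζ p' :=
      hcf.comp (by fun_prop : Continuous fun ζ => (ζ, p'))
    fun_prop
  · intro η hη
    obtain ⟨hη1, hη2⟩ := mem_uIcc_out j hξ hη
    have hsub : uIcc ξ (P.outAbscissa j) ⊆ Icc 0 1 := fun ζ hζ => (mem_uIcc_out j hξ hζ).1
    have hd : ∀ q ∈ halfStrip, P.dir j * q.1 ≤ P.dir j * ξ → HasDerivWithinAt (fun η => P.flow j η q)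
        (1 / P.a j (η, P.flow j η q)) (uIcc ξ (P.outAbscissa j)) η := by
      intro q hq hqξ
      have h1 := (hasDerivWithinAt_charac hs hr j hq.1 hη1).mono hsub
      rw [← flow_of_mem j hη1 hq] at h1
      have h2 := h1.congr (fun ζ hζ => flow_of_mem j (hsub hζ) hq) (flow_of_mem j hη1 hq)
      unfold slope at h2
      simp only [max_eq_left (flow_nonneg hs hr j hq hη1 (hqξ.trans hη2))] at h2
      exact h2
    refine ((hd p' hp' h').sub (hd p hp h)).congr_deriv ?_
    exact timeSlope_mul hF hη1 (flow_nonneg hs hr j hp hη1 (h.trans hη2))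
      (flow_nonneg hs hr j hp' hη1 (h'.trans hη2))

end HyperbolicProblem

/-! ### Derivatives of integrals along characteristics -/

theorem abs_sub_le_of_mem_uIcc {a b c : ℝ} (h : c ∈ uIcc a b) : |c - b| ≤ |a - b| := by
  have := abs_sub_right_of_mem_uIcc h
  rwa [abs_sub_comm, abs_sub_comm a b]

/-- One of the two integrals is over a degenerate interval. The other is over an interval of length
`|p'.1 - p.1|` on which the integrand is close to `κ (p.1, p)`; in both cases the leading term has
the same sign. -/
theorem isLittleO_integral_sub_integral {κ : ℝ × (ℝ × ℝ) → ℝ} (hκ : Continuous κ) (p : ℝ × ℝ)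
    {ξ₀ : ℝ × ℝ → ℝ} (hξ₀ : ∀ p', ξ₀ p' = p.1 ∨ ξ₀ p' = p'.1) :
    (fun p' : ℝ × ℝ => (∫ η in p'.1..ξ₀ p', κ (η, p')) - (∫ η in p.1..ξ₀ p', κ (η, p)) +
      κ (p.1, p) * (p'.1 - p.1)) =o[𝓝 p] fun p' => p' - p := by
  rw [isLittleO_iff]
  intro ε hε
  obtain ⟨δ, hδ, hδε⟩ := Metric.continuousAt_iff.1 (hκ.continuousAt (x := (p.1, p))) ε hε
  filter_upwards [Metric.ball_mem_nhds p hδ] with p' hp'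
  have h1 : |p'.1 - p.1| ≤ ‖p' - p‖ := by
    have := norm_fst_le (p' - p)
    simpa using this
  have hp'δ : ‖p' - p‖ < δ := by rwa [Metric.mem_ball, dist_eq_norm] at hp'
  have hc1 : Continuous fun η => κ (η, p') := by fun_prop
  have hc2 : Continuous fun η => κ (η, p) := by fun_prop
  rcases hξ₀ p' with h | h
  · rw [h, intervalIntegral.integral_same, sub_zero]
    have e : (∫ η in p'.1..p.1, κ (η, p')) + κ (p.1, p) * (p'.1 - p.1) =
        ∫ η in p'.1..p.1, (κ (η, p') - κ (p.1, p)) := by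
      rw [intervalIntegral.integral_sub (hc1.intervalIntegrable _ _) (by simp),
        intervalIntegral.integral_const, smul_eq_mul]
      ring
    rw [e]
    refine (intervalIntegral.norm_integral_le_of_norm_le_const (C := ε) fun η hη => ?_).trans ?_
    · have hη' := uIoc_subset_uIcc hη
      have h2 : |η - p.1| ≤ |p'.1 - p.1| := abs_sub_le_of_mem_uIcc hη'
      refine (dist_eq_norm (κ (η, p')) (κ (p.1, p)) ▸ hδε ?_).le
      rw [Prod.dist_eq, max_lt_iff, Real.dist_eq]
      exact ⟨by linarith, hp'⟩
    · rw [abs_sub_comm]; gcongr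
  · rw [h, intervalIntegral.integral_same, zero_sub]
    have e : -(∫ η in p.1..p'.1, κ (η, p)) + κ (p.1, p) * (p'.1 - p.1) =
        -∫ η in p.1..p'.1, (κ (η, p) - κ (p.1, p)) := by
      rw [intervalIntegral.integral_sub (hc2.intervalIntegrable _ _) (by simp),
        intervalIntegral.integral_const, smul_eq_mul]
      ring
    rw [e, norm_neg]
    refine (intervalIntegral.norm_integral_le_of_norm_le_const (C := ε) fun η hη => ?_).trans ?_
    · have hη' := uIoc_subset_uIcc hη
      rw [uIcc_comm] at hη'
      have h2 : |η - p.1| ≤ |p'.1 - p.1| := abs_sub_le_of_mem_uIcc hη'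
      refine (dist_eq_norm (κ (η, p)) (κ (p.1, p)) ▸ hδε ?_).le
      rw [Prod.dist_eq, max_lt_iff, Real.dist_eq, dist_self]
      exact ⟨by linarith, hδ⟩
    · gcongr

namespace HyperbolicProblem

variable {n : ℕ} {P : HyperbolicProblem n}

/-- The integral of `K` along the `j`-th characteristic up to the boundary on which it leaves. -/
noncomputable def charInt (P : HyperbolicProblem n) (j : Fin n) (K : ℝ × ℝ → ℝ) (q : ℝ × ℝ) : ℝ :=
  ∫ η in q.1..P.outAbscissa j, K (clampStrip (η, P.flow j η q))

/-- The difference quotient of `charInt` between two characteristics. -/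
noncomputable def charSlope (P : HyperbolicProblem n) (j : Fin n) (K : ℝ × ℝ → ℝ)
    (z : ℝ × (ℝ × ℝ) × (ℝ × ℝ)) : ℝ :=
  ∫ η in z.1..P.outAbscissa j, timeSlope K (η, P.flow j η z.2.1, P.flow j η z.2.2) *
    Real.exp (∫ ζ in z.1..η,
      timeSlope (fun q => 1 / P.a j q) (ζ, P.flow j ζ z.2.1, P.flow j ζ z.2.2))

theorem continuous_timeSlope_flow (hs : P.SpeedBounds) (hr : P.BasicRegularity)
    (j : Fin n) {K : ℝ × ℝ → ℝ} (hK : ContDiffOn ℝ 1 K halfStrip) :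
    Continuous fun z : ((ℝ × ℝ) × (ℝ × ℝ)) × ℝ =>
      timeSlope K (z.2, P.flow j z.2 z.1.1, P.flow j z.2 z.1.2) := by
  have hts := continuous_timeSlope hK
  have hcf := continuous_flow hs hr j
  have h1 : Continuous fun z : ((ℝ × ℝ) × (ℝ × ℝ)) × ℝ => P.flow j z.2 z.1.1 :=
    hcf.comp (by fun_prop : Continuous fun z : ((ℝ × ℝ) × (ℝ × ℝ)) × ℝ => (z.2, z.1.1))
  have h2 : Continuous fun z : ((ℝ × ℝ) × (ℝ × ℝ)) × ℝ => P.flow j z.2 z.1.2 :=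
    hcf.comp (by fun_prop : Continuous fun z : ((ℝ × ℝ) × (ℝ × ℝ)) × ℝ => (z.2, z.1.2))
  exact hts.comp (continuous_snd.prodMk (h1.prodMk h2))

theorem continuous_charSlope (hs : P.SpeedBounds) (hr : P.BasicRegularity)
    (hC : P.C1Regularity) (j : Fin n) {K : ℝ × ℝ → ℝ} (hK : ContDiffOn ℝ 1 K halfStrip) :
    Continuous (P.charSlope j K) := by
  have hF := continuous_timeSlope_flow hs hr j (contDiffOn_one_div_a hs hC j)
  have hK' := continuous_timeSlope_flow hs hr j hK
  set f := fun z : ((ℝ × ℝ) × (ℝ × ℝ)) × ℝ =>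
    timeSlope (fun q => 1 / P.a j q) (z.2, P.flow j z.2 z.1.1, P.flow j z.2 z.1.2) with hf
  set g := fun z : ((ℝ × ℝ) × (ℝ × ℝ)) × ℝ =>
    timeSlope K (z.2, P.flow j z.2 z.1.1, P.flow j z.2 z.1.2) with hg
  have hprim : Continuous fun z : ((ℝ × ℝ) × (ℝ × ℝ)) × ℝ =>
      ∫ ζ in P.outAbscissa j..z.2, f (z.1, ζ) :=
    intervalIntegral.continuous_parametric_intervalIntegral_of_continuous
      (f := fun (z : ((ℝ × ℝ) × (ℝ × ℝ)) × ℝ) ζ => f (z.1, ζ))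
      (by simp only [Function.uncurry_def]; fun_prop) continuous_snd
  have hi : ∀ w u v, IntervalIntegrable (fun ζ => f (w, ζ)) volume u v := fun w u v =>
    (hF.comp (by fun_prop : Continuous fun ζ : ℝ => (w, ζ))).intervalIntegrable u v
  -- With the fixed base `outAbscissa`, each integral has a single moving end point, as required for
  -- joint continuity.
  have e : P.charSlope j K = fun z : ℝ × (ℝ × ℝ) × (ℝ × ℝ) =>
      -∫ η in P.outAbscissa j..z.1, g (z.2, η) *
        Real.exp ((∫ ζ in P.outAbscissa j..η, f (z.2, ζ)) -
          ∫ ζ in P.outAbscissa j..z.1, f (z.2, ζ)) := by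
    funext z
    unfold charSlope
    rw [intervalIntegral.integral_symm]
    congr 1
    refine intervalIntegral.integral_congr fun η _ => ?_
    simp only [hg]
    congr 2
    rw [intervalIntegral.integral_interval_sub_left (hi _ _ _) (hi _ _ _)]
  rw [e]
  refine Continuous.neg (intervalIntegral.continuous_parametric_intervalIntegral_of_continuous
      (f := fun (z : ℝ × (ℝ × ℝ) × (ℝ × ℝ)) η => g (z.2, η) *
        Real.exp ((∫ ζ in P.outAbscissa j..η, f (z.2, ζ)) -
          ∫ ζ in P.outAbscissa j..z.1, f (z.2, ζ))) ?_ continuous_fst)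
  simp only [Function.uncurry_def]
  have h1 : Continuous fun z : (ℝ × (ℝ × ℝ) × (ℝ × ℝ)) × ℝ =>
      ∫ ζ in P.outAbscissa j..z.2, f (z.1.2, ζ) :=
    hprim.comp (by fun_prop : Continuous fun z : (ℝ × (ℝ × ℝ) × (ℝ × ℝ)) × ℝ => (z.1.2, z.2))
  have h2 : Continuous fun z : (ℝ × (ℝ × ℝ) × (ℝ × ℝ)) × ℝ =>
      ∫ ζ in P.outAbscissa j..z.1.1, f (z.1.2, ζ) :=
    hprim.comp (by fun_prop : Continuous fun z : (ℝ × (ℝ × ℝ) × (ℝ × ℝ)) × ℝ => (z.1.2, z.1.1))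
  exact (hK'.comp (by fun_prop : Continuous fun z : (ℝ × (ℝ × ℝ) × (ℝ × ℝ)) × ℝ =>
    (z.1.2, z.2))).mul (Real.continuous_exp.comp (h1.sub h2))

theorem continuous_comp_flow (hs : P.SpeedBounds) (hr : P.BasicRegularity)
    (j : Fin n) {K : ℝ × ℝ → ℝ} (hK : ContinuousOn K halfStrip) :
    Continuous fun z : ℝ × (ℝ × ℝ) => K (clampStrip (z.1, P.flow j z.1 z.2)) := by
  have h1 := continuous_comp_clampStrip hK
  have h2 := continuous_flow hs hr j
  exact h1.comp (continuous_fst.prodMk h2)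

theorem flow_eq_add_integral (hs : P.SpeedBounds) (hr : P.BasicRegularity) (j : Fin n)
    {p : ℝ × ℝ} (hp : p ∈ halfStrip) {ξ : ℝ} (hξ : ξ ∈ Icc (0 : ℝ) 1) :
    P.flow j ξ p = p.2 + ∫ η in p.1..ξ, 1 / P.a j (clampStrip (η, P.flow j η p)) := by
  have hsub : uIcc p.1 ξ ⊆ Icc 0 1 := ordConnected_Icc.uIcc_subset hp.1 hξ
  have hsub' : Icc (min p.1 ξ) (max p.1 ξ) ⊆ Icc 0 1 := hsub
  have hcont : Continuous fun η => 1 / P.a j (clampStrip (η, P.flow j η p)) := by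
    have h := continuous_comp_flow hs hr j (K := fun q => 1 / P.a j q)
      (continuousOn_const.div (hr.1 j) fun _ hq => hs.a_ne_zero j hq)
    exact h.comp (by fun_prop : Continuous fun η : ℝ => (η, p))
  have h := intervalIntegral.integral_eq_sub_of_hasDeriv_right
    (f := P.charac j p) (f' := fun η => 1 / P.a j (clampStrip (η, P.flow j η p)))
    ((continuousOn_charac hs hr j hp.1).mono hsub) (fun η hη => by
      have hη' : η ∈ Icc (0 : ℝ) 1 := hsub' (Ioo_subset_Icc_self hη)
      have h0 : (0 : ℝ) < η := lt_of_le_of_lt (le_min hp.1.1 hξ.1) hη.1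
      have h1 : η < 1 := hη.2.trans_le (max_le hp.1.2 hξ.2)
      have h2 := hasDerivWithinAt_charac hs hr j hp.1 hη'
      rw [flow_of_mem j hη' hp, clampStrip_fst hη']
      exact (h2.hasDerivAt (Icc_mem_nhds h0 h1)).hasDerivWithinAt)
    (hcont.intervalIntegrable _ _)
  rw [h, charac_self hs hr j hp.1, flow_of_mem j hξ hp]
  ring

/-- The derivative `dt - dx / aⱼ(p)`, which vanishes in the characteristic direction. -/
noncomputable def transverse (P : HyperbolicProblem n) (j : Fin n) (p : ℝ × ℝ) : ℝ × ℝ →L[ℝ] ℝ :=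
  ContinuousLinearMap.snd ℝ ℝ ℝ - (1 / P.a j p) • ContinuousLinearMap.fst ℝ ℝ ℝ

theorem transverse_apply (j : Fin n) (p v : ℝ × ℝ) :
    P.transverse j p v = v.2 - 1 / P.a j p * v.1 := by
  simp [transverse]

/-- Two integrals are compared from the abscissa `ξ₀` that lies further downstream. The short piece
before `ξ₀` contributes `-K(p) dx`. Beyond `ξ₀` the difference is the gap of the two characteristics
at `ξ₀` times a continuous quotient, and this gap is `dt - dx / aⱼ` to first order. -/
theorem hasFDerivWithinAt_charInt (hs : P.SpeedBounds) (hr : P.BasicRegularity)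
    (hC : P.C1Regularity) (j : Fin n) {K : ℝ × ℝ → ℝ} (hK : ContDiffOn ℝ 1 K halfStrip)
    {p : ℝ × ℝ} (hp : p ∈ halfStrip) :
    HasFDerivWithinAt (P.charInt j K)
      (P.charSlope j K (p.1, p, p) • P.transverse j p - K p • ContinuousLinearMap.fst ℝ ℝ ℝ)
      halfStrip p := by
  have hF := contDiffOn_one_div_a hs hC j
  -- The one of `p.1` and `p'.1` that is further downstream: beyond it both characteristics lie in
  -- `Π`.
  set ξ₀ : ℝ × ℝ → ℝ := fun p' => p.1 + P.dir j * max 0 (P.dir j * (p'.1 - p.1)) with hξdef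
  have hdd := P.dir_mul_self j
  have hξ₀ : ∀ p', ξ₀ p' = p.1 ∨ ξ₀ p' = p'.1 := by
    intro p'
    rcases max_choice 0 (P.dir j * (p'.1 - p.1)) with h | h
    · left; simp [hξdef, h]
    · right
      simp only [hξdef, h]
      linear_combination (p'.1 - p.1) * hdd
  have hξ1 : ∀ p', P.dir j * p.1 ≤ P.dir j * ξ₀ p' := by
    intro p'
    have h1 : P.dir j * ξ₀ p' = P.dir j * p.1 + max 0 (P.dir j * (p'.1 - p.1)) := by
      simp only [hξdef]
      linear_combination (max 0 (P.dir j * (p'.1 - p.1))) * hdd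
    rw [h1]
    linarith [le_max_left 0 (P.dir j * (p'.1 - p.1))]
  have hξ2 : ∀ p', P.dir j * p'.1 ≤ P.dir j * ξ₀ p' := by
    intro p'
    have h1 : P.dir j * ξ₀ p' = P.dir j * p.1 + max 0 (P.dir j * (p'.1 - p.1)) := by
      simp only [hξdef]
      linear_combination (max 0 (P.dir j * (p'.1 - p.1))) * hdd
    rw [h1]
    linarith [le_max_right 0 (P.dir j * (p'.1 - p.1))]
  have hξcont : Continuous ξ₀ := by fun_prop
  have hξp : ξ₀ p = p.1 := by simp [hξdef]
  have hξmem : ∀ p' ∈ halfStrip, ξ₀ p' ∈ Icc (0 : ℝ) 1 := by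
    intro p' hp'
    rcases hξ₀ p' with h | h <;> rw [h]
    · exact hp.1
    · exact hp'.1
  have hκK := continuous_comp_flow hs hr j hK.continuousOn
  have hκF := continuous_comp_flow hs hr j hF.continuousOn
  have hself : clampStrip (p.1, P.flow j p.1 p) = p := by
    rw [flow_of_mem j hp.1 hp, charac_self hs hr j hp.1]
    exact clampStrip_of_mem hp
  have hoK := isLittleO_integral_sub_integral hκK p hξ₀
  have hoF := isLittleO_integral_sub_integral hκF p hξ₀
  simp only [hself] at hoK hoF
  set Δ : ℝ × ℝ → ℝ := fun p' => P.flow j (ξ₀ p') p' - P.flow j (ξ₀ p') p with hΔ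
  -- The integral equation of the flow reduces the gap to the preceding asymptotics with `1 / aⱼ` in
  -- place of `K`.
  have hoΔ : (fun p' => Δ p' - P.transverse j p (p' - p)) =o[𝓝[halfStrip] p] fun p' => p' - p := by
    refine (hoF.mono nhdsWithin_le_nhds).congr' ?_ EventuallyEq.rfl
    filter_upwards [self_mem_nhdsWithin] with p' hp'
    simp only [hΔ]
    rw [flow_eq_add_integral hs hr j hp' (hξmem p' hp'),
      flow_eq_add_integral hs hr j hp (hξmem p' hp'), transverse_apply]
    simp only [Prod.fst_sub, Prod.snd_sub]
    ring
  have hOΔ : Δ =O[𝓝[halfStrip] p] fun p' => p' - p := by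
    have := hoΔ.isBigO.add ((P.transverse j p).isBigO_comp (fun p' => p' - p) (𝓝[halfStrip] p))
    simpa using this
  have hB : (fun p' => P.charSlope j K (ξ₀ p', p, p') - P.charSlope j K (p.1, p, p))
      =o[𝓝[halfStrip] p] fun _ => (1 : ℝ) := by
    rw [isLittleO_one_iff]
    have h1 : Continuous fun p' => P.charSlope j K (ξ₀ p', p, p') - P.charSlope j K (p.1, p, p) :=
      ((continuous_charSlope hs hr hC j hK).comp
        (by fun_prop : Continuous fun p' : ℝ × ℝ => (ξ₀ p', p, p'))).sub continuous_const
    have h2 := (h1.tendsto p).mono_left (nhdsWithin_le_nhds (s := halfStrip))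
    simpa [hξp] using h2
  have hprod : (fun p' => Δ p' * (P.charSlope j K (ξ₀ p', p, p') - P.charSlope j K (p.1, p, p)))
      =o[𝓝[halfStrip] p] fun p' => p' - p := by
    have := (hOΔ.norm_right).mul_isLittleO hB
    simpa using this
  rw [hasFDerivWithinAt_iff_isLittleO]
  refine (((hoK.mono nhdsWithin_le_nhds).add hprod).add
    (hoΔ.const_mul_left (P.charSlope j K (p.1, p, p)))).congr' ?_ EventuallyEq.rfl
  filter_upwards [self_mem_nhdsWithin] with p' hp'
  have hi : ∀ q u v, IntervalIntegrable (fun η => K (clampStrip (η, P.flow j η q))) volume u v :=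
    fun q u v => (hκK.comp (by fun_prop : Continuous fun η : ℝ => (η, q))).intervalIntegrable u v
  have hsplit : ∀ q, P.charInt j K q = (∫ η in q.1..ξ₀ p', K (clampStrip (η, P.flow j η q))) +
      ∫ η in ξ₀ p'..P.outAbscissa j, K (clampStrip (η, P.flow j η q)) := fun q =>
    (intervalIntegral.integral_add_adjacent_intervals (hi _ _ _) (hi _ _ _)).symm
  have hdiff : (∫ η in ξ₀ p'..P.outAbscissa j, K (clampStrip (η, P.flow j η p'))) -
      (∫ η in ξ₀ p'..P.outAbscissa j, K (clampStrip (η, P.flow j η p))) =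
      Δ p' * P.charSlope j K (ξ₀ p', p, p') := by
    rw [← intervalIntegral.integral_sub (hi _ _ _) (hi _ _ _)]
    unfold charSlope
    rw [← intervalIntegral.integral_const_mul]
    refine intervalIntegral.integral_congr fun η hη => ?_
    obtain ⟨hη1, hη2⟩ := mem_uIcc_out j (hξmem p' hp') hη
    have h1 := flow_nonneg hs hr j hp hη1 ((hξ1 p').trans hη2)
    have h2 := flow_nonneg hs hr j hp' hη1 ((hξ2 p').trans hη2)
    simp only
    rw [clampStrip_fst hη1, clampStrip_fst hη1, max_eq_left h1, max_eq_left h2,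
      timeSlope_mul hK hη1 h1 h2,
      flow_sub_flow hs hr hC j hp hp' (hξmem p' hp') (hξ1 p') (hξ2 p') η hη]
    ring
  rw [hsplit p', hsplit p]
  simp only [sub_apply, smul_apply, smul_eq_mul,
    ContinuousLinearMap.coe_fst', Prod.fst_sub]
  linear_combination -hdiff

theorem continuousOn_transverse (hs : P.SpeedBounds) (hr : P.BasicRegularity) (j : Fin n) :
    ContinuousOn (P.transverse j) halfStrip := by
  unfold transverse
  exact continuousOn_const.sub ((continuousOn_const.div (hr.1 j) fun _ hq =>
    hs.a_ne_zero j hq).smul continuousOn_const)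

theorem contDiffOn_one_of_hasFDerivWithinAt {f : ℝ × ℝ → ℝ} {f' : ℝ × ℝ → ℝ × ℝ →L[ℝ] ℝ}
    (h : ∀ p ∈ halfStrip, HasFDerivWithinAt f (f' p) halfStrip p)
    (hc : ContinuousOn f' halfStrip) : ContDiffOn ℝ 1 f halfStrip := by
  rw [show (1 : WithTop ℕ∞) = 0 + 1 from rfl,
    contDiffOn_succ_iff_hasFDerivWithinAt_of_uniqueDiffOn uniqueDiffOn_halfStrip]
  exact ⟨by simp, f', contDiffOn_zero.2 hc, h⟩

theorem continuousOn_charSlope_self (hs : P.SpeedBounds) (hr : P.BasicRegularity)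
    (hC : P.C1Regularity) (j : Fin n) {K : ℝ × ℝ → ℝ} (hK : ContDiffOn ℝ 1 K halfStrip) :
    Continuous fun p : ℝ × ℝ => P.charSlope j K (p.1, p, p) :=
  (continuous_charSlope hs hr hC j hK).comp
    (by fun_prop : Continuous fun p : ℝ × ℝ => (p.1, p, p))

theorem contDiffOn_charInt (hs : P.SpeedBounds) (hr : P.BasicRegularity)
    (hC : P.C1Regularity) (j : Fin n) {K : ℝ × ℝ → ℝ} (hK : ContDiffOn ℝ 1 K halfStrip) :
    ContDiffOn ℝ 1 (P.charInt j K) halfStrip :=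
  contDiffOn_one_of_hasFDerivWithinAt (fun _ hp => hasFDerivWithinAt_charInt hs hr hC j hK hp)
    (((continuousOn_charSlope_self hs hr hC j hK).continuousOn.smul
      (continuousOn_transverse hs hr j)).sub (hK.continuousOn.smul continuousOn_const))

/-! ### Exit times, entry times and outgoing traces -/

/-- The time at which the `j`-th characteristic through `p` leaves the strip. -/
noncomputable def exitTime (P : HyperbolicProblem n) (j : Fin n) (p : ℝ × ℝ) : ℝ :=
  P.charac j p (P.outAbscissa j)

/-- The derivative of the exit time along the transverse direction. -/
noncomputable def exitRate (P : HyperbolicProblem n) (j : Fin n) (p : ℝ × ℝ) : ℝ :=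
  1 + P.charSlope j (fun q => 1 / P.a j q) (p.1, p, p)

/-- On the diagonal `charSlope` of `1 / aⱼ` is `∫ D e^{∫ D} = e^{∫ D} - 1`, so the rate is an
exponential. -/
theorem exitRate_pos (hs : P.SpeedBounds) (hr : P.BasicRegularity)
    (hC : P.C1Regularity) (j : Fin n) (p : ℝ × ℝ) : 0 < P.exitRate j p := by
  have hD : Continuous fun ζ => timeSlope (fun q => 1 / P.a j q) (ζ, P.flow j ζ p, P.flow j ζ p) :=
    (continuous_timeSlope_flow hs hr j (contDiffOn_one_div_a hs hC j)).comp
      (by fun_prop : Continuous fun ζ : ℝ => ((p, p), ζ))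
  set D := fun ζ => timeSlope (fun q => 1 / P.a j q) (ζ, P.flow j ζ p, P.flow j ζ p) with hDdef
  have h1 : ∀ η, HasDerivAt (fun η => Real.exp (∫ ζ in p.1..η, D ζ))
      (D η * Real.exp (∫ ζ in p.1..η, D ζ)) η := by
    intro η
    have := (hD.integral_hasStrictDerivAt p.1 η).hasDerivAt.exp
    rwa [mul_comm] at this
  have hprim : Continuous fun η => Real.exp (∫ ζ in p.1..η, D ζ) :=
    continuous_iff_continuousAt.2 fun η => (h1 η).continuousAt
  have h2 : P.charSlope j (fun q => 1 / P.a j q) (p.1, p, p) =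
      Real.exp (∫ ζ in p.1..P.outAbscissa j, D ζ) - Real.exp (∫ ζ in p.1..p.1, D ζ) :=
    intervalIntegral.integral_eq_sub_of_hasDerivAt (fun η _ => h1 η)
      ((hD.mul hprim).intervalIntegrable _ _)
  unfold exitRate
  rw [h2, intervalIntegral.integral_same, Real.exp_zero]
  linarith [Real.exp_pos (∫ ζ in p.1..P.outAbscissa j, D ζ)]

theorem continuous_exitRate (hs : P.SpeedBounds) (hr : P.BasicRegularity)
    (hC : P.C1Regularity) (j : Fin n) : Continuous (P.exitRate j) :=
  continuous_const.add (continuousOn_charSlope_self hs hr hC j (contDiffOn_one_div_a hs hC j))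

theorem hasFDerivWithinAt_exitTime (hs : P.SpeedBounds) (hr : P.BasicRegularity)
    (hC : P.C1Regularity) (j : Fin n) {p : ℝ × ℝ} (hp : p ∈ halfStrip) :
    HasFDerivWithinAt (P.exitTime j) (P.exitRate j p • P.transverse j p) halfStrip p := by
  have h1 := (hasFDerivWithinAt_snd (𝕜 := ℝ) (E := ℝ) (F := ℝ) (p := p) (s := halfStrip)).add
    (hasFDerivWithinAt_charInt hs hr hC j (contDiffOn_one_div_a hs hC j) hp)
  have h2 : ∀ q ∈ halfStrip, P.exitTime j q = q.2 + P.charInt j (fun q => 1 / P.a j q) q := by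
    intro q hq
    unfold exitTime charInt
    rw [← flow_of_mem j (P.outAbscissa_mem j) hq,
      flow_eq_add_integral hs hr j hq (P.outAbscissa_mem j)]
  refine (h1.congr h2 (h2 p hp)).congr_fderiv ?_
  unfold exitRate transverse
  module

theorem contDiffOn_exitTime (hs : P.SpeedBounds) (hr : P.BasicRegularity)
    (hC : P.C1Regularity) (j : Fin n) : ContDiffOn ℝ 1 (P.exitTime j) halfStrip :=
  contDiffOn_one_of_hasFDerivWithinAt (fun _ hp => hasFDerivWithinAt_exitTime hs hr hC j hp)
    ((continuous_exitRate hs hr hC j).continuousOn.smul (continuousOn_transverse hs hr j))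

theorem exitTime_nonneg (hs : P.SpeedBounds) (hr : P.BasicRegularity) (j : Fin n) {p : ℝ × ℝ}
    (hp : p ∈ halfStrip) : 0 ≤ P.exitTime j p :=
  (show (0 : ℝ) ≤ p.2 from hp.2).trans (le_charac_out hs hr j hp.1)

theorem out_mem_activeSet (hs : P.SpeedBounds) (hr : P.BasicRegularity) (j : Fin n) {p : ℝ × ℝ}
    (hp : p ∈ halfStrip) : P.outAbscissa j ∈ P.activeSet j p :=
  ⟨P.outAbscissa_mem j, exitTime_nonneg hs hr j hp⟩

/-- `Qu` is determined by its trace on the boundaries on which the components leave. -/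
theorem Q_eq_trace (hs : P.SpeedBounds) (hr : P.BasicRegularity) (j : Fin n)
    {p : ℝ × ℝ} (hp : p ∈ halfStrip) (φ : ℝ → Fin n → ℝ) (u : ℝ × ℝ → Fin n → ℝ) :
    P.Q φ u p j =
      P.weight j (P.outAbscissa j) p * P.Q φ u (P.outAbscissa j, P.exitTime j p) j :=
  Q_transport hs hr j (q := (P.outAbscissa j, P.exitTime j p)) hp
    (mem_halfStrip (P.outAbscissa_mem j) (exitTime_nonneg hs hr j hp)) rfl φ u

theorem weight_out_eq (hs : P.SpeedBounds) (hr : P.BasicRegularity) (j : Fin n)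
    {p : ℝ × ℝ} (hp : p ∈ halfStrip) :
    P.weight j (P.outAbscissa j) p =
      Real.exp (P.charInt j (fun q => P.b j q / P.a j q) p) := by
  rw [weight_eq]
  unfold charInt
  congr 1
  refine intervalIntegral.integral_congr fun η hη => ?_
  obtain ⟨h1, h2⟩ := mem_uIcc_out j hp.1 hη
  have h3 := flow_nonneg hs hr j hp h1 h2
  simp only
  rw [clampStrip_fst h1, max_eq_left h3, flow_of_mem j h1 hp]
  rfl

theorem contDiffOn_weight_out (hs : P.SpeedBounds) (hr : P.BasicRegularity)
    (hC : P.C1Regularity) (j : Fin n) :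
    ContDiffOn ℝ 1 (P.weight j (P.outAbscissa j)) halfStrip :=
  (contDiffOn_charInt hs hr hC j (contDiffOn_b_div_a hs hC j)).exp.congr
    fun _ hp => weight_out_eq hs hr j hp

/-- The cocycle rule turns the weight taken backwards from the exit into the reciprocal of the
forward weight, whose `C¹` dependence on the point is known. -/
theorem weight_foot_eq (hs : P.SpeedBounds) (hr : P.BasicRegularity) (j : Fin n) {s : ℝ}
    (hs0 : 0 ≤ s) {q : ℝ × ℝ} (hq : q ∈ halfStrip)
    (hpq : q.2 = P.charac j (P.outAbscissa j, s) q.1) :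
    P.weight j q.1 (P.outAbscissa j, s) = (P.weight j (P.outAbscissa j) q)⁻¹ := by
  have hp : (P.outAbscissa j, s) ∈ halfStrip := mem_halfStrip (P.outAbscissa_mem j) hs0
  have h := weight_mul_weight hs hr j hp hq hpq (out_mem_activeSet hs hr j hp)
  have h2 : P.weight j (P.outAbscissa j) (P.outAbscissa j, s) = 1 := weight_self j (_, s)
  rw [h2] at h
  exact eq_inv_of_mul_eq_one_left h

theorem exitTime_eq (hs : P.SpeedBounds) (hr : P.BasicRegularity) (j : Fin n) {s : ℝ}
    {q : ℝ × ℝ} (hq : q.1 ∈ Icc (0 : ℝ) 1)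
    (hpq : q.2 = P.charac j (P.outAbscissa j, s) q.1) : P.exitTime j q = s := by
  have hE := charac_eqOn hs hr (p := q) (p' := (P.outAbscissa j, s)) hq (P.outAbscissa_mem j) hq
    (by rw [charac_self hs hr j hq, hpq])
  unfold exitTime
  rw [hE (P.outAbscissa_mem j)]
  exact charac_self hs hr j (p := (P.outAbscissa j, s)) (P.outAbscissa_mem j)

/-- The time at which the `j`-th characteristic that leaves at time `s` has entered. -/
noncomputable def entryTime (P : HyperbolicProblem n) (j : Fin n) (s : ℝ) : ℝ :=
  P.flow j (P.inAbscissa j) (P.outAbscissa j, s)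

theorem entryTime_eq (j : Fin n) {s : ℝ} (hs0 : 0 ≤ s) :
    P.entryTime j s = P.charac j (P.outAbscissa j, s) (P.inAbscissa j) :=
  flow_of_mem j (P.inAbscissa_mem j) (mem_halfStrip (P.outAbscissa_mem j) hs0)

theorem continuous_entryTime (hs : P.SpeedBounds) (hr : P.BasicRegularity) (j : Fin n) :
    Continuous (P.entryTime j) :=
  (continuous_flow hs hr j).comp
    (by fun_prop : Continuous fun s : ℝ => (P.inAbscissa j, (P.outAbscissa j, s)))

/-- This and `exitTime_startPoint` exhibit entry time and starting point as local inverses of the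
exit time on the inflow side and on the bottom, from which they inherit differentiability. -/
theorem exitTime_entryTime (hs : P.SpeedBounds) (hr : P.BasicRegularity) (j : Fin n) {s : ℝ}
    (hs0 : 0 ≤ s) : P.exitTime j (P.inAbscissa j, P.entryTime j s) = s :=
  exitTime_eq hs hr j (q := (P.inAbscissa j, P.entryTime j s)) (P.inAbscissa_mem j)
    (entryTime_eq j hs0)

/-- The abscissa at time zero of the `j`-th characteristic that leaves at time `s`. -/
noncomputable def startPoint (P : HyperbolicProblem n) (j : Fin n) (s : ℝ) : ℝ :=
  P.foot j (P.outAbscissa j, s)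

theorem startPoint_mem (hs : P.SpeedBounds) (hr : P.BasicRegularity) (j : Fin n) {s : ℝ}
    (hs0 : 0 ≤ s) : P.startPoint j s ∈ Icc (0 : ℝ) 1 :=
  foot_mem hs hr j (mem_halfStrip (P.outAbscissa_mem j) hs0)

theorem charac_startPoint (hs : P.SpeedBounds) (hr : P.BasicRegularity) (j : Fin n) {s : ℝ}
    (hs0 : 0 ≤ s) (h : P.entryTime j s ≤ 0) :
    P.charac j (P.outAbscissa j, s) (P.startPoint j s) = 0 := by
  rw [entryTime_eq j hs0] at h
  rcases h.lt_or_eq with h | h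
  · exact charac_foot_eq_zero hs hr j (mem_halfStrip (P.outAbscissa_mem j) hs0) h
  · unfold startPoint
    rw [foot_eq_inAbscissa j h.ge, h]

theorem exitTime_startPoint (hs : P.SpeedBounds) (hr : P.BasicRegularity) (j : Fin n) {s : ℝ}
    (hs0 : 0 ≤ s) (h : P.entryTime j s ≤ 0) : P.exitTime j (P.startPoint j s, 0) = s :=
  exitTime_eq hs hr j (q := (P.startPoint j s, 0)) (startPoint_mem hs hr j hs0)
    (charac_startPoint hs hr j hs0 h).symm

/-- The curve leaving at `s` vanishes at its own starting point and has slope at least `c` in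
absolute value. Its value at the starting point for `s₀`, divided by `c`, therefore bounds the
displacement, and it tends to zero by continuity of the flow. -/
theorem continuousOn_startPoint (hs : P.SpeedBounds) (hr : P.BasicRegularity) (j : Fin n) :
    ContinuousOn (P.startPoint j) {s | 0 ≤ s ∧ P.entryTime j s ≤ 0} := by
  rintro s₀ ⟨h0, h0'⟩
  obtain ⟨c, hc, hcb⟩ := exists_le_slope hs hr (s₀ + 1)
  have hcont : Continuous fun s => P.flow j (P.startPoint j s₀) (P.outAbscissa j, s) :=
    (continuous_flow hs hr j).comp
      (by fun_prop : Continuous fun s : ℝ => (P.startPoint j s₀, (P.outAbscissa j, s)))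
  have hlim : Tendsto (fun s => |P.flow j (P.startPoint j s₀) (P.outAbscissa j, s)| / c)
      (𝓝[{s | 0 ≤ s ∧ P.entryTime j s ≤ 0}] s₀) (𝓝 0) := by
    have h1 : Tendsto (fun s => |P.flow j (P.startPoint j s₀) (P.outAbscissa j, s)| / c) (𝓝 s₀) _ :=
      (hcont.abs.div_const c).tendsto s₀
    rw [flow_of_mem j (startPoint_mem hs hr j h0) (mem_halfStrip (P.outAbscissa_mem j) h0),
      charac_startPoint hs hr j h0 h0', abs_zero, zero_div] at h1
    exact h1.mono_left nhdsWithin_le_nhds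
  refine tendsto_iff_dist_tendsto_zero.2 (squeeze_zero' (Eventually.of_forall fun _ => dist_nonneg)
    ?_ hlim)
  filter_upwards [self_mem_nhdsWithin,
    nhdsWithin_le_nhds (Iio_mem_nhds (show s₀ < s₀ + 1 by linarith))] with s hmem hlt
  obtain ⟨h1, h1'⟩ := hmem
  have hp : ((P.outAbscissa j, s) : ℝ × ℝ).1 ∈ Icc (0 : ℝ) 1 := P.outAbscissa_mem j
  obtain ⟨ζ, hζ, h2⟩ := exists_charac_sub_eq hs hr j hp (startPoint_mem hs hr j h1)
    (startPoint_mem hs hr j h0)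
  rw [charac_startPoint hs hr j h1 h1', sub_zero] at h2
  have h3 : P.charac j (P.outAbscissa j, s) ζ ≤ s := by
    have h := charac_mono hs hr j hp hζ hp (P.le_dir_mul_outAbscissa j hζ)
    rwa [charac_self hs hr j hp] at h
  have h4 := hcb j (ζ, P.charac j (P.outAbscissa j, s) ζ) hζ (h3.trans (le_of_lt hlt))
  have h5 : c ≤ |P.slope j (ζ, P.charac j (P.outAbscissa j, s) ζ)| := by
    refine h4.trans ((le_abs_self _).trans ?_)
    rw [abs_mul, abs_dir, one_mul]
  rw [flow_of_mem j (startPoint_mem hs hr j h0) (mem_halfStrip (P.outAbscissa_mem j) h1), h2,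
    abs_mul, le_div_iff₀ hc, Real.dist_eq, abs_sub_comm, mul_comm]
  exact mul_le_mul_of_nonneg_right h5 (abs_nonneg _)

theorem trace_of_nonneg (hs : P.SpeedBounds) (hr : P.BasicRegularity) (j : Fin n) {s : ℝ}
    (hs0 : 0 ≤ s) (h : 0 ≤ P.entryTime j s) (φ : ℝ → Fin n → ℝ) (u : ℝ × ℝ → Fin n → ℝ) :
    P.Q φ u (P.outAbscissa j, s) j =
      (P.weight j (P.outAbscissa j) (P.inAbscissa j, P.entryTime j s))⁻¹ *
        P.boundaryOp u (P.entryTime j s) j := by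
  have h' := entryTime_eq (P := P) j hs0
  rw [← weight_foot_eq hs hr j hs0 (q := (P.inAbscissa j, P.entryTime j s))
    (mem_halfStrip (P.inAbscissa_mem j) h) h', h']
  exact Q_of_nonneg j φ u (h' ▸ h)

theorem trace_of_neg (hs : P.SpeedBounds) (hr : P.BasicRegularity) (j : Fin n) {s : ℝ}
    (hs0 : 0 ≤ s) (h : P.entryTime j s < 0) (φ : ℝ → Fin n → ℝ) (u : ℝ × ℝ → Fin n → ℝ) :
    P.Q φ u (P.outAbscissa j, s) j =
      (P.weight j (P.outAbscissa j) (P.startPoint j s, 0))⁻¹ * φ (P.startPoint j s) j := by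
  rw [← weight_foot_eq hs hr j hs0 (q := (P.startPoint j s, 0))
    (mem_halfStrip (startPoint_mem hs hr j hs0) le_rfl) (charac_startPoint hs hr j hs0 h.le).symm]
  exact Q_of_neg hs hr j (mem_halfStrip (P.outAbscissa_mem j) hs0) φ u (entryTime_eq j hs0 ▸ h)

/-- At entry time zero `Q` takes its lateral branch, and compatibility at the corner makes the two
branches agree there. Both formulas thus hold on closed sets and can be glued continuously. -/
theorem trace_of_nonpos (hs : P.SpeedBounds) (hr : P.BasicRegularity) (j : Fin n) {s : ℝ}
    (hs0 : 0 ≤ s) (h : P.entryTime j s ≤ 0) {φ : ℝ → Fin n → ℝ} {u : ℝ × ℝ → Fin n → ℝ}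
    (hcompat : P.outTrace φ = P.boundaryOp u 0) :
    P.Q φ u (P.outAbscissa j, s) j =
      (P.weight j (P.outAbscissa j) (P.startPoint j s, 0))⁻¹ * φ (P.startPoint j s) j := by
  rcases h.lt_or_eq with h | h
  · exact trace_of_neg hs hr j hs0 h φ u
  · have h1 : P.startPoint j s = P.inAbscissa j :=
      foot_eq_inAbscissa j (entryTime_eq (P := P) j hs0 ▸ h.ge)
    rw [trace_of_nonneg hs hr j hs0 h.ge, h1, h, ← hcompat]
    rfl

theorem Q_initial (hs : P.SpeedBounds) (hr : P.BasicRegularity) {φ : ℝ → Fin n → ℝ}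
    {u : ℝ × ℝ → Fin n → ℝ} (hcompat : P.outTrace φ = P.boundaryOp u 0) {x : ℝ}
    (hx : x ∈ Icc (0 : ℝ) 1) : P.Q φ u (x, 0) = φ x := by
  have hp : (x, (0 : ℝ)) ∈ halfStrip := mem_halfStrip hx le_rfl
  funext j
  have h0 : P.charac j (x, 0) x = 0 := charac_self hs hr j (p := (x, 0)) hx
  have hf : P.foot j (x, 0) = x := foot_eq_of_charac_eq_zero hs hr j hx hx h0
  have hw : P.weight j x (x, 0) = 1 := weight_self j (x, 0)
  unfold Q shiftOp
  rw [hf, hw, h0, ← hcompat]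
  split_ifs with h
  · rw [h]; simp [outTrace]
  · simp

theorem continuousOn_trace (hs : P.SpeedBounds) (hr : P.BasicRegularity) (hC : P.C1Regularity)
    {φ : ℝ → Fin n → ℝ} {u : ℝ × ℝ → Fin n → ℝ} (hφ : ContinuousOn φ (Icc 0 1))
    (hu : ContinuousOn u halfStrip) (hcompat : P.outTrace φ = P.boundaryOp u 0) (j : Fin n) :
    ContinuousOn (fun s => P.Q φ u (P.outAbscissa j, s) j) (Ici 0) := by
  have hρ := continuous_entryTime hs hr j
  have hw := (contDiffOn_weight_out hs hr hC j).continuousOn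
  have hw0 : ∀ p, P.weight j (P.outAbscissa j) p ≠ 0 := fun p => (Real.exp_pos _).ne'
  have hcov : Ici (0 : ℝ) = {s | 0 ≤ s ∧ 0 ≤ P.entryTime j s} ∪
      {s | 0 ≤ s ∧ P.entryTime j s ≤ 0} := by
    ext s
    simp only [mem_Ici, mem_union, mem_ofPred_eq]
    exact ⟨fun h => (le_total 0 (P.entryTime j s)).imp (⟨h, ·⟩) (⟨h, ·⟩),
      fun h => h.elim (·.1) (·.1)⟩
  rw [hcov]
  refine ContinuousOn.union_of_isClosed ?_ ?_
    ((isClosed_le continuous_const continuous_id).inter (isClosed_le continuous_const hρ))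
    ((isClosed_le continuous_const continuous_id).inter (isClosed_le hρ continuous_const))
  · have h1 : ContinuousOn (fun s => (P.weight j (P.outAbscissa j)
        (P.inAbscissa j, P.entryTime j s))⁻¹ * P.boundaryOp u (P.entryTime j s) j)
        {s | 0 ≤ s ∧ 0 ≤ P.entryTime j s} := by
      refine ContinuousOn.mul (ContinuousOn.inv₀ (hw.comp (by fun_prop) fun s hs' =>
        mem_halfStrip (P.inAbscissa_mem j) hs'.2) fun s _ => hw0 _) ?_
      have h2 : ContinuousOn (fun s => ((P.entryTime j s,
          fun i => u (P.outAbscissa i, P.entryTime j s) i) : ℝ × (Fin n → ℝ)))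
          {s | 0 ≤ s ∧ 0 ≤ P.entryTime j s} := by
        refine hρ.continuousOn.prodMk (continuousOn_pi.2 fun i => ?_)
        refine (continuous_apply i).comp_continuousOn (hu.comp (by fun_prop) fun s hs' =>
          mem_halfStrip (P.outAbscissa_mem i) hs'.2)
      exact (continuous_apply j).comp_continuousOn (hr.2.2.2.comp h2 fun s hs' =>
        ⟨hs'.2, mem_univ _⟩)
    exact h1.congr fun s hs' => trace_of_nonneg hs hr j hs'.1 hs'.2 φ u
  · have hX := continuousOn_startPoint hs hr j
    have h1 : ContinuousOn (fun s => (P.weight j (P.outAbscissa j)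
        (P.startPoint j s, 0))⁻¹ * φ (P.startPoint j s) j)
        {s | 0 ≤ s ∧ P.entryTime j s ≤ 0} := by
      refine ContinuousOn.mul (ContinuousOn.inv₀ (hw.comp (hX.prodMk continuousOn_const)
        fun s hs' => mem_halfStrip (startPoint_mem hs hr j hs'.1) le_rfl) fun s _ => hw0 _) ?_
      exact (continuous_apply j).comp_continuousOn (hφ.comp hX fun s hs' =>
        startPoint_mem hs hr j hs'.1)
    exact h1.congr fun s hs' => trace_of_nonpos hs hr j hs'.1 hs'.2 hcompat

theorem continuousOn_Q (hs : P.SpeedBounds) (hr : P.BasicRegularity) (hC : P.C1Regularity)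
    {φ : ℝ → Fin n → ℝ} {u : ℝ × ℝ → Fin n → ℝ} (hφ : ContinuousOn φ (Icc 0 1))
    (hu : ContinuousOn u halfStrip) (hcompat : P.outTrace φ = P.boundaryOp u 0) :
    ContinuousOn (P.Q φ u) halfStrip := by
  refine continuousOn_pi.2 fun j => ?_
  have h1 := (continuousOn_trace hs hr hC hφ hu hcompat j).comp
    (contDiffOn_exitTime hs hr hC j).continuousOn fun p hp => exitTime_nonneg hs hr j hp
  exact ((contDiffOn_weight_out hs hr hC j).continuousOn.mul h1).congr fun p hp =>
    Q_eq_trace hs hr j hp φ u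

theorem boundaryOp_zero_eq {u : ℝ × ℝ → Fin n → ℝ} {φ : ℝ → Fin n → ℝ}
    (h : ∀ x ∈ Icc (0 : ℝ) 1, u (x, 0) = φ x) :
    P.boundaryOp u 0 = P.h 0 (P.inTrace φ) := by
  unfold boundaryOp
  congr 1
  funext i
  exact congrFun (h _ (P.outAbscissa_mem i)) i

/-- The initial values have to be carried through the induction, because they restore the corner
compatibility before each application of `Q`. -/
theorem continuousOn_iterate_Q (hs : P.SpeedBounds) (hr : P.BasicRegularity)
    (hC : P.C1Regularity) {φ : ℝ → Fin n → ℝ} (hφ : φ ∈ P.Ch) {u : ℝ × ℝ → Fin n → ℝ}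
    (hu : ContinuousOn u halfStrip) (hu0 : ∀ x ∈ Icc (0 : ℝ) 1, u (x, 0) = φ x) (k : ℕ) :
    ContinuousOn ((P.Q φ)^[k] u) halfStrip ∧
      ∀ x ∈ Icc (0 : ℝ) 1, (P.Q φ)^[k] u (x, 0) = φ x := by
  induction k with
  | zero => exact ⟨hu, hu0⟩
  | succ k ih =>
    rw [Function.iterate_succ_apply']
    have hcompat : P.outTrace φ = P.boundaryOp ((P.Q φ)^[k] u) 0 := by
      rw [boundaryOp_zero_eq ih.2]; exact hφ.2
    exact ⟨continuousOn_Q hs hr hC hφ.1 ih.1 hcompat, fun x hx => Q_initial hs hr hcompat hx⟩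

end HyperbolicProblem

/-! ### Classical solutions for smooth initial functions -/

theorem contDiffOn_one_of_hasDerivAt {f f' : ℝ → ℝ} {O : Set ℝ} (hO : IsOpen O)
    (h : ∀ x ∈ O, HasDerivAt f (f' x) x) (hc : ContinuousOn f' O) : ContDiffOn ℝ 1 f O := by
  rw [show (1 : WithTop ℕ∞) = 0 + 1 from rfl, contDiffOn_succ_iff_deriv_of_isOpen hO]
  exact ⟨fun x hx => (h x hx).differentiableAt.differentiableWithinAt, by simp,
    contDiffOn_zero.2 (hc.congr fun x hx => (h x hx).deriv)⟩

namespace HyperbolicProblem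

variable {n : ℕ} {P : HyperbolicProblem n}

theorem hasDerivAt_exitTime_fst (hs : P.SpeedBounds) (hr : P.BasicRegularity)
    (hC : P.C1Regularity) (j : Fin n) {x : ℝ} (hx : x ∈ Ioo (0 : ℝ) 1) :
    HasDerivAt (fun y => P.exitTime j (y, 0)) (-(P.exitRate j (x, 0) * (1 / P.a j (x, 0)))) x := by
  have hmem : ∀ y ∈ Icc (0 : ℝ) 1, (y, (0 : ℝ)) ∈ halfStrip := fun y hy => mem_halfStrip hy le_rfl
  have h1 := hasFDerivWithinAt_exitTime hs hr hC j (hmem x (Ioo_subset_Icc_self hx))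
  have h2 : HasDerivWithinAt (fun y : ℝ => (y, (0 : ℝ))) (1, 0) (Icc 0 1) x :=
    (hasDerivWithinAt_id x _).prodMk (hasDerivWithinAt_const _ _ _)
  refine ((h1.comp_hasDerivWithinAt x h2 hmem).hasDerivAt
    (Icc_mem_nhds hx.1 hx.2)).congr_deriv ?_
  simp [transverse]

theorem hasDerivAt_exitTime_snd (hs : P.SpeedBounds) (hr : P.BasicRegularity)
    (hC : P.C1Regularity) (j : Fin n) {t : ℝ} (ht : 0 < t) :
    HasDerivAt (fun t => P.exitTime j (P.inAbscissa j, t)) (P.exitRate j (P.inAbscissa j, t)) t := by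
  have hmem : ∀ y ∈ Ici (0 : ℝ), (P.inAbscissa j, y) ∈ halfStrip :=
    fun y hy => mem_halfStrip (P.inAbscissa_mem j) hy
  have h1 := hasFDerivWithinAt_exitTime hs hr hC j (hmem t ht.le)
  have h2 : HasDerivWithinAt (fun y : ℝ => (P.inAbscissa j, y)) (0, 1) (Ici 0) t :=
    (hasDerivWithinAt_const _ _ _).prodMk (hasDerivWithinAt_id t _)
  refine ((h1.comp_hasDerivWithinAt t h2 hmem).hasDerivAt (Ici_mem_nhds ht)).congr_deriv ?_
  simp [transverse]

theorem contDiffOn_entryTime (hs : P.SpeedBounds) (hr : P.BasicRegularity)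
    (hC : P.C1Regularity) (j : Fin n) :
    ContDiffOn ℝ 1 (P.entryTime j) {s | 0 < s ∧ 0 < P.entryTime j s} := by
  have hρ := continuous_entryTime hs hr j
  have hO : IsOpen {s | 0 < s ∧ 0 < P.entryTime j s} :=
    (isOpen_lt continuous_const continuous_id).inter (isOpen_lt continuous_const hρ)
  refine contDiffOn_one_of_hasDerivAt
    (f' := fun s => (P.exitRate j (P.inAbscissa j, P.entryTime j s))⁻¹) hO ?_ ?_
  · intro s hs'
    refine HasDerivAt.of_local_left_inverse hρ.continuousAt
      (hasDerivAt_exitTime_snd hs hr hC j hs'.2) (exitRate_pos hs hr hC j _).ne' ?_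
    filter_upwards [hO.mem_nhds hs'] with r hr'
    exact exitTime_entryTime hs hr j hr'.1.le
  · refine Continuous.continuousOn (Continuous.inv₀ ?_ fun s => (exitRate_pos hs hr hC j _).ne')
    exact (continuous_exitRate hs hr hC j).comp (by fun_prop)

theorem isOpen_startSet (hs : P.SpeedBounds) (hr : P.BasicRegularity) (j : Fin n) :
    IsOpen {s | 0 < s ∧ P.entryTime j s < 0} :=
  (isOpen_lt continuous_const continuous_id).inter
    (isOpen_lt (continuous_entryTime hs hr j) continuous_const)

theorem startPoint_mem_Ioo (hs : P.SpeedBounds) (hr : P.BasicRegularity) (j : Fin n) {s : ℝ}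
    (hs0 : 0 < s) (h : P.entryTime j s < 0) : P.startPoint j s ∈ Ioo (0 : ℝ) 1 := by
  refine P.mem_Ioo_of_ne j (startPoint_mem hs hr j hs0.le) ?_ ?_
  · exact foot_ne_inAbscissa hs hr j (mem_halfStrip (P.outAbscissa_mem j) hs0.le)
      (entryTime_eq (P := P) j hs0.le ▸ h)
  · intro h1
    have h2 := charac_startPoint hs hr j hs0.le h.le
    rw [h1, charac_self hs hr j (p := (P.outAbscissa j, s)) (P.outAbscissa_mem j)] at h2
    exact hs0.ne' h2

theorem contDiffOn_startPoint (hs : P.SpeedBounds) (hr : P.BasicRegularity)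
    (hC : P.C1Regularity) (j : Fin n) :
    ContDiffOn ℝ 1 (P.startPoint j) {s | 0 < s ∧ P.entryTime j s < 0} := by
  have hO := isOpen_startSet hs hr j
  have hX : ContinuousOn (P.startPoint j) {s | 0 < s ∧ P.entryTime j s < 0} :=
    (continuousOn_startPoint hs hr j).mono fun s h => ⟨h.1.le, h.2.le⟩
  have hmem : ∀ s ∈ {s | 0 < s ∧ P.entryTime j s < 0},
      (P.startPoint j s, (0 : ℝ)) ∈ halfStrip := fun s h =>
    mem_halfStrip (startPoint_mem hs hr j h.1.le) le_rfl
  have hne : ∀ s ∈ {s | 0 < s ∧ P.entryTime j s < 0},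
      -(P.exitRate j (P.startPoint j s, 0) * (1 / P.a j (P.startPoint j s, 0))) ≠ 0 := by
    intro s h
    have := hs.a_ne_zero j (hmem s h)
    exact neg_ne_zero.2 (mul_ne_zero (exitRate_pos hs hr hC j _).ne' (one_div_ne_zero this))
  refine contDiffOn_one_of_hasDerivAt
    (f' := fun s => (-(P.exitRate j (P.startPoint j s, 0) *
      (1 / P.a j (P.startPoint j s, 0))))⁻¹) hO ?_ ?_
  · intro s hs'
    refine HasDerivAt.of_local_left_inverse (hX.continuousAt (hO.mem_nhds hs'))
      (hasDerivAt_exitTime_fst hs hr hC j (startPoint_mem_Ioo hs hr j hs'.1 hs'.2)) (hne s hs') ?_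
    filter_upwards [hO.mem_nhds hs'] with r hr'
    exact exitTime_startPoint hs hr j hr'.1.le hr'.2.le
  · refine ContinuousOn.inv₀ (ContinuousOn.neg (ContinuousOn.mul ?_ ?_)) hne
    · exact (continuous_exitRate hs hr hC j).comp_continuousOn (hX.prodMk continuousOn_const)
    · exact (contDiffOn_one_div_a hs hC j).continuousOn.comp (hX.prodMk continuousOn_const) hmem

/-- The traces of `u` on the boundaries on which the components leave are continuously
differentiable and vanish near `t = 0`. -/
def SmoothTraces (P : HyperbolicProblem n) (u : ℝ × ℝ → Fin n → ℝ) : Prop :=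
  ∀ j, ContDiffOn ℝ 1 (fun s => u (P.outAbscissa j, s) j) (Ici 0) ∧
    ∀ᶠ s in 𝓝[≥] (0 : ℝ), u (P.outAbscissa j, s) j = 0

theorem boundaryOp_eventually_zero {u : ℝ × ℝ → Fin n → ℝ} (hu : P.SmoothTraces u)
    (hzero : ∀ t : ℝ, 0 ≤ t → P.h t 0 = 0) :
    ∃ ε > 0, ∀ t, 0 ≤ t → t < ε → P.boundaryOp u t = 0 := by
  have h : ∀ᶠ t in 𝓝[≥] (0 : ℝ), P.boundaryOp u t = 0 := by
    have h1 := eventually_all.2 fun j => (hu j).2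
    filter_upwards [h1, self_mem_nhdsWithin] with t ht ht0
    have : P.inTrace (fun x => u (x, t)) = 0 := funext ht
    simp [boundaryOp, this, hzero t ht0]
  obtain ⟨ε, hε, hsub⟩ := (mem_nhdsGE_iff_exists_Ico_subset).1 h
  exact ⟨ε, hε, fun t h0 h1 => hsub ⟨h0, h1⟩⟩

/-- A continuously differentiable initial function that vanishes near the end points. -/
def SmoothInitial (φ : ℝ → Fin n → ℝ) : Prop :=
  ContDiff ℝ 1 φ ∧ φ =ᶠ[𝓝 0] 0 ∧ φ =ᶠ[𝓝 1] 0

theorem SmoothInitial.eventually_in {φ : ℝ → Fin n → ℝ} (hφ : SmoothInitial φ) (j : Fin n) :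
    φ =ᶠ[𝓝 (P.inAbscissa j)] 0 := by
  rcases P.dir_cases j with ⟨-, -, h, -⟩ | ⟨-, -, h, -⟩ <;> rw [h]
  exacts [hφ.2.1, hφ.2.2]

theorem SmoothInitial.eventually_out {φ : ℝ → Fin n → ℝ} (hφ : SmoothInitial φ) (j : Fin n) :
    φ =ᶠ[𝓝 (P.outAbscissa j)] 0 := by
  rcases P.dir_cases j with ⟨-, -, -, h⟩ | ⟨-, -, -, h⟩ <;> rw [h]
  exacts [hφ.2.2, hφ.2.1]

theorem entryTime_zero_neg (hs : P.SpeedBounds) (hr : P.BasicRegularity) (j : Fin n) :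
    P.entryTime j 0 < 0 := by
  rw [entryTime_eq j le_rfl]
  obtain ⟨δ, hδ, h⟩ := exists_crossing_time hs hr 0
  linarith [h j 0 le_rfl]

/-- For positive and for negative entry times the trace is a composition of `C¹` functions. The two
formulas meet at entry time zero, where both vanish nearby since `φ` vanishes near the ends and the
traces vanish near `t = 0`; no compatibility of derivatives has to be checked. -/
theorem SmoothTraces.Q (hs : P.SpeedBounds) (hr : P.BasicRegularity)
    (hC : P.C1Regularity) (hzero : ∀ t : ℝ, 0 ≤ t → P.h t 0 = 0) {φ : ℝ → Fin n → ℝ}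
    (hφ : SmoothInitial φ) {u : ℝ × ℝ → Fin n → ℝ} (hu : P.SmoothTraces u) :
    P.SmoothTraces (P.Q φ u) := by
  intro j
  have hρ := continuous_entryTime hs hr j
  have hX := continuousOn_startPoint hs hr j
  have hw := contDiffOn_weight_out hs hr hC j
  have hw0 : ∀ p, P.weight j (P.outAbscissa j) p ≠ 0 := fun p => (Real.exp_pos _).ne'
  set y : ℝ → ℝ := fun s => P.Q φ u (P.outAbscissa j, s) j with hy
  have hstart : ∀ s₀, 0 ≤ s₀ → P.entryTime j s₀ ≤ 0 → φ =ᶠ[𝓝 (P.startPoint j s₀)] 0 →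
      ∀ᶠ s in 𝓝 s₀, 0 ≤ s → P.entryTime j s < 0 → y s = 0 := by
    intro s₀ h0 h0' hev
    have h1 : ∀ᶠ s in 𝓝[{s | 0 ≤ s ∧ P.entryTime j s ≤ 0}] s₀, φ (P.startPoint j s) = 0 :=
      (hX s₀ ⟨h0, h0'⟩).eventually hev
    filter_upwards [eventually_nhdsWithin_iff.1 h1] with s hs1 hs2 hs3
    simp only [hy]
    rw [trace_of_neg hs hr j hs2 hs3 φ u, hs1 ⟨hs2, hs3.le⟩]
    simp
  have hy0 : ∀ᶠ s in 𝓝[≥] (0 : ℝ), y s = 0 := by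
    have h1 := entryTime_zero_neg hs hr j
    have h2 : P.startPoint j 0 = P.outAbscissa j :=
      foot_eq_of_charac_eq_zero hs hr j (P.outAbscissa_mem j) (P.outAbscissa_mem j)
        (charac_self hs hr j (p := (P.outAbscissa j, 0)) (P.outAbscissa_mem j))
    filter_upwards [nhdsWithin_le_nhds (hstart 0 le_rfl h1.le (h2 ▸ hφ.eventually_out j)),
      self_mem_nhdsWithin,
      nhdsWithin_le_nhds (hρ.continuousAt.eventually_lt continuousAt_const h1)] with s h3 h4 h5
    exact h3 h4 h5
  refine ⟨fun s hs0 => ?_, hy0⟩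
  rcases (show (0 : ℝ) ≤ s from hs0).eq_or_lt with rfl | hpos
  · exact (contDiffWithinAt_const (c := (0 : ℝ))).congr_of_eventuallyEq hy0
      (hy0.self_of_nhdsWithin self_mem_Ici)
  rcases lt_trichotomy (P.entryTime j s) 0 with h | h | h
  · have hmem : MapsTo (fun s => (P.startPoint j s, (0 : ℝ))) {s | 0 < s ∧ P.entryTime j s < 0}
        halfStrip := fun s h => mem_halfStrip (startPoint_mem hs hr j h.1.le) le_rfl
    have hX' := contDiffOn_startPoint hs hr hC j
    have h1 : ContDiffOn ℝ 1 (fun s => (P.weight j (P.outAbscissa j) (P.startPoint j s, 0))⁻¹ *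
        φ (P.startPoint j s) j) {s | 0 < s ∧ P.entryTime j s < 0} := by
      refine ContDiffOn.mul (ContDiffOn.inv (hw.comp (hX'.prodMk contDiffOn_const) hmem)
        fun s _ => hw0 _) ?_
      exact (contDiff_pi.1 hφ.1 j).comp_contDiffOn hX'
    have h2 : ContDiffOn ℝ 1 y {s | 0 < s ∧ P.entryTime j s < 0} :=
      h1.congr fun s hs' => trace_of_neg hs hr j hs'.1.le hs'.2 φ u
    exact (h2.contDiffAt ((isOpen_startSet hs hr j).mem_nhds ⟨hpos, h⟩)).contDiffWithinAt
  -- The characteristic starts exactly at the inflow corner. On one side of `s` the initial function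
  -- vanishes, on the other the boundary data do.
  · obtain ⟨ε, hε, hεb⟩ := boundaryOp_eventually_zero hu hzero
    have h2 : P.startPoint j s = P.inAbscissa j :=
      foot_eq_inAbscissa j (entryTime_eq (P := P) j hs0 ▸ h.ge)
    have hev : y =ᶠ[𝓝 s] fun _ => 0 := by
      filter_upwards [hstart s hs0 h.le (h2 ▸ hφ.eventually_in j), Ioi_mem_nhds hpos,
        hρ.continuousAt.eventually_lt continuousAt_const (h.trans_lt hε)] with r h3 h4 h5
      rcases lt_or_ge (P.entryTime j r) 0 with h6 | h6
      · exact h3 (le_of_lt h4) h6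
      · simp only [hy]
        rw [trace_of_nonneg hs hr j (le_of_lt h4) h6, hεb _ h6 h5]
        simp
    exact ((contDiffAt_const (c := (0 : ℝ))).congr_of_eventuallyEq hev).contDiffWithinAt
  · have hρ' := contDiffOn_entryTime hs hr hC j
    have hO : IsOpen {s | 0 < s ∧ 0 < P.entryTime j s} :=
      (isOpen_lt continuous_const continuous_id).inter (isOpen_lt continuous_const hρ)
    have h1 : ContDiffOn ℝ 1 (fun s => (P.weight j (P.outAbscissa j)
        (P.inAbscissa j, P.entryTime j s))⁻¹ * P.boundaryOp u (P.entryTime j s) j)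
        {s | 0 < s ∧ 0 < P.entryTime j s} := by
      refine ContDiffOn.mul (ContDiffOn.inv (hw.comp (contDiffOn_const.prodMk hρ') fun s hs' =>
        mem_halfStrip (P.inAbscissa_mem j) hs'.2.le) fun s _ => hw0 _) ?_
      have h2 : ContDiffOn ℝ 1 (fun s => ((P.entryTime j s,
          fun i => u (P.outAbscissa i, P.entryTime j s) i) : ℝ × (Fin n → ℝ)))
          {s | 0 < s ∧ 0 < P.entryTime j s} := by
        refine hρ'.prodMk (contDiffOn_pi.2 fun i => ?_)
        exact (hu i).1.comp hρ' fun s hs' => hs'.2.le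
      exact contDiffOn_pi.1 (hC.2.2.comp h2 fun s hs' => ⟨hs'.2.le, mem_univ _⟩) j
    have h2 : ContDiffOn ℝ 1 y {s | 0 < s ∧ 0 < P.entryTime j s} :=
      h1.congr fun s hs' => trace_of_nonneg hs hr j hs'.1.le hs'.2.le φ u
    exact (h2.contDiffAt (hO.mem_nhds ⟨hpos, h⟩)).contDiffWithinAt

theorem contDiffOn_Q (hs : P.SpeedBounds) (hr : P.BasicRegularity)
    (hC : P.C1Regularity) {φ : ℝ → Fin n → ℝ} {u : ℝ × ℝ → Fin n → ℝ}
    (hQ : P.SmoothTraces (P.Q φ u)) : ContDiffOn ℝ 1 (P.Q φ u) halfStrip := by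
  refine contDiffOn_pi.2 fun j => ?_
  have h1 := (hQ j).1.comp (contDiffOn_exitTime hs hr hC j) fun p hp => exitTime_nonneg hs hr j hp
  exact ((contDiffOn_weight_out hs hr hC j).mul h1).congr fun p hp => Q_eq_trace hs hr j hp φ u

theorem halfStrip_mem_nhds {p : ℝ × ℝ} (h0 : 0 < p.1) (h1 : p.1 < 1) (h2 : 0 < p.2) :
    halfStrip ∈ 𝓝 p :=
  prod_mem_nhds (Icc_mem_nhds h0 h1) (Ici_mem_nhds h2)

/-- `Qu` is `exp` of an integral of `bⱼ / aⱼ` times a function of the exit time. The operator `∂ₜ +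
aⱼ ∂ₓ` annihilates the transverse derivative, hence the exit time, and maps the integral to `-bⱼ`.
-/
theorem pde_Q (hs : P.SpeedBounds) (hr : P.BasicRegularity)
    (hC : P.C1Regularity) {φ : ℝ → Fin n → ℝ} {u : ℝ × ℝ → Fin n → ℝ}
    (hQ : P.SmoothTraces (P.Q φ u)) {p : ℝ × ℝ} (h0 : 0 < p.1) (h1 : p.1 < 1) (h2 : 0 < p.2)
    (j : Fin n) :
    fderiv ℝ (P.Q φ u) p (0, 1) j + P.a j p * fderiv ℝ (P.Q φ u) p (1, 0) j +
      P.b j p * P.Q φ u p j = 0 := by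
  have hnhds := halfStrip_mem_nhds h0 h1 h2
  have hp : p ∈ halfStrip := mem_of_mem_nhds hnhds
  have ha := hs.a_ne_zero j hp
  have hdiff : DifferentiableAt ℝ (P.Q φ u) p :=
    ((contDiffOn_Q hs hr hC hQ).contDiffAt hnhds).differentiableAt one_ne_zero
  have hcomp : ∀ v, fderiv ℝ (P.Q φ u) p v j = fderiv ℝ (fun q => P.Q φ u q j) p v := by
    intro v
    rw [fderiv_apply (by exact hdiff)]
    rfl
  have hc := (hasFDerivWithinAt_charInt hs hr hC j (contDiffOn_b_div_a hs hC j) hp).hasFDerivAt hnhds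
  have he := (hasFDerivWithinAt_exitTime hs hr hC j hp).hasFDerivAt hnhds
  have hepos : 0 < P.exitTime j p := h2.trans_le (le_charac_out hs hr j hp.1)
  have hy := (((hQ j).1.contDiffAt (Ici_mem_nhds hepos)).differentiableAt one_ne_zero).hasDerivAt
  have hprod := hc.exp.mul (hy.comp_hasFDerivAt p he)
  have heq : (fun q => P.Q φ u q j) =ᶠ[𝓝 p] fun q =>
      Real.exp (P.charInt j (fun q => P.b j q / P.a j q) q) *
        P.Q φ u (P.outAbscissa j, P.exitTime j q) j := by
    filter_upwards [hnhds] with q hq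
    rw [Q_eq_trace hs hr j hq, weight_out_eq hs hr j hq]
  have hF := hprod.congr_of_eventuallyEq heq
  have hval := heq.self_of_nhds
  beta_reduce at hval
  rw [hcomp, hcomp, hF.fderiv, hval]
  simp only [add_apply, sub_apply, smul_apply, smul_eq_mul, transverse_apply,
    ContinuousLinearMap.coe_fst', Function.comp_apply]
  field_simp
  ring

theorem SmoothInitial.inTrace_eq {φ : ℝ → Fin n → ℝ} (hφ : SmoothInitial φ) : P.inTrace φ = 0 :=
  funext fun j => congrFun (hφ.eventually_out (P := P) j).self_of_nhds j

theorem SmoothInitial.outTrace_eq {φ : ℝ → Fin n → ℝ} (hφ : SmoothInitial φ) :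
    P.outTrace φ = 0 :=
  funext fun j => congrFun (hφ.eventually_in (P := P) j).self_of_nhds j

theorem SmoothInitial.mem_C1h {φ : ℝ → Fin n → ℝ} (hφ : SmoothInitial φ)
    (hzero : ∀ t : ℝ, 0 ≤ t → P.h t 0 = 0) : φ ∈ P.C1h :=
  ⟨⟨hφ.1.continuous.continuousOn, by rw [hφ.outTrace_eq, hφ.inTrace_eq, hzero 0 le_rfl]⟩,
    hφ.1.contDiffOn⟩

/-- For smooth initial functions that vanish near the end points, the iterates of the propagation
operator become stationary on bounded time intervals, and their limit is a classical solution. -/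
theorem exists_classical_solution (hs : P.SpeedBounds) (hr : P.BasicRegularity)
    (hC : P.C1Regularity) (hzero : ∀ t : ℝ, 0 ≤ t → P.h t 0 = 0) {φ : ℝ → Fin n → ℝ}
    (hφ : SmoothInitial φ) :
    ∃ u : ℝ × ℝ → Fin n → ℝ, P.IsContinuousSolution φ u ∧ P.IsPiecewiseC1Solution φ u := by
  choose K hK using exists_iterate_Q_stable hs hr
  set w₀ : ℝ × ℝ → Fin n → ℝ := fun p => φ p.1 with hw₀
  have hφh : φ ∈ P.Ch := (hφ.mem_C1h hzero).1
  have hw₀s : P.SmoothTraces w₀ := by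
    intro j
    have h : (fun s : ℝ => w₀ (P.outAbscissa j, s) j) = fun _ => 0 :=
      funext fun s => congrFun (hφ.eventually_out (P := P) j).self_of_nhds j
    exact ⟨h ▸ contDiffOn_const, Eventually.of_forall fun s => congrFun h s⟩
  have hsmooth : ∀ k, P.SmoothTraces ((P.Q φ)^[k] w₀) := by
    intro k
    induction k with
    | zero => exact hw₀s
    | succ k ih => rw [Function.iterate_succ_apply']; exact ih.Q hs hr hC hzero hφ
  -- The number of iterations depends on the time of the point, since stationarity is uniform only
  -- on bounded time intervals.
  set u : ℝ × ℝ → Fin n → ℝ := fun p => (P.Q φ)^[K p.2] w₀ p with hu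
  have hstat : ∀ T, ∀ k ≥ K T, ∀ p ∈ halfStrip, p.2 ≤ T → u p = (P.Q φ)^[k] w₀ p := by
    intro T k hk p hp hpT
    simp only [hu]
    rw [hK p.2 φ w₀ w₀ _ le_rfl (max k (K p.2)) (le_max_right _ _) p hp le_rfl]
    exact hK T φ w₀ w₀ _ (hk.le.trans (le_max_left _ _)) k hk p hp hpT
  have hfix : ∀ p ∈ halfStrip, u p = P.Q φ u p := by
    intro p hp
    rw [hstat p.2 (K p.2 + 1) (Nat.le_succ _) p hp le_rfl, Function.iterate_succ_apply']
    funext j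
    refine Q_congr hs hr j hp (fun _ => rfl) fun h i => ?_
    rw [hstat p.2 (K p.2) le_rfl _ (mem_halfStrip (P.outAbscissa_mem i) h)
      (charac_in_le hs hr j hp.1)]
  -- Near `p` a single iterate represents `u`. The extra application puts it in the form `Q φ _`, to
  -- which the regularity and the differential equation apply.
  have hloc : ∀ p : ℝ × ℝ, u =ᶠ[𝓝[halfStrip] p] (P.Q φ)^[K (p.2 + 1) + 1] w₀ := by
    intro p
    filter_upwards [self_mem_nhdsWithin, nhdsWithin_le_nhds
      (continuous_snd.continuousAt.eventually_lt continuousAt_const (lt_add_one p.2))] with q hq hqT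
    exact hstat (p.2 + 1) _ (Nat.le_succ _) q hq hqT.le
  have hC1 : ContDiffOn ℝ 1 u halfStrip := by
    intro p hp
    have h1 := hsmooth (K (p.2 + 1) + 1)
    rw [Function.iterate_succ_apply'] at h1
    have h2 := contDiffOn_Q hs hr hC h1 p hp
    rw [← Function.iterate_succ_apply' (P.Q φ)] at h2
    exact h2.congr_of_eventuallyEq (hloc p) ((hloc p).self_of_nhdsWithin hp)
  have hinit : ∀ x ∈ Icc (0 : ℝ) 1, u (x, 0) = φ x := by
    intro x hx
    exact (continuousOn_iterate_Q hs hr hC hφh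
      (hφ.1.continuous.comp continuous_fst).continuousOn (fun _ _ => rfl) _).2 x hx
  refine ⟨u, ⟨⟨hC1.continuousOn, ?_⟩, hinit, hfix⟩, hC1.continuousOn,
    ⟨∅, countable_empty, by simp, fun p hp _ => ⟨hC1 p hp, fun h0 h1 h2 j => ?_⟩⟩, hinit, ?_⟩
  · have h1 : P.outTrace (fun x => u (x, 0)) = P.outTrace φ :=
      funext fun j => congrFun (hinit _ (P.inAbscissa_mem j)) j
    have h2 : P.inTrace (fun x => u (x, 0)) = P.inTrace φ :=
      funext fun j => congrFun (hinit _ (P.outAbscissa_mem j)) j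
    rw [h1, h2]
    exact hφh.2
  · have h := hloc p
    rw [nhdsWithin_eq_nhds.2 (halfStrip_mem_nhds h0 h1 h2)] at h
    have h3 := h.self_of_nhds
    have hQ := hsmooth (K (p.2 + 1) + 1)
    rw [h.fderiv_eq, h3]
    rw [Function.iterate_succ_apply'] at hQ ⊢
    exact pde_Q hs hr hC hQ h0 h1 h2 j
  · intro t ht
    funext j
    change u (P.inAbscissa j, t) j = P.boundaryOp u t j
    have h1 : P.charac j (P.inAbscissa j, t) (P.inAbscissa j) = t :=
      charac_self hs hr j (p := (P.inAbscissa j, t)) (P.inAbscissa_mem j)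
    have hw : P.weight j (P.inAbscissa j) (P.inAbscissa j, t) = 1 :=
      weight_self j (P.inAbscissa j, t)
    rw [hfix _ (mem_halfStrip (P.inAbscissa_mem j) ht), Q_of_nonneg j φ u (by rw [h1]; exact ht), h1, hw, one_mul]

/-! ### Dependence of the iterates on finitely many initial values -/

/-- Times at which one of the characteristics that are traced back through at most `k` reflections
starts at a corner. -/
def cornerTimes (P : HyperbolicProblem n) : ℕ → Set ℝ
  | 0 => {0}
  | k + 1 => {0} ∪ ⋃ i, {t | 0 ≤ t ∧
      P.charac i (P.outAbscissa i, t) (P.inAbscissa i) ∈ cornerTimes P k}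

theorem zero_mem_cornerTimes (k : ℕ) : (0 : ℝ) ∈ P.cornerTimes k := by
  cases k with
  | zero => exact rfl
  | succ k => exact Or.inl rfl

/-- By uniqueness the entry ordinate is an injective function of the exit time, so each reflection
pulls countable sets back to countable sets. -/
theorem countable_cornerTimes (hs : P.SpeedBounds) (hr : P.BasicRegularity) (k : ℕ) :
    (P.cornerTimes k).Countable := by
  induction k with
  | zero => exact countable_singleton 0
  | succ k ih =>
    refine (countable_singleton 0).union (countable_iUnion fun i => ?_)
    refine MapsTo.countable_of_injOn
      (f := fun t => P.charac i (P.outAbscissa i, t) (P.inAbscissa i)) (fun t ht => ht.2) ?_ ih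
    intro t _ t' _ h
    have h1 := charac_eqOn hs hr (p := (P.outAbscissa i, t)) (p' := (P.outAbscissa i, t'))
      (P.outAbscissa_mem i) (P.outAbscissa_mem i) (P.inAbscissa_mem i) h (P.outAbscissa_mem i)
    rwa [charac_self hs hr i (p := (P.outAbscissa i, t)) (P.outAbscissa_mem i),
      charac_self hs hr i (p := (P.outAbscissa i, t')) (P.outAbscissa_mem i)] at h1

/-- Away from the corners, an iterate of `Q_φ` depends on `φ` only at finitely many points. -/
theorem exists_finset_iterate_Q_eq (hs : P.SpeedBounds) (hr : P.BasicRegularity) (k : ℕ) :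
    ∀ (j : Fin n), ∀ p ∈ halfStrip, 0 < p.2 →
      P.charac j p (P.inAbscissa j) ∉ P.cornerTimes k →
      ∃ S : Finset ℝ, ↑S ⊆ Ioo (0 : ℝ) 1 ∧ ∀ (φ φ' : ℝ → Fin n → ℝ) (w : ℝ × ℝ → Fin n → ℝ),
        (∀ x ∈ S, φ x = φ' x) → (P.Q φ)^[k] w p j = (P.Q φ')^[k] w p j := by
  induction k with
  | zero => exact fun j p _ _ _ => ⟨∅, by simp, fun _ _ _ _ => rfl⟩
  | succ k ih =>
    intro j p hp hp2 hcorner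
    rcases lt_or_ge (P.charac j p (P.inAbscissa j)) 0 with h | h
    -- The foot is not the inflow end, where the ordinate is negative, nor the outflow end, where it
    -- is at least `p.2 > 0`.
    · refine ⟨{P.foot j p}, ?_, fun φ φ' w hφ => ?_⟩
      · simp only [Finset.coe_singleton, singleton_subset_iff]
        refine P.mem_Ioo_of_ne j (foot_mem hs hr j hp) (foot_ne_inAbscissa hs hr j hp h) ?_
        intro h1
        have h2 := charac_foot_eq_zero hs hr j hp h
        rw [h1] at h2
        have h3 := le_charac_out hs hr j hp.1
        linarith
      · rw [Function.iterate_succ_apply', Function.iterate_succ_apply']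
        refine Q_congr hs hr j hp (fun _ => ?_) fun h' => absurd h h'.not_gt
        rw [hφ _ (Finset.mem_singleton_self _)]
    · set τ := P.charac j p (P.inAbscissa j) with hτ
      have hτ0 : τ ≠ 0 := fun h0 => hcorner (h0 ▸ zero_mem_cornerTimes _)
      have hτpos : 0 < τ := lt_of_le_of_ne h hτ0.symm
      -- At the positive entry time the boundary condition calls for all `n` outgoing traces; each
      -- is traced back one level further.
      have hS : ∀ i, ∃ S : Finset ℝ, ↑S ⊆ Ioo (0 : ℝ) 1 ∧
          ∀ (φ φ' : ℝ → Fin n → ℝ) (w : ℝ × ℝ → Fin n → ℝ), (∀ x ∈ S, φ x = φ' x) →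
            (P.Q φ)^[k] w (P.outAbscissa i, τ) i = (P.Q φ')^[k] w (P.outAbscissa i, τ) i := by
        intro i
        refine ih i _ (mem_halfStrip (P.outAbscissa_mem i) h) hτpos fun h' => hcorner ?_
        exact Or.inr (mem_iUnion.2 ⟨i, h, h'⟩)
      choose S hS1 hS2 using hS
      refine ⟨Finset.univ.biUnion S, ?_, fun φ φ' w hφ => ?_⟩
      · rw [Finset.coe_biUnion]
        exact iUnion₂_subset fun i _ => hS1 i
      · rw [Function.iterate_succ_apply', Function.iterate_succ_apply']
        refine Q_congr hs hr j hp (fun h' => absurd h' h.not_gt) fun _ i => ?_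
        exact hS2 i φ φ' w fun x hx => hφ x (Finset.mem_biUnion.2 ⟨i, Finset.mem_univ i, hx⟩)

/-- Interpolation with one bump function per point, supported in the open interval away from the
other points. -/
theorem exists_smoothInitial_eq (φ : ℝ → Fin n → ℝ) (S : Finset ℝ) (hS : ↑S ⊆ Ioo (0 : ℝ) 1) :
    ∃ φ' : ℝ → Fin n → ℝ, SmoothInitial φ' ∧ ∀ x ∈ S, φ x = φ' x := by
  have hχ : ∀ x : ℝ, x ∈ S → ∃ χ : ℝ → ℝ, ContDiff ℝ 1 χ ∧ χ x = 1 ∧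
      (∀ y ∈ S, y ≠ x → χ y = 0) ∧ χ =ᶠ[𝓝 0] 0 ∧ χ =ᶠ[𝓝 1] 0 := by
    intro x hx
    have hU : Ioo (0 : ℝ) 1 \ ((S.erase x : Finset ℝ) : Set ℝ) ∈ 𝓝 x :=
      (isOpen_Ioo.sdiff (S.erase x).finite_toSet.isClosed).mem_nhds ⟨hS hx, by simp⟩
    obtain ⟨χ, h1, -, h3, -, h5⟩ := exists_contDiff_tsupport_subset (n := 1) hU
    refine ⟨χ, h3, h5, fun y hy hyx => ?_, ?_, ?_⟩
    · refine image_eq_zero_of_notMem_tsupport fun h => (h1 h).2 ?_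
      simp [hy, hyx]
    · exact notMem_tsupport_iff_eventuallyEq.1 fun h => lt_irrefl _ (h1 h).1.1
    · exact notMem_tsupport_iff_eventuallyEq.1 fun h => lt_irrefl _ (h1 h).1.2
  choose! χ h1 h2 h3 h4 h5 using hχ
  refine ⟨fun y => ∑ x ∈ S, χ x y • φ x, ⟨?_, ?_, ?_⟩, fun y hy => ?_⟩
  · exact ContDiff.sum fun x hx => (h1 x hx).smul contDiff_const
  · filter_upwards [(Finset.eventually_all S).2 fun x hx => h4 x hx] with y hy
    exact Finset.sum_eq_zero fun x hx => by rw [hy x hx]; simp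
  · filter_upwards [(Finset.eventually_all S).2 fun x hx => h5 x hx] with y hy
    exact Finset.sum_eq_zero fun x hx => by rw [hy x hx]; simp
  · beta_reduce
    rw [Finset.sum_eq_single_of_mem y hy fun x hx hxy => by rw [h3 x hx y hy hxy.symm, zero_smul],
      h2 y hy, one_smul]

/-- If all classical solutions with smooth initial data that vanish near the end points vanish at
some time, then so do sufficiently high iterates of the propagation operator. -/
theorem propagationVanishes_of_smooth (hs : P.SpeedBounds) (hr : P.BasicRegularity)
    (hC : P.C1Regularity) (hzero : ∀ t : ℝ, 0 ≤ t → P.h t 0 = 0) {T : ℝ} (hT : 0 < T)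
    (h : ∀ (φ : ℝ → Fin n → ℝ) (u : ℝ × ℝ → Fin n → ℝ), SmoothInitial φ →
      P.IsContinuousSolution φ u → P.IsPiecewiseC1Solution φ u →
      ∀ x ∈ Icc (0 : ℝ) 1, u (x, T) = 0) : P.PropagationVanishes := by
  obtain ⟨K, hK⟩ := exists_iterate_Q_stable hs hr T
  refine ⟨T, hT, K, fun w hw x hx => ?_⟩
  have hφ : (fun y => w (y, 0)) ∈ P.Ch :=
    ⟨hw.1.comp (by fun_prop) fun y hy => mem_halfStrip hy le_rfl, hw.2⟩
  have hcont : ContinuousOn (fun x => (P.Q (fun y => w (y, 0)))^[K] w (x, T)) (Icc 0 1) :=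
    (continuousOn_iterate_Q hs hr hC hφ hw.1 (fun _ _ => rfl) K).1.comp (by fun_prop)
      fun y hy => mem_halfStrip hy hT.le
  funext j
  -- The exceptional points. Two points of the line `t = T` with the same entry ordinate share a
  -- characteristic and so coincide by strict monotonicity; hence `B` is countable.
  set B : Set ℝ := {x | x ∈ Icc (0 : ℝ) 1 ∧
    P.charac j (x, T) (P.inAbscissa j) ∈ P.cornerTimes K} with hB
  have hBc : B.Countable := by
    refine MapsTo.countable_of_injOn (f := fun x => P.charac j (x, T) (P.inAbscissa j))
      (fun x hx => hx.2) ?_ (countable_cornerTimes hs hr K)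
    intro x hx x' hx' hxx
    have h1 := charac_eqOn hs hr (p := (x, T)) (p' := (x', T)) hx.1 hx'.1
      (P.inAbscissa_mem j) hxx hx.1
    have h2 : P.charac j (x, T) x = T := charac_self hs hr j (p := (x, T)) hx.1
    have h3 : P.charac j (x', T) x' = T := charac_self hs hr j (p := (x', T)) hx'.1
    replace h1 : P.charac j (x', T) x = P.charac j (x', T) x' := (h1.symm.trans h2).trans h3.symm
    exact dir_mul_injective j (le_antisymm
      ((charac_le_iff hs hr j (p := (x', T)) hx'.1 hx.1 hx'.1).1 h1.le)
      ((charac_le_iff hs hr j (p := (x', T)) hx'.1 hx'.1 hx.1).1 h1.ge))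
  have hgood : ∀ y ∈ Icc (0 : ℝ) 1, y ∉ B → (P.Q (fun y => w (y, 0)))^[K] w (y, T) j = 0 := by
    intro y hy hyB
    have hp : (y, T) ∈ halfStrip := mem_halfStrip hy hT.le
    obtain ⟨S, hS1, hS2⟩ := exists_finset_iterate_Q_eq hs hr K j (y, T) hp hT
      fun h' => hyB ⟨hy, h'⟩
    obtain ⟨φ', hφ', hφS⟩ := exists_smoothInitial_eq (fun y => w (y, 0)) S hS1
    obtain ⟨u, hu1, hu2⟩ := exists_classical_solution hs hr hC hzero hφ'
    -- First the initial function is exchanged for the smooth one, then `w` for its classical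
    -- solution, which vanishes at time `T`.
    rw [hS2 _ φ' w hφS, hK φ' w u K le_rfl K le_rfl _ hp le_rfl,
      iterate_Q_eq_of_fixed hs hr hu1.2.2 K _ hp, h φ' u hφ' hu1 hu2 y hy]
    rfl
  have hae : (fun x => (P.Q (fun y => w (y, 0)))^[K] w (x, T) j)
      =ᵐ[volume.restrict (Icc (0 : ℝ) 1)] fun _ => 0 := by
    rw [EventuallyEq, ae_restrict_iff' measurableSet_Icc]
    filter_upwards [hBc.ae_notMem volume] with y hyB hy
    exact hgood y hy hyB
  exact Measure.eqOn_Icc_of_ae_eq volume zero_ne_one hae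
    ((continuous_apply j).comp_continuousOn hcont) continuousOn_const hx

end HyperbolicProblem

/-! ### Density and distances in `L²` -/

/-- A smooth function that is equal to `1` on `[η, 1 - η]` and vanishes near `0` and `1`. -/
theorem exists_cutoff_eq_one {η : ℝ} (hη : 0 < η) :
    ∃ χ : ℝ → ℝ, ContDiff ℝ 1 χ ∧ χ =ᶠ[𝓝 0] 0 ∧ χ =ᶠ[𝓝 1] 0 ∧ (∀ x, χ x ∈ Icc (0 : ℝ) 1) ∧
      ∀ x ∈ Icc η (1 - η), χ x = 1 := by
  have hχ : ContDiff ℝ 1 fun x : ℝ => Real.smoothTransition (2 * x / η - 1) *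
      Real.smoothTransition (2 * (1 - x) / η - 1) :=
    (Real.smoothTransition.contDiff.comp (by fun_prop)).mul
      (Real.smoothTransition.contDiff.comp (by fun_prop))
  have hz : ∀ y : ℝ, y < η / 2 → Real.smoothTransition (2 * y / η - 1) = 0 := by
    intro y hy
    refine Real.smoothTransition.zero_of_nonpos ?_
    rw [sub_nonpos, div_le_one hη]
    linarith
  have ho : ∀ y : ℝ, η ≤ y → Real.smoothTransition (2 * y / η - 1) = 1 := by
    intro y hy
    refine Real.smoothTransition.one_of_one_le ?_
    rw [le_sub_iff_add_le, le_div_iff₀ hη]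
    linarith
  refine ⟨_, hχ, ?_, ?_, fun x => ⟨?_, ?_⟩, fun x hx => ?_⟩
  · filter_upwards [Iio_mem_nhds (show (0 : ℝ) < η / 2 by positivity)] with x hx
    simp [hz x hx]
  · filter_upwards [Ioi_mem_nhds (show 1 - η / 2 < (1 : ℝ) by linarith)] with x hx
    have hx' : 1 - η / 2 < x := hx
    simp [hz (1 - x) (by linarith)]
  · exact mul_nonneg (Real.smoothTransition.nonneg _) (Real.smoothTransition.nonneg _)
  · exact mul_le_one₀ (Real.smoothTransition.le_one _) (Real.smoothTransition.nonneg _)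
      (Real.smoothTransition.le_one _)
  · simp only [ho x hx.1, ho (1 - x) (by linarith [hx.2]), mul_one]

/-- Smooth functions that vanish near the end points are dense in `L²(0,1)ⁿ`. -/
theorem exists_smoothInitial_l2Dist_lt {n : ℕ} (φ : L2Space n) {ε : ℝ} (hε : 0 < ε) :
    ∃ φ' : ℝ → Fin n → ℝ, HyperbolicProblem.SmoothInitial φ' ∧
      l2Dist φ' φ ≤ ENNReal.ofReal ε := by
  set μ := volume.restrict (Ioo (0 : ℝ) 1) with hμ
  obtain ⟨g, hg1, hg2, hg3⟩ := (Lp.memLp φ).exist_eLpNorm_sub_le (by simp) (by norm_num)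
    (half_pos hε)
  have hgL : MemLp g 2 μ := hg2.continuous.memLp_of_hasCompactSupport hg1
  -- Sets of measure at most `δ` carry `L²`-norm at most `ε / 2` of `g`. Cutting off two end strips
  -- of width `δ / 2` therefore costs no more than that.
  obtain ⟨δ, hδ, hind⟩ := hgL.eLpNorm_indicator_le (by norm_num) (by simp) (half_pos hε)
  obtain ⟨χ, hχ1, hχ2, hχ3, hχ4, hχ5⟩ := exists_cutoff_eq_one (half_pos hδ)
  have hS : MeasurableSet (Icc (δ / 2) (1 - δ / 2))ᶜ := measurableSet_Icc.compl
  have hμS : μ (Icc (δ / 2) (1 - δ / 2))ᶜ ≤ ENNReal.ofReal δ := by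
    rw [hμ, Measure.restrict_apply hS]
    calc volume ((Icc (δ / 2) (1 - δ / 2))ᶜ ∩ Ioo (0 : ℝ) 1)
        ≤ volume (Ioo 0 (δ / 2) ∪ Ioo (1 - δ / 2) 1) := by
          refine measure_mono fun x hx => ?_
          by_cases h : x < δ / 2
          · exact Or.inl ⟨hx.2.1, h⟩
          · exact Or.inr ⟨not_le.1 fun h' => hx.1 ⟨not_lt.1 h, h'⟩, hx.2.2⟩
      _ ≤ volume (Ioo 0 (δ / 2)) + volume (Ioo (1 - δ / 2) 1) := measure_union_le _ _
      _ = ENNReal.ofReal δ := by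
          rw [Real.volume_Ioo, Real.volume_Ioo, ← ENNReal.ofReal_add (by linarith) (by linarith)]
          congr 1
          ring
  have hcut : eLpNorm (fun x => χ x • g x - g x) 2 μ ≤ ENNReal.ofReal (ε / 2) := by
    refine (eLpNorm_mono fun x => ?_).trans (hind _ hS hμS)
    by_cases hx : x ∈ Icc (δ / 2) (1 - δ / 2)
    · simp [hχ5 x hx]
    · rw [indicator_of_mem hx, show χ x • g x - g x = (χ x - 1) • g x by rw [sub_smul, one_smul],
        norm_smul]
      refine mul_le_of_le_one_left (norm_nonneg _) ?_
      rw [Real.norm_eq_abs, abs_le]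
      constructor <;> linarith [(hχ4 x).1, (hχ4 x).2]
  have hsm : ContDiff ℝ 1 fun x => χ x • g x :=
    hχ1.smul (hg2.of_le (by exact_mod_cast le_top))
  refine ⟨fun x => WithLp.ofLp (χ x • g x), ⟨?_, ?_, ?_⟩, ?_⟩
  · exact (PiLp.continuousLinearEquiv 2 ℝ fun _ : Fin n => ℝ).contDiff.comp hsm
  · filter_upwards [hχ2] with x hx
    simp [hx]
  · filter_upwards [hχ3] with x hx
    simp [hx]
  · have hsplit : (fun x => WithLp.toLp 2 (WithLp.ofLp (χ x • g x)) - φ x)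
        = (fun x => χ x • g x - g x) + (g - φ) := by
      ext1 x
      simp
    rw [l2Dist, hsplit]
    refine (eLpNorm_add_le (hsm.continuous.sub hg2.continuous).aestronglyMeasurable
      (hg2.continuous.aestronglyMeasurable.sub (Lp.aestronglyMeasurable φ)) (by norm_num)).trans ?_
    rw [eLpNorm_sub_comm g]
    refine (add_le_add hcut hg3).trans ?_
    rw [← ENNReal.ofReal_add (half_pos hε).le (half_pos hε).le, add_halves]

theorem tendsto_ofReal_one_div_add_one :
    Tendsto (fun l : ℕ => ENNReal.ofReal (1 / ((l : ℝ) + 1))) atTop (𝓝 0) := by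
  simpa using ENNReal.tendsto_ofReal (tendsto_one_div_add_atTop_nhds_zero_nat (𝕜 := ℝ))

/-- A function on `[0,1]` at `L²`-distance zero from `0` is zero if it is continuous. -/
theorem eq_zero_of_l2Dist_eq_zero {n : ℕ} {f : ℝ → Fin n → ℝ} (hf : ContinuousOn f (Icc 0 1))
    (h : l2Dist f 0 = 0) : ∀ x ∈ Icc (0 : ℝ) 1, f x = 0 := by
  have hc : ContinuousOn (fun x => WithLp.toLp 2 (f x)) (Icc 0 1) :=
    (PiLp.continuous_toLp 2 _).comp_continuousOn hf
  have h0 : (fun x => WithLp.toLp 2 (f x) - (0 : L2Space n) x)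
      =ᵐ[volume.restrict (Ioo (0 : ℝ) 1)] fun x => WithLp.toLp 2 (f x) := by
    filter_upwards [Lp.coeFn_zero (EuclideanSpace ℝ (Fin n)) 2
      (volume.restrict (Ioo (0 : ℝ) 1))] with x hx
    rw [hx]
    exact sub_zero _
  have hm : AEStronglyMeasurable (fun x => WithLp.toLp 2 (f x))
      (volume.restrict (Ioo (0 : ℝ) 1)) :=
    (hc.mono Ioo_subset_Icc_self).aestronglyMeasurable measurableSet_Ioo
  rw [l2Dist, eLpNorm_congr_ae h0, eLpNorm_eq_zero_iff hm (by norm_num)] at h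
  rw [restrict_Ioo_eq_restrict_Icc] at h
  intro x hx
  have := Measure.eqOn_Icc_of_ae_eq volume zero_ne_one h hc continuousOn_const hx
  simpa using congrArg WithLp.ofLp this

theorem eq_zero_of_l2Dist_zero_eq_zero {n : ℕ} {f : ℝ → Fin n → ℝ}
    (hf : ∀ x ∈ Icc (0 : ℝ) 1, f x = 0) {g : L2Space n} (h : l2Dist f g = 0) : g = 0 := by
  have h0 : (fun x => WithLp.toLp 2 (f x) - g x)
      =ᵐ[volume.restrict (Ioo (0 : ℝ) 1)] -g := by
    rw [EventuallyEq, ae_restrict_iff' measurableSet_Ioo]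
    refine Eventually.of_forall fun x hx => ?_
    simp [hf x (Ioo_subset_Icc_self hx)]
  rw [l2Dist, eLpNorm_congr_ae h0, eLpNorm_neg,
    eLpNorm_eq_zero_iff (Lp.aestronglyMeasurable g) (by norm_num)] at h
  exact (Lp.eq_zero_iff_ae_eq_zero).2 h

/-! ### The case of `L²`-generalized solutions -/

namespace HyperbolicProblem

variable {n : ℕ} {P : HyperbolicProblem n}

theorem SmoothInitial.exists_l2Dist_eq_zero {φ : ℝ → Fin n → ℝ} (hφ : SmoothInitial φ) :
    ∃ Φ : L2Space n, l2Dist φ Φ = 0 := by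
  have hc : Continuous fun x => (WithLp.toLp 2 (φ x) : EuclideanSpace ℝ (Fin n)) :=
    (PiLp.continuous_toLp 2 _).comp hφ.1.continuous
  obtain ⟨M, hM⟩ := (isCompact_Icc (a := (0 : ℝ)) (b := 1)).exists_bound_of_continuousOn
    hc.continuousOn
  have hL : MemLp (fun x => (WithLp.toLp 2 (φ x) : EuclideanSpace ℝ (Fin n))) 2
      (volume.restrict (Ioo (0 : ℝ) 1)) := by
    refine MemLp.of_bound hc.aestronglyMeasurable M ?_
    rw [ae_restrict_iff' measurableSet_Ioo]
    exact Eventually.of_forall fun x hx => hM x (Ioo_subset_Icc_self hx)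
  refine ⟨hL.toLp, ?_⟩
  rw [l2Dist, eLpNorm_congr_ae (g := 0), eLpNorm_zero]
  filter_upwards [hL.coeFn_toLp] with x hx
  simp [hx]

theorem IsL2Solution.tendsto_l2Dist {φ : L2Space n} {U : ℝ → L2Space n} (hU : P.IsL2Solution φ U)
    {φl : ℕ → ℝ → Fin n → ℝ} {ul : ℕ → ℝ × ℝ → Fin n → ℝ} (hφl : ∀ l, φl l ∈ P.C1h)
    (hlim : Tendsto (fun l => l2Dist (φl l) φ) atTop (𝓝 0))
    (hul : ∀ l, P.IsPiecewiseC1Solution (φl l) (ul l)) {t : ℝ} (ht : 0 < t) :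
    Tendsto (fun l => l2Dist (fun x => ul l (x, t)) (U t)) atTop (𝓝 0) :=
  tendsto_of_tendsto_of_tendsto_of_le_of_le tendsto_const_nhds (hU.2 φl ul hφl hlim hul t ht)
    (fun _ => zero_le) fun l => le_iSup₂_of_le
      (f := fun s (_ : s ∈ Icc 0 t) => l2Dist (fun x => ul l (x, s)) (U s)) t ⟨ht.le, le_rfl⟩ le_rfl

/-- Finite time stabilizability in the sense of `L²`-generalized solutions is equivalent to the
vanishing of a power of the propagation operator. -/
theorem isFTSL2_iff (hs : P.SpeedBounds) (hr : P.BasicRegularity) (hC : P.C1Regularity)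
    (hzero : ∀ t : ℝ, 0 ≤ t → P.h t 0 = 0)
    (hex : ∀ φ : L2Space n, ∃ u : ℝ → L2Space n, P.IsL2Solution φ u) :
    P.IsFTSL2 ↔ P.PropagationVanishes := by
  constructor
  · rintro ⟨T, hT, h⟩
    refine propagationVanishes_of_smooth hs hr hC hzero (by linarith : 0 < T + 1)
      fun φ u hφ hu hu' => ?_
    obtain ⟨Φ, hΦ⟩ := hφ.exists_l2Dist_eq_zero
    obtain ⟨U, hU⟩ := hex Φ
    -- The constant sequence `φ` is admissible and identifies the generalized solution with the
    -- classical one at time `T + 1`, where the former vanishes.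
    have hlim := hU.tendsto_l2Dist (φl := fun _ => φ) (ul := fun _ => u)
      (fun _ => hφ.mem_C1h hzero) (by simp [hΦ]) (fun _ => hu') (by linarith : 0 < T + 1)
    rw [h Φ U hU (T + 1) (by linarith)] at hlim
    refine eq_zero_of_l2Dist_eq_zero (hu'.1.comp (by fun_prop) fun x hx => ?_)
      (tendsto_nhds_unique tendsto_const_nhds hlim)
    exact ⟨hx, by simp; linarith⟩
  · intro h
    obtain ⟨T, hT, hvan⟩ := eq_zero_of_propagationVanishes hs hr hzero h
    refine ⟨T, hT, fun φ U hU t ht => ?_⟩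
    -- The definition of a generalized solution may be tested with any approximating sequence; this
    -- one has classical solutions that are known to exist and to vanish from `T` on.
    choose φl hφl hφl' using fun l : ℕ =>
      exists_smoothInitial_l2Dist_lt φ (ε := 1 / ((l : ℝ) + 1)) (by positivity)
    choose ul hul hul' using fun l => exists_classical_solution hs hr hC hzero (hφl l)
    have hlim := hU.tendsto_l2Dist (fun l => (hφl l).mem_C1h hzero)
      (tendsto_of_tendsto_of_tendsto_of_le_of_le tendsto_const_nhds
        tendsto_ofReal_one_div_add_one (fun _ => zero_le) hφl') hul' (hT.trans ht)
    have hz : ∀ l, ∀ x ∈ Icc (0 : ℝ) 1, ul l (x, t) = 0 := fun l x hx =>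
      hvan _ _ (hul l) x hx t ht.le
    have hconst : ∀ l, l2Dist (fun x => ul l (x, t)) (U t) = l2Dist (fun _ => 0) (U t) := by
      intro l
      refine eLpNorm_congr_ae ?_
      rw [EventuallyEq, ae_restrict_iff' measurableSet_Ioo]
      refine Eventually.of_forall fun x hx => ?_
      simp only [hz l x (Ioo_subset_Icc_self hx)]
    simp only [hconst] at hlim
    exact eq_zero_of_l2Dist_zero_eq_zero (fun _ _ => rfl)
      (tendsto_nhds_unique tendsto_const_nhds hlim)

end HyperbolicProblem

theorem mainTheorem2 {n : ℕ} (hn : 2 ≤ n) (P : HyperbolicProblem n) (hm : P.m ≤ n)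
    (hspeed : P.SpeedBounds) (hreg : P.BasicRegularity) (hgrowth : P.GrowthCondition)
    (hzero : ∀ t : ℝ, 0 ≤ t → P.h t 0 = 0) :
    (P.C1Regularity →
      (∀ φ : L2Space n, ∃ u : ℝ → L2Space n, P.IsL2Solution φ u) →
      (P.IsFTSL2 ↔ P.PropagationVanishes)) ∧
    ((∀ φ ∈ P.Ch, ∃ u : ℝ × ℝ → Fin n → ℝ, P.IsContinuousSolution φ u) →
      (P.IsFTSContinuous ↔ P.PropagationVanishes)) :=
  ⟨fun hC hex => HyperbolicProblem.isFTSL2_iff hspeed hreg hC hzero hex,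
    fun hex => HyperbolicProblem.isFTSContinuous_iff hspeed hreg hzero hex⟩
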